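/- Let $\mathfrak g=\mathfrak g_0\oplus\mathfrak g_1$ be a finite-dimensional Lie superalgebra over $\mathbb C$. Filter $U(\mathfrak g)$ by giving elements of $\mathfrak g_1$ degree $1$ and elements of $\mathfrak g_0$ degree $2$: $U_n$ is the span of all products of homogeneous elements of $\mathfrak g$ of total degree at most $n$. Let $\operatorname{gr}U(\mathfrak g)=\bigoplus_n U_n/U_{n-1}$, in which $S(\mathfrak g_0)$ is a central subalgebra. For a prime ideal $q$ of $S(\mathfrak g_0)$ let $F_q$ be the field of fractions of $S(\mathfrak g_0)/q$, let $k(q)$ be the rank of the symmetric $F_q$-bilinear form on $\mathfrak g_1\otimes F_q$ that extends the bracket $\mathfrak g_1\times\mathfrak g_1\to\mathfrak g_0\to F_q$, and put $\ell(q)=\lfloor (k(q)+1)/2\rfloor$. Let $T$ be the Clifford algebra of this form (with relations $xy+yx=[x,y]$ for $x,y\in\mathfrak g_1$) and $C_q=T/N_T$, where $N_T$ is the ideal generated by the radical of the form. $C_q$ is called split if its simple modules have dimension $2^{\ell(q)}$ over $F_q$. For a nonzero finitely generated graded $S(\mathfrak g_0)$-module $N=\bigoplus_{m\ge 0}N(m)$,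 where $\mathfrak g_0$ has degree $1$, write $\dim\bigoplus_{m\le n}N(m)=a_d\binom nd+\dots+a_0$ for $n\gg0$ with $a_d\neq0$, and put $d(N)=d$, $e(N)=a_d$. For a graded $\operatorname{gr}U(\mathfrak g)$-module $N$ (on which $\mathfrak g_0$ acts with degree $2$) these are taken for the $S(\mathfrak g_0)$-module $N$ with the grading whose components are $N(2m-1)\oplus N(2m)$; that is, $\dim\bigoplus_{m\le 2n}N(m)=a_d\binom nd+\dots+a_0$ for $n\gg0$. Let $N=\bigoplus_{m\ge0}N(m)$ be a finitely generated graded $\operatorname{gr}U(\mathfrak g)$-module such that $q=\operatorname{ann}_{S(\mathfrak g_0)}N$ is prime (so that $N\ne0$) and $N$ is torsion-free as an $S(\mathfrak g_0)/q$-module. Let $\mathcal V\subseteq\mathfrak g_0^*$ be the closed set defined by $q$, and put $\ell(\mathcal V)=\ell(q)$ and $e(\mathcal V)=e(S(\mathfrak g_0)/q)$. Then $$d(N)=d(S(\mathfrak g_0)/q)\quad\text{and}\quad e(N)\ge 2^{\ell(\mathcal V)}e(\mathcal V).$$ Furthermore, if $e(N)=2^{\ell(\mathcal V)}e(\mathcal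 V)$, then $C_q$ is split. -/

import Mathlib

open scoped DirectSum TensorProduct

noncomputable section

/-! ### The associated graded algebra of a filtered algebra -/

/-- An increasing multiplicative filtration `F 0 ⊆ F 1 ⊆ ...`
of a complex algebra. -/
structure AlgFiltration (A : Type*) [Ring A] [Algebra ℂ A] where
  F : ℕ → Submodule ℂ A
  mono : Monotone F
  one_mem : (1 : A) ∈ F 0
  mul_mem : ∀ {i j : ℕ} {a b : A}, a ∈ F i → b ∈ F j → a * b ∈ F (i + j)

namespace AlgFiltration

variable {A : Type*} [Ring A] [Algebra ℂ A] (Φ : AlgFiltration A)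

/-- The previous step `F (n - 1)` of the filtration, with the convention `F (-1) = 0`. -/
def prev : ℕ → Submodule ℂ A
  | 0 => ⊥
  | n + 1 => Φ.F n

/-- The homogeneous component `F n / F (n - 1)`. -/
def Piece (n : ℕ) : Type _ := Φ.F n ⧸ (Φ.prev n).submoduleOf (Φ.F n)

instance (n : ℕ) : AddCommGroup (Φ.Piece n) :=
  inferInstanceAs (AddCommGroup (Φ.F n ⧸ (Φ.prev n).submoduleOf (Φ.F n)))

instance (n : ℕ) : Module ℂ (Φ.Piece n) :=
  inferInstanceAs (Module ℂ (Φ.F n ⧸ (Φ.prev n).submoduleOf (Φ.F n)))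

/-- The class of an element of `F n` in `F n / F (n - 1)`. -/
def cls (n : ℕ) : Φ.F n →ₗ[ℂ] Φ.Piece n := ((Φ.prev n).submoduleOf (Φ.F n)).mkQ

theorem cls_eq_zero {n : ℕ} {a : Φ.F n} (h : (a : A) ∈ Φ.prev n) : Φ.cls n a = 0 :=
  (Submodule.Quotient.mk_eq_zero _).2 h

theorem prev_mul {i j : ℕ} {a b : A} (ha : a ∈ Φ.prev i) (hb : b ∈ Φ.F j) :
    a * b ∈ Φ.prev (i + j) := by
  cases i with
  | zero =>
    have : a = 0 := by simpa [prev] using ha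
    simp [this]
  | succ i =>
    rw [Nat.add_right_comm]
    exact Φ.mul_mem ha hb

theorem mul_prev {i j : ℕ} {a b : A} (ha : a ∈ Φ.F i) (hb : b ∈ Φ.prev j) :
    a * b ∈ Φ.prev (i + j) := by
  cases j with
  | zero =>
    have : b = 0 := by simpa [prev] using hb
    simp [this]
  | succ j => exact Φ.mul_mem ha hb

/-- Multiplication `F i × F j → F (i + j)`. -/
def mulF (i j : ℕ) : Φ.F i →ₗ[ℂ] Φ.F j →ₗ[ℂ] Φ.F (i + j) :=
  LinearMap.mk₂ ℂ (fun a b => ⟨a * b, Φ.mul_mem a.2 b.2⟩)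
    (fun _ _ _ => Subtype.ext (add_mul _ _ _))
    (fun _ _ _ => Subtype.ext (smul_mul_assoc _ _ _))
    (fun _ _ _ => Subtype.ext (mul_add _ _ _))
    (fun _ _ _ => Subtype.ext (mul_smul_comm _ _ _))

/-- The multiplication induced on homogeneous components: the product of the class of `a`
and the class of `b` is the class of `a * b`. -/
def mulPiece (i j : ℕ) : Φ.Piece i →ₗ[ℂ] Φ.Piece j →ₗ[ℂ] Φ.Piece (i + j) :=
  Submodule.liftQ _
    { toFun := fun a => Submodule.liftQ _ ((Φ.cls (i + j)).comp (Φ.mulF i j a))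
        (fun b hb => Φ.cls_eq_zero (Φ.mul_prev a.2 hb))
      map_add' := fun a b => by
        apply Submodule.linearMap_qext
        ext c
        exact congrArg (Φ.cls (i + j)) (LinearMap.map_add₂ (Φ.mulF i j) a b c)
      map_smul' := fun r a => by
        apply Submodule.linearMap_qext
        ext c
        exact congrArg (Φ.cls (i + j)) (LinearMap.map_smul₂ (Φ.mulF i j) r a c) }
    (fun a ha => by
      apply Submodule.linearMap_qext
      ext b
      exact Φ.cls_eq_zero (Φ.prev_mul ha b.2))

theorem mulPiece_cls {i j : ℕ} (a : Φ.F i) (b : Φ.F j) :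
    Φ.mulPiece i j (Φ.cls i a) (Φ.cls j b) =
      Φ.cls (i + j) ⟨a * b, Φ.mul_mem a.2 b.2⟩ := rfl

theorem cls_surjective (n : ℕ) : Function.Surjective (Φ.cls n) :=
  Submodule.mkQ_surjective _

theorem mk_cls_eq {i j : ℕ} (h : i = j) {a b : A} (hab : a = b) (ha : a ∈ Φ.F i)
    (hb : b ∈ Φ.F j) :
    (GradedMonoid.mk i (Φ.cls i ⟨a, ha⟩) : GradedMonoid Φ.Piece) =
      GradedMonoid.mk j (Φ.cls j ⟨b, hb⟩) := by
  subst h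
  subst hab
  rfl

instance : GradedMonoid.GOne Φ.Piece where
  one := Φ.cls 0 ⟨1, Φ.one_mem⟩

instance : GradedMonoid.GMul Φ.Piece where
  mul {i j} a b := Φ.mulPiece i j a b

instance : GradedMonoid.GMonoid Φ.Piece where
  one_mul := by
    rintro ⟨i, a⟩
    obtain ⟨a, rfl⟩ := Φ.cls_surjective i a
    exact Φ.mk_cls_eq (zero_add i) (one_mul _) _ _
  mul_one := by
    rintro ⟨i, a⟩
    obtain ⟨a, rfl⟩ := Φ.cls_surjective i a
    exact Φ.mk_cls_eq (add_zero i) (mul_one _) _ _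
  mul_assoc := by
    rintro ⟨i, a⟩ ⟨j, b⟩ ⟨k, c⟩
    obtain ⟨a, rfl⟩ := Φ.cls_surjective i a
    obtain ⟨b, rfl⟩ := Φ.cls_surjective j b
    obtain ⟨c, rfl⟩ := Φ.cls_surjective k c
    exact Φ.mk_cls_eq (add_assoc i j k) (mul_assoc _ _ _) _ _

instance : DirectSum.GRing Φ.Piece where
  mul_zero _ := map_zero _
  zero_mul _ := LinearMap.map_zero₂ _ _
  mul_add _ _ _ := map_add _ _ _
  add_mul _ _ _ := LinearMap.map_add₂ _ _ _ _
  natCast n := (n : ℕ) • Φ.cls 0 ⟨1, Φ.one_mem⟩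
  natCast_zero := zero_smul _ _
  natCast_succ _ := succ_nsmul _ _
  intCast n := (n : ℤ) • Φ.cls 0 ⟨1, Φ.one_mem⟩
  intCast_ofNat _ := natCast_zsmul _ _
  intCast_negSucc_ofNat _ := negSucc_zsmul _ _

instance : DirectSum.GAlgebra ℂ Φ.Piece where
  toFun := ((LinearMap.toSpanSingleton ℂ (Φ.Piece 0) (Φ.cls 0 ⟨1, Φ.one_mem⟩))).toAddMonoidHom
  map_one := one_smul ℂ (Φ.cls 0 ⟨1, Φ.one_mem⟩)
  map_mul r s := Φ.mk_cls_eq (a := (r * s) • (1 : A)) (b := (r • (1 : A)) * (s • (1 : A)))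
    (zero_add 0).symm (by simp [mul_smul, smul_comm r s])
    ((Φ.F 0).smul_mem _ Φ.one_mem)
    (Φ.mul_mem ((Φ.F 0).smul_mem _ Φ.one_mem) ((Φ.F 0).smul_mem _ Φ.one_mem))
  commutes r := by
    rintro ⟨i, a⟩
    obtain ⟨a, rfl⟩ := Φ.cls_surjective i a
    exact Φ.mk_cls_eq (a := (r • (1 : A)) * (a : A)) (b := (a : A) * (r • (1 : A)))
      (add_comm 0 i) (by simp)
      (Φ.mul_mem ((Φ.F 0).smul_mem _ Φ.one_mem) a.2)
      (Φ.mul_mem a.2 ((Φ.F 0).smul_mem _ Φ.one_mem))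
  smul_def r := by
    rintro ⟨i, a⟩
    obtain ⟨a, rfl⟩ := Φ.cls_surjective i a
    exact Φ.mk_cls_eq (a := r • (a : A)) (b := (r • (1 : A)) * (a : A))
      (zero_add i).symm (by simp) ((Φ.F i).smul_mem _ a.2)
      (Φ.mul_mem ((Φ.F 0).smul_mem _ Φ.one_mem) a.2)

/-- The associated graded algebra `⨁ n, F n / F (n - 1)`. -/
abbrev Gr : Type _ := ⨁ n, Φ.Piece n

/-- The symbol in degree `n` of an element of `F n`, as an element of the graded algebra. -/
def symb (n : ℕ) : Φ.F n →ₗ[ℂ] Φ.Gr := (DirectSum.lof ℂ ℕ Φ.Piece n).comp (Φ.cls n)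

theorem symb_mul {i j : ℕ} (a : Φ.F i) (b : Φ.F j) :
    Φ.symb i a * Φ.symb j b = Φ.symb (i + j) ⟨a * b, Φ.mul_mem a.2 b.2⟩ :=
  DirectSum.of_mul_of _ _

theorem symb_eq {n : ℕ} {a b : Φ.F n} (h : (a : A) - b ∈ Φ.prev n) :
    Φ.symb n a = Φ.symb n b := by
  rw [← sub_eq_zero, ← map_sub]
  simp only [symb, LinearMap.comp_apply]
  rw [Φ.cls_eq_zero (a := a - b) h, map_zero]

end AlgFiltration

/-! ### Lie superalgebras and their enveloping algebras -/

/-- The sign `(-1)^(i j)` for `i, j` in `ℤ/2`. -/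
def superSign (i j : ZMod 2) : ℂ := if i = 1 ∧ j = 1 then -1 else 1

/-- A complex Lie superalgebra structure `g = g₀ ⊕ g₁` on a vector space `g`. -/
structure LieSuperalgebra (g : Type*) [AddCommGroup g] [Module ℂ g] where
  part : ZMod 2 → Submodule ℂ g
  isInternal : DirectSum.IsInternal part
  bracket : g →ₗ[ℂ] g →ₗ[ℂ] g
  bracket_mem : ∀ {i j : ZMod 2} {x y : g}, x ∈ part i → y ∈ part j →
    bracket x y ∈ part (i + j)
  skew : ∀ {i j : ZMod 2} {x y : g}, x ∈ part i → y ∈ part j →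
    bracket x y = -(superSign i j • bracket y x)
  jacobi : ∀ {i j : ZMod 2} {x y : g} (z : g), x ∈ part i → y ∈ part j →
    bracket x (bracket y z) =
      bracket (bracket x y) z + superSign i j • bracket y (bracket x z)

namespace LieSuperalgebra

universe u v

variable {g : Type u} [AddCommGroup g] [Module ℂ g] (L : LieSuperalgebra g)

/-- The defining relations `x y - (-1)^(i j) y x = [x, y]` for homogeneous `x, y`. -/
inductive EnvRel : TensorAlgebra ℂ g → TensorAlgebra ℂ g → Prop
  | mk {i j : ZMod 2} {x y : g} (hx : x ∈ L.part i) (hy : y ∈ L.part j) :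
      EnvRel (TensorAlgebra.ι ℂ x * TensorAlgebra.ι ℂ y -
          superSign i j • (TensorAlgebra.ι ℂ y * TensorAlgebra.ι ℂ x))
        (TensorAlgebra.ι ℂ (L.bracket x y))

/-- The universal enveloping algebra `U(g)`. -/
abbrev Env : Type u := RingQuot L.EnvRel

/-- The projection from the tensor algebra `T(g)` to `U(g)`. -/
def toEnv : TensorAlgebra ℂ g →ₐ[ℂ] L.Env := RingQuot.mkAlgHom ℂ L.EnvRel

/-- Even elements of `g` have weight `2` and odd elements have weight `1`. -/
def weight (i : ZMod 2) : ℕ := if i = 0 then 2 else 1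

/-- The component `T^m(g)` of the tensor algebra, spanned by the products `x₁ ⋯ x_r` of
homogeneous elements of `g` whose weights add up to `m`: thus `T⁰ = ℂ`, `T¹ = g₁`,
`T² = g₀ + g₁ ⊗ g₁`. -/
def tensorGrade (m : ℕ) : Submodule ℂ (TensorAlgebra ℂ g) :=
  Submodule.span ℂ {t | ∃ l : List (ZMod 2 × g), (∀ p ∈ l, p.2 ∈ L.part p.1) ∧
    (l.map fun p => weight p.1).sum = m ∧ t = (l.map fun p => TensorAlgebra.ι ℂ p.2).prod}

/-- `U_n`, the image in `U(g)` of the sum of the `T^m(g)` with `m ≤ n`. -/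
def envFil (n : ℕ) : Submodule ℂ L.Env :=
  (⨆ m ≤ n, L.tensorGrade m).map L.toEnv.toLinearMap

theorem tensorGrade_mul {i j : ℕ} {a b : TensorAlgebra ℂ g} (ha : a ∈ L.tensorGrade i)
    (hb : b ∈ L.tensorGrade j) : a * b ∈ L.tensorGrade (i + j) := by
  have h := Submodule.mul_mem_mul ha hb
  rw [tensorGrade, tensorGrade, Submodule.span_mul_span] at h
  refine Submodule.span_mono ?_ h
  rintro _ ⟨_, ⟨l, hl, rfl, rfl⟩, _, ⟨l', hl', rfl, rfl⟩, rfl⟩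
  refine ⟨l ++ l', fun p hp => ?_, by simp, by simp⟩
  rcases List.mem_append.1 hp with h | h
  · exact hl p h
  · exact hl' p h

theorem envFil_eq (n : ℕ) :
    L.envFil n = ⨆ m ≤ n, (L.tensorGrade m).map L.toEnv.toLinearMap := by
  simp only [envFil, Submodule.map_iSup]

theorem mem_envFil {m n : ℕ} (h : m ≤ n) {t : TensorAlgebra ℂ g} (ht : t ∈ L.tensorGrade m) :
    L.toEnv t ∈ L.envFil n :=
  Submodule.mem_map_of_mem (Submodule.mem_iSup_of_mem m (Submodule.mem_iSup_of_mem h ht))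

theorem envFil_mul (i j : ℕ) : L.envFil i * L.envFil j ≤ L.envFil (i + j) := by
  rw [L.envFil_eq i, L.envFil_eq j]
  simp only [Submodule.iSup_mul, Submodule.mul_iSup, iSup_le_iff]
  intro m hm n hn
  rw [Submodule.mul_le]
  rintro _ ⟨a, ha, rfl⟩ _ ⟨b, hb, rfl⟩
  have := L.mem_envFil (add_le_add hn hm)
    (L.tensorGrade_mul (SetLike.mem_coe.1 ha) (SetLike.mem_coe.1 hb))
  simpa using this

/-- The filtration `{U_n}` of `U(g)`. -/
def envFiltration : AlgFiltration L.Env where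
  F := L.envFil
  mono := fun i j hij => Submodule.map_mono
    (iSup₂_le fun m hm => le_iSup₂_of_le m (hm.trans hij) le_rfl)
  one_mem := by
    have : (1 : TensorAlgebra ℂ g) ∈ L.tensorGrade 0 :=
      Submodule.subset_span ⟨[], by simp, by simp, by simp⟩
    simpa using L.mem_envFil le_rfl this
  mul_mem := fun ha hb => L.envFil_mul _ _ (Submodule.mul_mem_mul ha hb)

/-- The associated graded ring `gr U(g)`. -/
abbrev GrEnv : Type u := L.envFiltration.Gr

/-! ### The subalgebra `S(g₀)` -/

/-- The symmetric algebra `S(g₀)`. -/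
abbrev SymEven : Type u := SymmetricAlgebra ℂ (L.part 0)

theorem ι_even_mem (x : L.part 0) :
    L.toEnv (TensorAlgebra.ι ℂ (x : g)) ∈ L.envFiltration.F 2 :=
  L.mem_envFil le_rfl (Submodule.subset_span
    ⟨[(0, (x : g))], by simp, by simp [weight], by simp⟩)

/-- An element of `g₀` as an element of degree `2` of `gr U(g)`. -/
def evenSymb : L.part 0 →ₗ[ℂ] L.GrEnv :=
  (L.envFiltration.symb 2).comp
    (((L.toEnv.toLinearMap.comp (TensorAlgebra.ι ℂ)).comp (L.part 0).subtype).codRestrict _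
      L.ι_even_mem)

theorem evenSymb_comm (x y : L.part 0) :
    L.evenSymb x * L.evenSymb y = L.evenSymb y * L.evenSymb x := by
  simp only [evenSymb, LinearMap.comp_apply]
  rw [L.envFiltration.symb_mul, L.envFiltration.symb_mul]
  refine L.envFiltration.symb_eq (n := 2 + 2) ?_
  have hr : L.toEnv (TensorAlgebra.ι ℂ (x : g) * TensorAlgebra.ι ℂ (y : g) -
      superSign 0 0 • (TensorAlgebra.ι ℂ (y : g) * TensorAlgebra.ι ℂ (x : g))) =
      L.toEnv (TensorAlgebra.ι ℂ (L.bracket x y)) :=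
    RingQuot.mkAlgHom_rel ℂ (EnvRel.mk x.2 y.2)
  have hb : L.bracket x y ∈ L.part 0 := by simpa using L.bracket_mem x.2 y.2
  have h2 := L.ι_even_mem ⟨_, hb⟩
  have h3 := L.envFiltration.mono (show 2 ≤ 3 by norm_num) h2
  rw [← hr] at h3
  have hs : superSign 0 0 = 1 := by simp [superSign]
  rw [hs, one_smul, map_sub, map_mul, map_mul] at h3
  exact h3

/-- The subalgebra of `gr U(g)` generated by `g₀`. -/
def evenSub : Subalgebra ℂ L.GrEnv := Algebra.adjoin ℂ (Set.range L.evenSymb)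

theorem evenSub_comm : IsMulCommutative L.evenSub :=
  Algebra.isMulCommutative_adjoin ℂ (by
    rintro _ ⟨x, rfl⟩ _ ⟨y, rfl⟩
    exact L.evenSymb_comm x y)

instance : CommRing L.evenSub :=
  { L.evenSub.toRing with mul_comm := L.evenSub_comm.is_comm.comm }

/-- The canonical homomorphism from `S(g₀)` to `gr U(g)`, extending `evenSymb`. -/
def evenHom : L.SymEven →ₐ[ℂ] L.GrEnv :=
  L.evenSub.val.comp (SymmetricAlgebra.lift
    { toFun := fun x => (⟨L.evenSymb x, Algebra.subset_adjoin ⟨x, rfl⟩⟩ : L.evenSub)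
      map_add' := fun x y => Subtype.ext (map_add L.evenSymb x y)
      map_smul' := fun r x => Subtype.ext (map_smul L.evenSymb r x) })

theorem evenHom_ι (x : L.part 0) :
    L.evenHom (SymmetricAlgebra.ι ℂ _ x) = L.evenSymb x := by
  simp [evenHom]

/-- The annihilator in `S(g₀)` of a `gr U(g)`-module. -/
def evenAnnihilator (N : Type v) [AddCommGroup N] [Module L.GrEnv N] : Ideal L.SymEven :=
  (Module.annihilator L.GrEnv N).comap L.evenHom

/-- `N` is torsion free as an `S(g₀)/q`-module (for `q` a prime annihilating `N`): the nonzero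
elements of the domain `S(g₀)/q` act injectively on `N`. -/
def IsTorsionFreeMod (q : Ideal L.SymEven) (N : Type v) [AddCommGroup N] [Module L.GrEnv N] :
    Prop :=
  ∀ s : L.SymEven, s ∉ q → ∀ x : N, L.evenHom s • x = 0 → x = 0

/-! ### The Clifford algebra of a prime of `S(g₀)` -/

/-- The bracket `g₁ × g₁ → g₀`. -/
def oddBracket : L.part 1 →ₗ[ℂ] L.part 1 →ₗ[ℂ] L.part 0 :=
  LinearMap.mk₂ ℂ
    (fun x y => ⟨L.bracket x y, by
      simpa [show (1 : ZMod 2) + 1 = 0 from rfl] using L.bracket_mem x.2 y.2⟩)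
    (fun x y z => Subtype.ext (by simp))
    (fun r x y => Subtype.ext (by simp))
    (fun x y z => Subtype.ext (by simp))
    (fun r x y => Subtype.ext (by simp))

section Clifford

variable (q : Ideal L.SymEven)

/-- The field of fractions `F_q` of `S(g₀)/q`. -/
abbrev FracField : Type u := FractionRing (L.SymEven ⧸ q)

/-- The map from `g₀` to `F_q`. -/
def evenToFrac : L.part 0 →ₗ[ℂ] L.FracField q :=
  ((IsScalarTower.toAlgHom ℂ (L.SymEven ⧸ q) (L.FracField q)).comp
    (Ideal.Quotient.mkₐ ℂ q)).toLinearMap.comp (SymmetricAlgebra.ι ℂ (L.part 0))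

/-- The `F_q`-bilinear extension to `F_q ⊗ g₁` of the bracket on `g₁`. -/
def form : LinearMap.BilinForm (L.FracField q) (L.FracField q ⊗[ℂ] L.part 1) :=
  LinearMap.liftBaseChange (L.FracField q)
    (((LinearMap.liftBaseChangeEquiv (L.FracField q)).toLinearMap.restrictScalars ℂ).comp
      (L.oddBracket.compr₂ (L.evenToFrac q)))

theorem form_tmul (a b : L.FracField q) (x y : L.part 1) :
    L.form q (a ⊗ₜ x) (b ⊗ₜ y) = a * b * L.evenToFrac q (L.oddBracket x y) := by
  simp [form, mul_assoc]

/-- `k(q)`, the rank of the bilinear form. -/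
def rankForm : ℕ := Module.finrank (L.FracField q) (LinearMap.range (L.form q))

/-- `ℓ(q) = [(k(q) + 1) / 2]`. -/
def ell : ℕ := (L.rankForm q + 1) / 2

variable [q.IsPrime]

/-- The quadratic form `v ↦ B(v, v) / 2`, so that `v w + w v = B(v, w)` in its Clifford
algebra. -/
def quadForm : QuadraticForm (L.FracField q) (L.FracField q ⊗[ℂ] L.part 1) :=
  (2⁻¹ : L.FracField q) • LinearMap.BilinMap.toQuadraticMap (L.form q)

/-- The relation that kills the radical of the bilinear form. -/
inductive RadRel : CliffordAlgebra (L.quadForm q) → CliffordAlgebra (L.quadForm q) → Prop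
  | mk (v : L.FracField q ⊗[ℂ] L.part 1) (hv : ∀ w, L.form q v w = 0) :
      RadRel (CliffordAlgebra.ι (L.quadForm q) v) 0

/-- The Clifford algebra `C_q = T / N`, where `T` is the Clifford algebra over `F_q` of the
form on `F_q ⊗ g₁` and `N` is the ideal generated by the radical of the form. -/
abbrev CliffordQ : Type u := RingQuot (L.RadRel q)

/-- `C_q` is split: its simple modules have dimension `2 ^ ℓ(q)` over `F_q`. -/
def IsSplit : Prop :=
  ∀ (E : Type u) [AddCommGroup E] [Module (L.FracField q) E] [Module (L.CliffordQ q) E]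
    [IsScalarTower (L.FracField q) (L.CliffordQ q) E] [IsSimpleModule (L.CliffordQ q) E],
    Module.finrank (L.FracField q) E = 2 ^ L.ell q

end Clifford

/-! ### Dimension and multiplicity -/

/-- The component `S^m(g₀)` of the symmetric algebra. -/
def symGrade (m : ℕ) : Submodule ℂ L.SymEven :=
  (LinearMap.range (SymmetricAlgebra.ι ℂ (L.part 0))) ^ m

/-- For `Z = S(g₀)/q`, the function `n ↦ dim (Z(0) + ⋯ + Z(n))`, where `Z(m)` is the image of
`S^m(g₀)`. -/
def hilbertSym (q : Ideal L.SymEven) (n : ℕ) : ℕ :=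
  Module.finrank ℂ ((⨆ m ≤ n, L.symGrade m).map (Ideal.Quotient.mkₐ ℂ q).toLinearMap)

end LieSuperalgebra

/-- For a graded `gr U(g)`-module `N = ⨁ N(m)`, the function `n ↦ dim (N(0) + ⋯ + N(2n))`.
As `g₀` has degree `2` in `gr U(g)`, the graded `S(g₀)`-module structure of `N` for the usual
grading of `S(g₀)` (with `g₀` in degree `1`) has components `N(2m - 1) + N(2m)`, and this is
the dimension of the sum of its components of degree at most `n`. -/
def hilbertGr {N : Type*} [AddCommGroup N] [Module ℂ N] (𝒩 : ℕ → Submodule ℂ N) (n : ℕ) : ℕ :=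
  ∑ m ∈ Finset.range (2 * n + 1), Module.finrank ℂ (𝒩 m)

/-- The function `h` has the form `a_d (n choose d) + ⋯ + a_1 (n choose 1) + a_0` for `n ≫ 0`
with `a_d = e ≠ 0`: it has dimension `d` and multiplicity `e`. -/
def HasDimMult (h : ℕ → ℕ) (d : ℕ) (e : ℚ) : Prop :=
  ∃ a : ℕ → ℚ, a d = e ∧ e ≠ 0 ∧ ∀ᶠ n in Filter.atTop,
    (h n : ℚ) = ∑ i ∈ Finset.range (d + 1), a i * (n.choose i : ℚ)

theorem choose_coeff_eq_zero (D : ℕ) : ∀ (c : ℕ → ℚ) (n₀ : ℕ),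
    (∀ n ≥ n₀, ∑ i ∈ Finset.range D, c i * (n.choose i : ℚ) = 0) → ∀ i < D, c i = 0 := by
  induction D with
  | zero => intro c n₀ h i hi; omega
  | succ D ih =>
    intro c n₀ h
    have h1 : ∀ i < D, c (i + 1) = 0 := by
      refine ih (fun i => c (i + 1)) n₀ fun n hn => ?_
      have e1 := h n hn
      have e2 := h (n + 1) (by omega)
      rw [Finset.sum_range_succ'] at e1 e2
      simp only [Nat.choose_succ_succ, Nat.cast_add, mul_add, Finset.sum_add_distrib,
        Nat.choose_zero_right] at e1 e2
      linarith
    intro i hi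
    cases i with
    | succ i => exact h1 i (by omega)
    | zero =>
      have e1 := h n₀ le_rfl
      rw [Finset.sum_range_succ', Finset.sum_eq_zero] at e1
      · simpa using e1
      · intro i hi
        rw [h1 i (Finset.mem_range.1 hi), zero_mul]

/-- The dimension and the multiplicity are determined by the function. -/
theorem HasDimMult.unique {h : ℕ → ℕ} {d d' : ℕ} {e e' : ℚ} (H : HasDimMult h d e)
    (H' : HasDimMult h d' e') : d = d' ∧ e = e' := by
  obtain ⟨a, rfl, ha, h1⟩ := H
  obtain ⟨b, rfl, hb, h2⟩ := H'
  obtain ⟨n₀, h3⟩ := Filter.eventually_atTop.1 (h1.and h2)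
  have pad : ∀ (a : ℕ → ℚ) (d D n : ℕ), d < D →
      ∑ i ∈ Finset.range D, (if i ≤ d then a i else 0) * (n.choose i : ℚ) =
        ∑ i ∈ Finset.range (d + 1), a i * (n.choose i : ℚ) := by
    intro a d D n hD
    rw [← Finset.sum_subset (Finset.range_mono (Nat.succ_le_of_lt hD))]
    · refine Finset.sum_congr rfl fun i hi => ?_
      rw [if_pos (by have := Finset.mem_range.1 hi; omega)]
    · intro i _ hi
      rw [if_neg (by rw [Finset.mem_range] at hi; omega), zero_mul]
  have key := choose_coeff_eq_zero (max d d' + 1)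
    (fun i => (if i ≤ d then a i else 0) - (if i ≤ d' then b i else 0)) n₀ (fun n hn => by
      simp only [sub_mul, Finset.sum_sub_distrib]
      rw [pad a d _ n (by omega), pad b d' _ n (by omega), ← (h3 n hn).1, ← (h3 n hn).2, sub_self])
  have k1 := key d (by omega)
  have k2 := key d' (by omega)
  rcases lt_trichotomy d d' with hlt | rfl | hlt
  · simp [not_le.2 hlt] at k2
    exact absurd k2 hb
  · simp at k1
    exact ⟨rfl, by linarith⟩
  · simp [not_le.2 hlt] at k1
    exact absurd k1 ha

end

/-! Write Z = S(g₀)/q and F = F_q, and let r be the dimension of F ⊗_Z N over F. The algebra gr U(g)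
is generated by the central image of S(g₀) and by odd symbols that anticommute up to elements of
that image. Hence it is finite over S(g₀), and N is a finitely generated graded torsion-free
Z-module. It contains r linearly independent elements and is spanned by finitely many homogeneous
ones, so comparing Hilbert functions gives d(N) = d(Z) and e(N) ≥ r e(Z)
(`IsGradingProj.exists_hasDimMult`). The bound on e(N) is thereby reduced to r ≥ 2^ℓ(q).

The odd symbols make F ⊗ N a module over the Clifford algebra of the form, of rank k. Diagonalising
the form yields k anticommuting operators with nonzero scalar squares. Over an algebraic closure
such operators need dimension at least 2^⌊k/2⌋, which is enough for even k. For odd k another factor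
2 is needed. The product z of the operators then commutes with all of them, and z² is, up to sign,
the product D of their squares. If D is not a square in F (where -1 is one), a trace argument shows
that z is not a scalar over the closure. So both of its eigenspaces are nonzero, and each has
dimension at least 2^((k-1)/2) (`IsAnticommSystem.two_pow_le_finrank`).

That D is not a square comes from the grading. Since N is graded, q is homogeneous, and multiplying
degree m by X^m induces an embedding F → F(X) that multiplies the form by X. If D were a square, X^k
would be a square in F(X), which is impossible for odd k
(`LinearMap.BilinForm.not_isSquare_prod_of_odd`).

If e(N) = 2^ℓ(q) e(Z), then r = 2^ℓ(q), because e(Z) > 0. The kernel of a radical vector on F ⊗ N is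
nonzero and stable, so by the lower bound it is everything
(`LinearMap.BilinForm.eq_zero_of_finrank_eq`), and F ⊗ N is a C_q-module. By the same bound it is
simple. As C_q is a simple Artinian ring (`IsAnticommSystem.isSimpleRing`), every simple C_q-module
is isomorphic to F ⊗ N. -/

noncomputable section

/-! ### Functions that are eventually combinations of binomial coefficients -/

/-- `f n` is a linear combination of binomial coefficients `n.choose i` for `n ≫ 0`. -/
def IsEventuallyBinomial (f : ℕ → ℚ) : Prop :=
  ∃ (D : ℕ) (a : ℕ → ℚ), ∀ᶠ n in Filter.atTop,
    f n = ∑ i ∈ Finset.range D, a i * (n.choose i : ℚ)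

theorem sum_range_ite_mul_choose (a : ℕ → ℚ) {D D' : ℕ} (h : D ≤ D') (n : ℕ) :
    ∑ i ∈ Finset.range D', (if i < D then a i else 0) * (n.choose i : ℚ) =
      ∑ i ∈ Finset.range D, a i * (n.choose i : ℚ) := by
  rw [← Finset.sum_subset (Finset.range_mono h)]
  · exact Finset.sum_congr rfl fun i hi => by rw [if_pos (Finset.mem_range.1 hi)]
  · intro i _ hi
    rw [if_neg (by simpa using hi), zero_mul]

/-- Pascal's rule. The second sum is the forward difference, in which every coefficient moves down
by one index. -/
theorem sum_range_mul_choose_succ (a : ℕ → ℚ) (D n : ℕ) :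
    ∑ i ∈ Finset.range (D + 1), a i * ((n + 1).choose i : ℚ) =
      ∑ i ∈ Finset.range (D + 1), a i * (n.choose i : ℚ) +
        ∑ i ∈ Finset.range D, a (i + 1) * (n.choose i : ℚ) := by
  rw [Finset.sum_range_succ', Finset.sum_range_succ' (fun i => a i * (n.choose i : ℚ))]
  simp only [Nat.choose_succ_succ, Nat.cast_add, mul_add, Finset.sum_add_distrib,
    Nat.choose_zero_right]
  ring

namespace IsEventuallyBinomial

theorem of_eventually_zero {f : ℕ → ℚ} (h : ∀ᶠ n in Filter.atTop, f n = 0) :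
    IsEventuallyBinomial f :=
  ⟨0, 0, by simpa using h⟩

theorem sub {f g : ℕ → ℚ} (hf : IsEventuallyBinomial f) (hg : IsEventuallyBinomial g) :
    IsEventuallyBinomial fun n => f n - g n := by
  obtain ⟨D, a, ha⟩ := hf
  obtain ⟨D', b, hb⟩ := hg
  refine ⟨max D D', fun i => (if i < D then a i else 0) - (if i < D' then b i else 0), ?_⟩
  filter_upwards [ha, hb] with n h1 h2
  simp only [sub_mul, Finset.sum_sub_distrib]
  rw [sum_range_ite_mul_choose a (le_max_left _ _), sum_range_ite_mul_choose b (le_max_right _ _),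
    h1, h2]

theorem comp_succ {f : ℕ → ℚ} (hf : IsEventuallyBinomial f) :
    IsEventuallyBinomial fun n => f (n + 1) := by
  obtain ⟨D, a, ha⟩ := hf
  refine ⟨D + 1, fun i => (if i < D then a i else 0) + if i + 1 < D then a (i + 1) else 0, ?_⟩
  filter_upwards [(Filter.tendsto_add_atTop_nat 1).eventually ha] with n hn
  rw [hn, ← sum_range_ite_mul_choose a D.le_succ, sum_range_mul_choose_succ]
  simp only [add_mul, Finset.sum_add_distrib]
  rw [Finset.sum_range_succ (fun i => (if i + 1 < D then a (i + 1) else 0) * (n.choose i : ℚ)),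
    if_neg (by omega), zero_mul, add_zero]

/-- Discrete integration: `n.choose (i + 1)` has difference `n.choose i`, so `f` differs from the
antidifference `G` by a constant once `n ≥ n₀`. That constant becomes the coefficient of index 0. -/
theorem of_succ_sub {f : ℕ → ℚ} (hf : IsEventuallyBinomial fun n => f (n + 1) - f n) :
    IsEventuallyBinomial f := by
  obtain ⟨D, a, ha⟩ := hf
  obtain ⟨n₀, h₀⟩ := Filter.eventually_atTop.1 ha
  set G : ℕ → ℚ := fun n => ∑ i ∈ Finset.range D, a i * (n.choose (i + 1) : ℚ) with hG
  have hGs : ∀ n, G (n + 1) = G n + ∑ i ∈ Finset.range D, a i * (n.choose i : ℚ) := by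
    intro n
    simp only [hG, Nat.choose_succ_succ, Nat.cast_add, mul_add, Finset.sum_add_distrib]
    ring
  have hc : ∀ n ≥ n₀, f n - G n = f n₀ - G n₀ := by
    intro n hn
    induction n, hn using Nat.le_induction with
    | base => rfl
    | succ n hn ih =>
      have := h₀ n hn
      rw [hGs]
      linarith
  refine ⟨D + 1, fun i => if i = 0 then f n₀ - G n₀ else a (i - 1), ?_⟩
  filter_upwards [Filter.eventually_ge_atTop n₀] with n hn
  rw [Finset.sum_range_succ']
  have := hc n hn
  simp only [hG] at this ⊢
  simp
  linarith

/-- Take the shortest expansion: its top coefficient is nonzero by minimality, and it is not empty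
because `h` is not eventually zero. -/
theorem exists_hasDimMult {h : ℕ → ℕ} (H : IsEventuallyBinomial fun n => (h n : ℚ))
    (h0 : ∀ᶠ n in Filter.atTop, h n ≠ 0) : ∃ d e, HasDimMult h d e := by
  classical
  have H' : ∃ D : ℕ, ∃ a : ℕ → ℚ, ∀ᶠ n in Filter.atTop,
    (h n : ℚ) = ∑ i ∈ Finset.range D, a i * (n.choose i : ℚ) := H
  obtain ⟨a, ha⟩ := Nat.find_spec H'
  have hmin := fun m => Nat.find_min (H := H') (m := m)
  generalize Nat.find H' = D at ha hmin
  cases D with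
  | zero =>
    obtain ⟨n, hn, hn'⟩ := (h0.and ha).exists
    simp at hn'
    exact absurd hn' hn
  | succ D =>
    refine ⟨D, a D, a, rfl, fun hD => hmin D (Nat.lt_succ_self D) ⟨a, ?_⟩, ha⟩
    filter_upwards [ha] with n hn
    rw [hn, Finset.sum_range_succ, hD, zero_mul, add_zero]

end IsEventuallyBinomial

/-! ### Growth of functions with a dimension and a multiplicity -/

namespace HasDimMult

open Filter Topology

/-- The shift adds `a (i + 1)` to `a i`, so the top coefficient stays the same. Hence bounded shifts
of degree do not affect dimension and multiplicity. -/
theorem comp_succ {h : ℕ → ℕ} {d : ℕ} {e : ℚ} (H : HasDimMult h d e) :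
    HasDimMult (fun n => h (n + 1)) d e := by
  obtain ⟨a, had, he, ha⟩ := H
  refine ⟨fun i => a i + if i < d then a (i + 1) else 0, by simp [had], he, ?_⟩
  filter_upwards [(tendsto_add_atTop_nat 1).eventually ha] with n hn
  rw [hn, sum_range_mul_choose_succ]
  simp only [add_mul, Finset.sum_add_distrib]
  rw [sum_range_ite_mul_choose (fun i => a (i + 1)) d.le_succ]

theorem comp_add {h : ℕ → ℕ} {d : ℕ} {e : ℚ} (H : HasDimMult h d e) (D : ℕ) :
    HasDimMult (fun n => h (n + D)) d e := by
  induction D with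
  | zero => exact H
  | succ D ih => simpa only [add_assoc, add_comm 1 D] using ih.comp_succ

theorem const_mul {h : ℕ → ℕ} {d : ℕ} {e : ℚ} (H : HasDimMult h d e) {r : ℕ} (hr : r ≠ 0) :
    HasDimMult (fun n => r * h n) d (r * e) := by
  obtain ⟨a, had, he, ha⟩ := H
  refine ⟨fun i => r * a i, by simp only [had], mul_ne_zero (Nat.cast_ne_zero.2 hr) he, ?_⟩
  filter_upwards [ha] with n hn
  rw [Nat.cast_mul, hn, Finset.mul_sum]
  exact Finset.sum_congr rfl fun i _ => (mul_assoc _ _ _).symm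

theorem tendsto_choose_div_pow (i : ℕ) :
    Tendsto (fun n : ℕ => (n.choose i : ℝ) / (n : ℝ) ^ i) atTop (𝓝 (1 / i.factorial)) := by
  induction i with
  | zero => simp
  | succ i ih =>
    have h1 : Tendsto (fun n : ℕ => 1 - (i : ℝ) / n) atTop (𝓝 (1 - 0)) :=
      tendsto_const_nhds.sub (tendsto_const_div_atTop_nhds_zero_nat _)
    have h2 := (ih.mul h1).mul_const (1 / ((i : ℝ) + 1))
    have h3 : 1 / (i.factorial : ℝ) * (1 - 0) * (1 / ((i : ℝ) + 1)) =
        1 / ((i + 1).factorial : ℝ) := by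
      rw [Nat.factorial_succ]
      push_cast
      field_simp
      ring
    rw [h3] at h2
    refine h2.congr' ?_
    filter_upwards [eventually_ge_atTop (i + 1)] with n hn
    have hn0 : (n : ℝ) ≠ 0 := by
      have : 0 < n := by omega
      positivity
    have h4 : (n.choose (i + 1) : ℝ) * (i + 1) = n.choose i * (n - i) := by
      have := Nat.choose_succ_right_eq n i
      rw [← Nat.cast_sub (by omega : i ≤ n)]
      exact_mod_cast this
    have h5 : (n.choose (i + 1) : ℝ) = n.choose i * (n - i) / (i + 1) := by
      rw [← h4]
      field_simp
    rw [h5]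
    field_simp
    ring

theorem tendsto_choose_div_pow_of_lt {i d : ℕ} (h : i < d) :
    Tendsto (fun n : ℕ => (n.choose i : ℝ) / (n : ℝ) ^ d) atTop (𝓝 0) := by
  obtain ⟨k, rfl⟩ := Nat.exists_eq_add_of_lt h
  have h1 : Tendsto (fun n : ℕ => 1 / ((n : ℝ) ^ (k + 1))) atTop (𝓝 0) := by
    simp only [one_div]
    exact ((tendsto_pow_atTop (Nat.succ_ne_zero k)).comp
      tendsto_natCast_atTop_atTop).inv_tendsto_atTop
  have h2 := (tendsto_choose_div_pow i).mul h1
  rw [mul_zero] at h2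
  refine h2.congr fun n => ?_
  rw [div_mul_div_comm, mul_one, ← pow_add, ← add_assoc]

/-- Only the top binomial coefficient survives division by `n ^ d`. Dimension and multiplicity are
thus read off from a limit, and pointwise inequalities between functions pass to them. -/
theorem tendsto_div_pow {h : ℕ → ℕ} {d : ℕ} {e : ℚ} (H : HasDimMult h d e) :
    Tendsto (fun n : ℕ => (h n : ℝ) / (n : ℝ) ^ d) atTop (𝓝 ((e : ℝ) / d.factorial)) := by
  obtain ⟨a, had, he, ha⟩ := H
  have h1 : Tendsto (fun n : ℕ => ∑ i ∈ Finset.range d, (a i : ℝ) * ((n.choose i : ℝ) / (n : ℝ) ^ d) +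
      (a d : ℝ) * ((n.choose d : ℝ) / (n : ℝ) ^ d)) atTop
      (𝓝 (∑ i ∈ Finset.range d, (a i : ℝ) * 0 + (a d : ℝ) * (1 / d.factorial))) := by
    refine Tendsto.add (tendsto_finsetSum _ fun i hi => ?_)
      ((tendsto_choose_div_pow d).const_mul _)
    exact (tendsto_choose_div_pow_of_lt (Finset.mem_range.1 hi)).const_mul _
  have h2 : ∑ i ∈ Finset.range d, (a i : ℝ) * 0 + (a d : ℝ) * (1 / d.factorial) =
      (e : ℝ) / d.factorial := by
    simp [had, div_eq_mul_inv]
  rw [h2] at h1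
  refine h1.congr' ?_
  filter_upwards [ha] with n hn
  have h3 : (h n : ℝ) = ∑ i ∈ Finset.range (d + 1), (a i : ℝ) * (n.choose i : ℝ) := by
    exact_mod_cast congrArg (fun x : ℚ => (x : ℝ)) hn
  rw [h3, Finset.sum_range_succ, add_div, Finset.sum_div]
  simp only [mul_div_assoc]

theorem pos {h : ℕ → ℕ} {d : ℕ} {e : ℚ} (H : HasDimMult h d e) : 0 < e := by
  have h1 : (0 : ℝ) ≤ (e : ℝ) / d.factorial :=
    ge_of_tendsto' H.tendsto_div_pow fun n => by positivity
  have h2 : (0 : ℝ) < d.factorial := by exact_mod_cast d.factorial_pos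
  have h3 : (0 : ℝ) ≤ e := by
    have := mul_nonneg h1 h2.le
    rwa [div_mul_cancel₀ _ h2.ne'] at this
  obtain ⟨a, -, he, -⟩ := H
  exact lt_of_le_of_ne (by exact_mod_cast h3) he.symm

/-- If `d > d'`, division by `n ^ d` sends `v` to 0 in the limit, but `u` to `e / d!`, which is
positive. -/
theorem dim_le_of_le {u v : ℕ → ℕ} {d d' : ℕ} {e e' : ℚ} (hu : HasDimMult u d e)
    (hv : HasDimMult v d' e') (h : ∀ n, u n ≤ v n) : d ≤ d' := by
  by_contra! hlt
  obtain ⟨k, rfl⟩ := Nat.exists_eq_add_of_lt hlt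
  have h1 : Tendsto (fun n : ℕ => 1 / ((n : ℝ) ^ (k + 1))) atTop (𝓝 0) := by
    simp only [one_div]
    exact ((tendsto_pow_atTop (Nat.succ_ne_zero k)).comp
      tendsto_natCast_atTop_atTop).inv_tendsto_atTop
  have h2 := hv.tendsto_div_pow.mul h1
  rw [mul_zero] at h2
  have h3 := le_of_tendsto_of_tendsto' hu.tendsto_div_pow h2 fun n => by
    rw [div_mul_div_comm, mul_one, ← pow_add, ← add_assoc]
    have : (u n : ℝ) ≤ v n := by exact_mod_cast h n
    gcongr
  have h4 : (0 : ℝ) < e := by exact_mod_cast hu.pos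
  have h5 : (0 : ℝ) < (e : ℝ) / (d' + k + 1).factorial := by positivity
  linarith

theorem mult_le_of_le {u v : ℕ → ℕ} {d : ℕ} {e e' : ℚ} (hu : HasDimMult u d e)
    (hv : HasDimMult v d e') (h : ∀ n, u n ≤ v n) : e ≤ e' := by
  have h3 := le_of_tendsto_of_tendsto' hu.tendsto_div_pow hv.tendsto_div_pow fun n => by
    have : (u n : ℝ) ≤ v n := by exact_mod_cast h n
    gcongr
  have h2 : (0 : ℝ) < d.factorial := by exact_mod_cast d.factorial_pos
  have := (div_le_div_iff_of_pos_right h2).1 h3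
  exact_mod_cast this

end HasDimMult

end

noncomputable section

/-! ### Gradings given by families of projections -/

/-- The family of projections of a vector space onto the components of an `ℕ`-grading. -/
structure IsGradingProj {k M : Type*} [Field k] [AddCommGroup M] [Module k M]
    (π : ℕ → M →ₗ[k] M) : Prop where
  proj_self : ∀ n x, π n (π n x) = π n x
  proj_ne : ∀ {m n}, m ≠ n → ∀ x, π m (π n x) = 0
  bounded : ∀ x, ∃ s, ∀ n ≥ s, π n x = 0
  sum_eq : ∀ x s, (∀ n ≥ s, π n x = 0) → ∑ n ∈ Finset.range s, π n x = x

namespace IsGradingProj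

section Sub

variable {k R M : Type*} [Field k] [CommRing R] [Algebra k R] [AddCommGroup M] [Module k M]
  [Module R M] [IsScalarTower k R M]

/-- The restriction of a family of projections to a graded submodule. -/
def onSub (π : ℕ → M →ₗ[k] M) (P : Submodule R M) (h : ∀ n, ∀ y ∈ P, π n y ∈ P) (n : ℕ) :
    P →ₗ[k] P where
  toFun y := ⟨π n y, h n y y.2⟩
  map_add' _ _ := Subtype.ext (map_add (π n) _ _)
  map_smul' c y := Subtype.ext (map_smul (π n) c (y : M))

theorem isGradingProj_onSub {π : ℕ → M →ₗ[k] M} (hπ : IsGradingProj π) (P : Submodule R M)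
    (h : ∀ n, ∀ y ∈ P, π n y ∈ P) : IsGradingProj (onSub π P h) where
  proj_self n y := Subtype.ext (hπ.proj_self n y)
  proj_ne hmn y := Subtype.ext (hπ.proj_ne hmn (y : M))
  bounded y := by
    obtain ⟨s, hs⟩ := hπ.bounded (y : M)
    exact ⟨s, fun n hn => Subtype.ext (hs n hn)⟩
  sum_eq y s hs := by
    refine Subtype.ext ?_
    rw [AddSubmonoidClass.coe_finsetSum]
    exact hπ.sum_eq y s fun n hn => congrArg Subtype.val (hs n hn)

/-- The family of projections induced on the quotient by a graded submodule. -/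
def onQuot (π : ℕ → M →ₗ[k] M) (P : Submodule R M) (h : ∀ n, ∀ y ∈ P, π n y ∈ P) (n : ℕ) :
    (M ⧸ P) →ₗ[k] (M ⧸ P) :=
  (Submodule.Quotient.restrictScalarsEquiv k P).toLinearMap ∘ₗ
    (Submodule.mapQ (P.restrictScalars k) (P.restrictScalars k) (π n) (h n)) ∘ₗ
      (Submodule.Quotient.restrictScalarsEquiv k P).symm.toLinearMap

theorem onQuot_mk (π : ℕ → M →ₗ[k] M) (P : Submodule R M) (h : ∀ n, ∀ y ∈ P, π n y ∈ P) (n : ℕ)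
    (y : M) : onQuot π P h n (Submodule.Quotient.mk y) = Submodule.Quotient.mk (π n y) := rfl

theorem isGradingProj_onQuot {π : ℕ → M →ₗ[k] M} (hπ : IsGradingProj π) (P : Submodule R M)
    (h : ∀ n, ∀ y ∈ P, π n y ∈ P) : IsGradingProj (onQuot π P h) where
  proj_self n y := by
    obtain ⟨y, rfl⟩ := Submodule.Quotient.mk_surjective P y
    simp only [onQuot_mk, hπ.proj_self]
  proj_ne hmn y := by
    obtain ⟨y, rfl⟩ := Submodule.Quotient.mk_surjective P y
    simp only [onQuot_mk, hπ.proj_ne hmn, Submodule.Quotient.mk_zero]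
  bounded y := by
    obtain ⟨y, rfl⟩ := Submodule.Quotient.mk_surjective P y
    obtain ⟨s, hs⟩ := hπ.bounded y
    exact ⟨s, fun n hn => by rw [onQuot_mk, hs n hn, Submodule.Quotient.mk_zero]⟩
  sum_eq y s hs := by
    obtain ⟨y, rfl⟩ := Submodule.Quotient.mk_surjective P y
    -- The components of the class may vanish from `s` on while those of the representative do not.
    -- So the sum is taken up to a bound for the representative and then cut off at `s`.
    obtain ⟨s', hs'⟩ := hπ.bounded y
    have h1 := hπ.sum_eq y (max s s') fun n hn => hs' n ((le_max_right _ _).trans hn)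
    conv_rhs => rw [← h1]
    change _ = P.mkQ _
    rw [map_sum]
    refine Finset.sum_subset (Finset.range_mono (le_max_left _ _)) fun n _ hn => ?_
    exact hs n (by simpa using hn)

end Sub

/-! ### The Hilbert–Serre theorem -/

section HilbertSerre

variable {k R : Type*} [Field k] [CommRing R] [Algebra k R]

/-- This serves the base of the Hilbert–Serre induction: once all generators kill `M`, the ring acts
through scalars, and finite generation over `R` becomes finite dimension. -/
theorem exists_smul_eq_of_forall_smul_eq_zero {M : Type*} [AddCommGroup M] [Module k M]
    [Module R M] [IsScalarTower k R M] {X : Set R} (hX : Algebra.adjoin k X = ⊤)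
    (h0 : ∀ a ∈ X, ∀ y : M, a • y = 0) (a : R) : ∃ c : k, ∀ y : M, a • y = c • y := by
  have ha : a ∈ Algebra.adjoin k X := hX ▸ Algebra.mem_top
  induction ha using Algebra.adjoin_induction with
  | mem a ha => exact ⟨0, fun y => by rw [h0 a ha, zero_smul]⟩
  | algebraMap c => exact ⟨c, fun y => algebraMap_smul R c y⟩
  | add a b _ _ iha ihb =>
    obtain ⟨c, hc⟩ := iha
    obtain ⟨d, hd⟩ := ihb
    exact ⟨c + d, fun y => by rw [add_smul, add_smul, hc, hd]⟩
  | mul a b _ _ iha ihb =>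
    obtain ⟨c, hc⟩ := iha
    obtain ⟨d, hd⟩ := ihb
    exact ⟨c * d, fun y => by rw [mul_smul, mul_smul, hd, hc]⟩

theorem finite_of_forall_smul_eq_zero {M : Type*} [AddCommGroup M] [Module k M]
    [Module R M] [IsScalarTower k R M] [Module.Finite R M] {X : Set R}
    (hX : Algebra.adjoin k X = ⊤) (h0 : ∀ a ∈ X, ∀ y : M, a • y = 0) : Module.Finite k M := by
  obtain ⟨S, hS⟩ := Module.Finite.fg_top (R := R) (M := M)
  refine ⟨S, eq_top_iff.2 fun y _ => ?_⟩
  have hy : y ∈ Submodule.span R (S : Set M) := hS ▸ Submodule.mem_top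
  induction hy using Submodule.span_induction with
  | mem y hy => exact Submodule.subset_span hy
  | zero => exact zero_mem _
  | add y z _ _ hy hz => exact add_mem (hy trivial) (hz trivial)
  | smul a y _ hy =>
    obtain ⟨c, hc⟩ := exists_smul_eq_of_forall_smul_eq_zero (M := M) hX h0 a
    rw [hc]
    exact Submodule.smul_mem _ _ (hy trivial)

theorem eventually_eq_zero {M : Type*} [AddCommGroup M] [Module k M] [Module.Finite k M]
    {π : ℕ → M →ₗ[k] M} (hπ : IsGradingProj π) : ∀ᶠ n in Filter.atTop, π n = 0 := by
  obtain ⟨S, hS⟩ := Module.Finite.fg_top (R := k) (M := M)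
  choose s hs using hπ.bounded
  filter_upwards [Filter.eventually_ge_atTop (S.sup s)] with n hn
  refine LinearMap.ext_on hS fun y hy => ?_
  exact hs y n ((Finset.le_sup hy).trans hn)

/-- Dimension count for 0 → ker f → A → B → C → 0. Finiteness of `B` is a conclusion, because
finiteness of the graded components is itself proved with it, by induction on the degree. -/
theorem finrank_add_eq_of_exact {A B C : Type*} [AddCommGroup A] [Module k A] [AddCommGroup B] [Module k B]
    [AddCommGroup C] [Module k C] (f : A →ₗ[k] B) (g : B →ₗ[k] C) (hfg : Function.Exact f g)
    (hg : Function.Surjective g) [Module.Finite k A] [Module.Finite k C] :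
    Module.Finite k B ∧ (Module.finrank k B : ℚ) - Module.finrank k A =
      Module.finrank k C - Module.finrank k (LinearMap.ker f) := by
  have h1 : LinearMap.ker g = LinearMap.range f := hfg.linearMap_ker_eq
  have hB : Module.Finite k B := by
    refine ⟨Submodule.fg_of_fg_map_of_fg_inf_ker g ?_ ?_⟩
    · rw [Submodule.map_top, LinearMap.range_eq_top.2 hg]
      exact Module.Finite.fg_top
    · rw [top_inf_eq, h1, LinearMap.range_eq_map]
      exact Module.Finite.fg_top.map f
  refine ⟨hB, ?_⟩
  have h2 := LinearMap.finrank_range_add_finrank_ker f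
  have h3 := LinearMap.finrank_range_add_finrank_ker g
  rw [LinearMap.range_eq_top.2 hg, finrank_top, h1] at h3
  have h2' : (Module.finrank k (LinearMap.range f) : ℚ) + Module.finrank k (LinearMap.ker f) =
    Module.finrank k A := by exact_mod_cast h2
  have h3' : (Module.finrank k C : ℚ) + Module.finrank k (LinearMap.range f) =
    Module.finrank k B := by exact_mod_cast h3
  linarith

/-- The Hilbert–Serre theorem, for a graded module over an algebra generated in degree one by
elements `x i`, almost all of which act as zero. -/
theorem hilbertSerre_aux [IsNoetherianRing R] {x : ℕ → R}
    (hx : Algebra.adjoin k (Set.range x) = ⊤) (s : ℕ) :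
    ∀ (M : Type*) [AddCommGroup M] [Module k M] [Module R M] [IsScalarTower k R M]
      [Module.Finite R M] (π : ℕ → M →ₗ[k] M), IsGradingProj π →
      (∀ i n y, π (n + 1) (x i • y) = x i • π n y) → (∀ i y, π 0 (x i • y) = 0) →
      (∀ i ≥ s, ∀ y : M, x i • y = 0) →
      (∀ n, Module.Finite k (LinearMap.range (π n))) ∧
        IsEventuallyBinomial fun n => (Module.finrank k (LinearMap.range (π n)) : ℚ) := by
  induction s with
  | zero =>
    intro M _ _ _ _ _ π hπ _ _ hs
    have : Module.Finite k M := finite_of_forall_smul_eq_zero hx (by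
      rintro _ ⟨i, rfl⟩ y
      exact hs i (Nat.zero_le i) y)
    refine ⟨fun n => inferInstance, .of_eventually_zero ?_⟩
    filter_upwards [eventually_eq_zero hπ] with n hn
    rw [hn, LinearMap.range_zero, finrank_bot, Nat.cast_zero]
  | succ s ih =>
    intro M _ _ _ _ _ π hπ hcomm h0 hs
    -- Multiplication by `a` raises degrees by one, and it acts as zero on its kernel `K` and on its
    -- cokernel `M ⧸ P`. On both only the `x i` with `i < s` can act nontrivially, so the induction
    -- hypothesis applies over the same ring. The sequences 0 → K(n) → M(n) → M(n+1) → (M/P)(n+1) →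
    -- 0 then express the difference of the Hilbert function of `M`.
    set a := x s with ha
    set K : Submodule R M := LinearMap.ker (LinearMap.lsmul R M a) with hK
    set P : Submodule R M := LinearMap.range (LinearMap.lsmul R M a) with hP
    have memK : ∀ y, y ∈ K ↔ a • y = 0 := fun y => by rw [hK, LinearMap.mem_ker]; rfl
    have memP : ∀ y, y ∈ P ↔ ∃ z, a • z = y := fun y => by rw [hP, LinearMap.mem_range]; rfl
    have hKs : ∀ n, ∀ y ∈ K, π n y ∈ K := fun n y hy => by
      rw [memK] at hy ⊢
      rw [← hcomm, hy, map_zero]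
    have hPs : ∀ n, ∀ y ∈ P, π n y ∈ P := fun n y hy => by
      rw [memP] at hy ⊢
      obtain ⟨z, rfl⟩ := hy
      cases n with
      | zero => exact ⟨0, by rw [h0, smul_zero]⟩
      | succ n => exact ⟨π n z, (hcomm s n z).symm⟩
    obtain ⟨-, hK2⟩ := ih K (onSub π K hKs) (isGradingProj_onSub hπ K hKs)
      (fun i n y => Subtype.ext (hcomm i n y)) (fun i y => Subtype.ext (h0 i (y : M)))
      (fun i hi y => by
        rcases hi.lt_or_eq with h | rfl
        · exact Subtype.ext (hs i h y)
        · exact Subtype.ext ((memK _).1 y.2))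
    obtain ⟨hC1, hC2⟩ := ih (M ⧸ P) (onQuot π P hPs) (isGradingProj_onQuot hπ P hPs)
      (fun i n y => by
        obtain ⟨y, rfl⟩ := Submodule.Quotient.mk_surjective P y
        rw [onQuot_mk, ← Submodule.Quotient.mk_smul, ← Submodule.Quotient.mk_smul, onQuot_mk,
          hcomm])
      (fun i y => by
        obtain ⟨y, rfl⟩ := Submodule.Quotient.mk_surjective P y
        rw [← Submodule.Quotient.mk_smul, onQuot_mk, h0, Submodule.Quotient.mk_zero])
      (fun i hi y => by
        obtain ⟨y, rfl⟩ := Submodule.Quotient.mk_surjective P y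
        rw [← Submodule.Quotient.mk_smul]
        rcases hi.lt_or_eq with h | rfl
        · rw [hs i h, Submodule.Quotient.mk_zero]
        · exact (Submodule.Quotient.mk_eq_zero P).2 ((memP _).2 ⟨y, rfl⟩))
    have fixed : ∀ {n} (y : LinearMap.range (π n)), π n (y : M) = y := by
      rintro n ⟨_, y, rfl⟩
      exact hπ.proj_self n y
    let g : ∀ n, LinearMap.range (π n) →ₗ[k] LinearMap.range (onQuot π P hPs n) := fun n =>
      { toFun := fun y => ⟨Submodule.Quotient.mk (y : M),
          Submodule.Quotient.mk (y : M), by rw [onQuot_mk, fixed]⟩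
        map_add' := fun y z => Subtype.ext rfl
        map_smul' := fun c y => Subtype.ext rfl }
    have hg : ∀ n, Function.Surjective (g n) := by
      rintro n ⟨_, y, rfl⟩
      obtain ⟨y, rfl⟩ := Submodule.Quotient.mk_surjective P y
      exact ⟨⟨π n y, y, rfl⟩, rfl⟩
    let f : ∀ n, LinearMap.range (π n) →ₗ[k] LinearMap.range (π (n + 1)) := fun n =>
      { toFun := fun y => ⟨a • (y : M), a • (y : M), by rw [hcomm, fixed]⟩
        map_add' := fun y z => Subtype.ext (smul_add a (y : M) z)
        map_smul' := fun c y => Subtype.ext (smul_comm a c (y : M)) }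
    have hg0 : ∀ n (y : LinearMap.range (π n)), g n y = 0 ↔ (y : M) ∈ P := fun n y => by
      rw [← Submodule.Quotient.mk_eq_zero]
      exact ⟨fun h => congrArg Subtype.val h, fun h => Subtype.ext h⟩
    have hfg : ∀ n, Function.Exact (f n) (g (n + 1)) := by
      intro n y
      rw [hg0, memP]
      constructor
      · rintro ⟨z, hz⟩
        refine ⟨⟨π n z, z, rfl⟩, Subtype.ext ?_⟩
        change a • π n z = y
        rw [← hcomm, hz, fixed]
      · rintro ⟨z, rfl⟩
        exact ⟨z, rfl⟩
    have hfin : ∀ n, Module.Finite k (LinearMap.range (π n)) := by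
      intro n
      induction n with
      -- The image of `a` has no component of degree 0, so M(0) embeds in (M/P)(0).
      | zero =>
        refine Module.Finite.of_injective (g 0) ((injective_iff_map_eq_zero _).2 fun y hy => ?_)
        obtain ⟨z, hz⟩ := (memP _).1 ((hg0 0 y).1 hy)
        refine Subtype.ext ?_
        rw [← fixed y, ← hz, h0]
        rfl
      | succ n ihn => exact (finrank_add_eq_of_exact (f n) (g (n + 1)) (hfg n) (hg _)).1
    have hker : ∀ n, Module.finrank k (LinearMap.ker (f n)) =
        Module.finrank k (LinearMap.range (onSub π K hKs n)) := by
      intro n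
      refine LinearEquiv.finrank_eq
        { toFun := fun y => ⟨⟨(y : LinearMap.range (π n)), (memK _).2 (congrArg Subtype.val y.2)⟩,
            ⟨(y : LinearMap.range (π n)), (memK _).2 (congrArg Subtype.val y.2)⟩,
            Subtype.ext (fixed (y : LinearMap.range (π n)))⟩
          map_add' := fun y z => rfl
          map_smul' := fun c y => rfl
          invFun := fun y => ⟨⟨((y : K) : M), by
            obtain ⟨_, z, rfl⟩ := y
            exact ⟨z, rfl⟩⟩, Subtype.ext ((memK _).1 (y : K).2)⟩
          left_inv := fun y => rfl
          right_inv := fun y => rfl }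
    refine ⟨hfin, .of_succ_sub ?_⟩
    have := hC2.comp_succ.sub hK2
    convert this using 2 with n
    rw [(finrank_add_eq_of_exact (f n) (g (n + 1)) (hfg n) (hg _)).2, hker]

end HilbertSerre

end IsGradingProj

end

/-! ### Truncations of graded modules and comparison of their dimensions -/

noncomputable section

namespace IsGradingProj

variable {k : Type*} [Field k]

section Trunc

variable {M : Type*} [AddCommGroup M] [Module k M]

/-- The sum of the components of degree at most `n`. -/
def trunc (π : ℕ → M →ₗ[k] M) (n : ℕ) : Submodule k M := ⨅ m ∈ Set.Ioi n, LinearMap.ker (π m)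

theorem mem_trunc {π : ℕ → M →ₗ[k] M} {n : ℕ} {x : M} :
    x ∈ trunc π n ↔ ∀ m, n < m → π m x = 0 := by
  simp [trunc]

theorem trunc_mono (π : ℕ → M →ₗ[k] M) : Monotone (trunc π) := fun _ _ h _ hx =>
  mem_trunc.2 fun m hm => mem_trunc.1 hx m (h.trans_lt hm)

variable {π : ℕ → M →ₗ[k] M} (hπ : IsGradingProj π)
include hπ

theorem sum_eq_of_mem_trunc {n : ℕ} {x : M} (hx : x ∈ trunc π n) :
    ∑ m ∈ Finset.range (n + 1), π m x = x :=
  hπ.sum_eq x (n + 1) fun m hm => mem_trunc.1 hx m hm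

theorem proj_mem_trunc {m n : ℕ} (h : m ≤ n) (x : M) : π m x ∈ trunc π n :=
  mem_trunc.2 fun _ hl => hπ.proj_ne (h.trans_lt hl).ne' x

theorem exists_mem_trunc (x : M) : ∃ n, x ∈ trunc π n := by
  obtain ⟨s, hs⟩ := hπ.bounded x
  exact ⟨s, mem_trunc.2 fun m hm => hs m hm.le⟩

/-- The components of degree at most `n` of an element of the truncation. -/
def truncEquiv (n : ℕ) :
    trunc π n ≃ₗ[k] ((m : Fin (n + 1)) → LinearMap.range (π m)) where
  toFun x m := ⟨π m x, x, rfl⟩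
  map_add' x y := funext fun m => Subtype.ext (map_add (π m) _ _)
  map_smul' c x := funext fun m => Subtype.ext (map_smul (π m) c (x : M))
  invFun f := ⟨∑ m, (f m : M), Submodule.sum_mem _ fun m _ => by
    obtain ⟨y, hy⟩ := (f m).2
    rw [← hy]
    exact hπ.proj_mem_trunc (Nat.lt_succ_iff.1 m.2) y⟩
  left_inv x := Subtype.ext (by
    have := hπ.sum_eq_of_mem_trunc x.2
    rwa [Finset.sum_range] at this)
  right_inv f := funext fun m => Subtype.ext (by
    change π m (∑ l, (f l : M)) = f m
    rw [map_sum, Finset.sum_eq_single m]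
    · obtain ⟨y, hy⟩ := (f m).2
      rw [← hy, hπ.proj_self]
    · intro l _ hl
      obtain ⟨y, hy⟩ := (f l).2
      rw [← hy, hπ.proj_ne]
      exact fun h => hl (Fin.ext h.symm)
    · simp)

theorem finite_trunc (h : ∀ n, Module.Finite k (LinearMap.range (π n))) (n : ℕ) :
    Module.Finite k (trunc π n) :=
  Module.Finite.equiv (hπ.truncEquiv n).symm

theorem finrank_trunc (h : ∀ n, Module.Finite k (LinearMap.range (π n))) (n : ℕ) :
    Module.finrank k (trunc π n) =
      ∑ m ∈ Finset.range (n + 1), Module.finrank k (LinearMap.range (π m)) := by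
  rw [(hπ.truncEquiv n).finrank_eq, Module.finrank_pi_fintype, Finset.sum_range]

theorem isEventuallyBinomial_finrank_trunc (h : ∀ n, Module.Finite k (LinearMap.range (π n)))
    (h' : IsEventuallyBinomial fun n => (Module.finrank k (LinearMap.range (π n)) : ℚ)) :
    IsEventuallyBinomial fun n => (Module.finrank k (trunc π n) : ℚ) := by
  refine .of_succ_sub ?_
  convert h'.comp_succ using 2 with n
  rw [hπ.finrank_trunc h, hπ.finrank_trunc h, Finset.sum_range_succ]
  push_cast
  ring

end Trunc

section GradedModule

variable {R M : Type*} [CommRing R] [Algebra k R] [AddCommGroup M] [Module k M]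
  [Module R M] [IsScalarTower k R M] {ρ : ℕ → R →ₗ[k] R} {π : ℕ → M →ₗ[k] M}
  (hρ : IsGradingProj ρ) (hπ : IsGradingProj π)
  (hsmul : ∀ i j a y, ρ i a = a → π j y = y → π (i + j) (a • y) = a • y)

section Smul

include hπ hsmul

/-- Only products of homogeneous elements are assumed homogeneous. For general `y`, decompose it:
the component of degree `n` alone contributes to degree `i + n`. -/
theorem proj_add_smul {i : ℕ} {a : R} (ha : ρ i a = a) (n : ℕ) (y : M) :
    π (i + n) (a • y) = a • π n y := by
  obtain ⟨s, hs⟩ := hπ.exists_mem_trunc y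
  conv_lhs => rw [← hπ.sum_eq_of_mem_trunc (trunc_mono π (le_max_left s n) hs)]
  rw [Finset.smul_sum, map_sum, Finset.sum_eq_single n]
  · exact hsmul i n a _ ha (hπ.proj_self n y)
  · intro m _ hm
    rw [← hsmul i m a _ ha (hπ.proj_self m y)]
    exact hπ.proj_ne (by omega) _
  · intro h
    simp at h

theorem proj_smul_of_lt {i n : ℕ} (h : n < i) {a : R} (ha : ρ i a = a) (y : M) :
    π n (a • y) = 0 := by
  obtain ⟨s, hs⟩ := hπ.exists_mem_trunc y
  rw [← hπ.sum_eq_of_mem_trunc hs, Finset.smul_sum, map_sum]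
  refine Finset.sum_eq_zero fun m _ => ?_
  rw [← hsmul i m a _ ha (hπ.proj_self m y)]
  exact hπ.proj_ne (by omega) _

include hρ

theorem smul_mem_trunc {i j : ℕ} {a : R} {y : M} (ha : a ∈ trunc ρ i) (hy : y ∈ trunc π j) :
    a • y ∈ trunc π (i + j) := by
  rw [← hρ.sum_eq_of_mem_trunc ha, Finset.sum_smul]
  refine Submodule.sum_mem _ fun m hm => mem_trunc.2 fun l hl => ?_
  rw [Finset.mem_range] at hm
  obtain ⟨l, rfl⟩ := Nat.exists_eq_add_of_le (show m ≤ l by omega)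
  rw [proj_add_smul hπ hsmul (hρ.proj_self m a), mem_trunc.1 hy l (by omega), smul_zero]

end Smul

end GradedModule

section Comparison

variable {R M : Type*} [CommRing R] [Algebra k R] [AddCommGroup M] [Module k M]
  [Module R M] [IsScalarTower k R M] {ρ : ℕ → R →ₗ[k] R} {π : ℕ → M →ₗ[k] M}

/-- The span of the products of elements of `R` of degree at most `n` and elements of `T`. -/
def truncSpan (ρ : ℕ → R →ₗ[k] R) (T : Set M) (n : ℕ) : Submodule k M :=
  Submodule.span k {y | ∃ a ∈ trunc ρ n, ∃ t ∈ T, y = a • t}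

theorem truncSpan_mono (ρ : ℕ → R →ₗ[k] R) (T : Set M) : Monotone (truncSpan ρ T) := by
  intro m n h
  refine Submodule.span_mono ?_
  rintro _ ⟨a, ha, t, ht, rfl⟩
  exact ⟨a, trunc_mono ρ h ha, t, ht, rfl⟩

theorem smul_mem_truncSpan (hρ : IsGradingProj ρ)
    (hmul : ∀ i j a b, ρ i a = a → ρ j b = b → ρ (i + j) (a • b) = a • b) {T : Set M}
    {i j : ℕ} {a : R} {y : M} (ha : a ∈ trunc ρ i) (hy : y ∈ truncSpan ρ T j) :
    a • y ∈ truncSpan ρ T (i + j) := by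
  induction hy using Submodule.span_induction with
  | mem y hy =>
    obtain ⟨b, hb, t, ht, rfl⟩ := hy
    rw [smul_smul]
    exact Submodule.subset_span ⟨a * b, smul_mem_trunc hρ hρ hmul ha hb, t, ht, rfl⟩
  | zero => rw [smul_zero]; exact zero_mem _
  | add y z _ _ hy hz => rw [smul_add]; exact add_mem hy hz
  | smul c y _ hy => rw [smul_comm]; exact Submodule.smul_mem _ c hy

/-- Degrees are nonnegative, so a homogeneous generator of degree d reaches degree n only through a
coefficient of degree n - d ≤ n. Homogeneity of the generators is essential here. -/
theorem trunc_le_truncSpan (hρ : IsGradingProj ρ) (hπ : IsGradingProj π) (h1 : ρ 0 1 = 1)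
    (hmul : ∀ i j a b, ρ i a = a → ρ j b = b → ρ (i + j) (a • b) = a • b)
    (hsmul : ∀ i j a y, ρ i a = a → π j y = y → π (i + j) (a • y) = a • y)
    {T : Set M} (hT : ∀ t ∈ T, ∃ d, π d t = t) (hspan : Submodule.span R T = ⊤) (n : ℕ) :
    trunc π n ≤ truncSpan ρ T n := by
  have h1' : ∀ n, (1 : R) ∈ trunc ρ n := fun n => by
    rw [← h1]
    exact hρ.proj_mem_trunc (Nat.zero_le n) 1
  have key : ∀ x : M, ∀ n, π n x ∈ truncSpan ρ T n := by
    intro x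
    have hx : x ∈ Submodule.span R T := hspan ▸ Submodule.mem_top
    induction hx using Submodule.span_induction with
    | mem t ht =>
      intro n
      obtain ⟨d, hd⟩ := hT t ht
      by_cases hnd : n = d
      · rw [hnd, hd]
        exact Submodule.subset_span ⟨1, h1' d, t, ht, (one_smul R t).symm⟩
      · rw [← hd, hπ.proj_ne hnd]
        exact zero_mem _
    | zero => intro n; rw [map_zero]; exact zero_mem _
    | add y z _ _ hy hz => intro n; rw [map_add]; exact add_mem (hy n) (hz n)
    | smul a y _ hy =>
      intro n
      obtain ⟨s, hs⟩ := hρ.exists_mem_trunc a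
      rw [← hρ.sum_eq_of_mem_trunc hs, Finset.sum_smul, map_sum]
      refine Submodule.sum_mem _ fun i _ => ?_
      rcases lt_or_ge n i with h | h
      · rw [proj_smul_of_lt hπ hsmul h (hρ.proj_self i a)]
        exact zero_mem _
      · obtain ⟨j, rfl⟩ := Nat.exists_eq_add_of_le h
        rw [proj_add_smul hπ hsmul (hρ.proj_self i a)]
        exact smul_mem_truncSpan hρ hmul (hρ.proj_mem_trunc le_rfl a) (hy j)
  intro x hx
  rw [← hπ.sum_eq_of_mem_trunc hx]
  exact Submodule.sum_mem _ fun m hm =>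
    truncSpan_mono ρ T (Nat.lt_succ_iff.1 (Finset.mem_range.1 hm)) (key x m)

theorem exists_homogeneous_generators [Module.Finite R M] (hπ : IsGradingProj π) :
    ∃ T : Finset M, (∀ t ∈ T, ∃ d, π d t = t) ∧ Submodule.span R (T : Set M) = ⊤ := by
  classical
  obtain ⟨S, hS⟩ := Module.Finite.fg_top (R := R) (M := M)
  choose s hs using hπ.exists_mem_trunc
  refine ⟨S.biUnion fun x => (Finset.range (s x + 1)).image fun m => π m x, ?_, ?_⟩
  · intro t ht
    simp only [Finset.mem_biUnion, Finset.mem_image] at ht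
    obtain ⟨x, -, m, -, rfl⟩ := ht
    exact ⟨m, hπ.proj_self m x⟩
  · rw [eq_top_iff, ← hS, Submodule.span_le]
    intro x hx
    rw [← hπ.sum_eq_of_mem_trunc (hs x)]
    refine Submodule.sum_mem _ fun m hm => Submodule.subset_span ?_
    simp only [Finset.coe_biUnion, Finset.coe_image, Set.mem_iUnion]
    exact ⟨x, hx, m, hm, rfl⟩

theorem exists_finrank_trunc_le [Module.Finite R M] (hρ : IsGradingProj ρ)
    (hπ : IsGradingProj π) (h1 : ρ 0 1 = 1)
    (hmul : ∀ i j a b, ρ i a = a → ρ j b = b → ρ (i + j) (a • b) = a • b)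
    (hsmul : ∀ i j a y, ρ i a = a → π j y = y → π (i + j) (a • y) = a • y)
    (hfin : ∀ n, Module.Finite k (LinearMap.range (ρ n))) :
    ∃ s : ℕ, s ≠ 0 ∧ ∀ n, Module.finrank k (trunc π n) ≤ s * Module.finrank k (trunc ρ n) := by
  obtain ⟨T, hT, hspan⟩ := exists_homogeneous_generators (R := R) hπ
  -- The summand 1 only ensures a nonzero factor, as `HasDimMult.const_mul` requires.
  refine ⟨T.card + 1, Nat.succ_ne_zero _, fun n => ?_⟩
  have := hρ.finite_trunc hfin n
  let Φ : (T → trunc ρ n) →ₗ[k] M :=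
    { toFun := fun c => ∑ t, (c t : R) • (t : M)
      map_add' := fun c d => by simp [add_smul, Finset.sum_add_distrib]
      map_smul' := fun c d => by simp [Finset.smul_sum] }
  have hle : trunc π n ≤ LinearMap.range Φ := by
    refine (trunc_le_truncSpan hρ hπ h1 hmul hsmul hT hspan n).trans (Submodule.span_le.2 ?_)
    rintro _ ⟨a, ha, t, ht, rfl⟩
    classical
    refine ⟨Pi.single ⟨t, ht⟩ ⟨a, ha⟩, ?_⟩
    change ∑ u, ((Pi.single ⟨t, ht⟩ ⟨a, ha⟩ : T → trunc ρ n) u : R) • (u : M) = a • t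
    rw [Finset.sum_eq_single ⟨t, ht⟩]
    · rw [Pi.single_eq_same]
    · intro u _ hu
      rw [Pi.single_eq_of_ne hu, ZeroMemClass.coe_zero, zero_smul]
    · simp
  calc Module.finrank k (trunc π n) ≤ Module.finrank k (LinearMap.range Φ) :=
        Submodule.finrank_mono hle
    _ ≤ Module.finrank k (T → trunc ρ n) := LinearMap.finrank_range_le Φ
    _ = T.card * Module.finrank k (trunc ρ n) := by
        rw [Module.finrank_pi_fintype, Finset.sum_const, Finset.card_univ, Fintype.card_coe,
          smul_eq_mul]
    _ ≤ _ := Nat.mul_le_mul_right _ (Nat.le_succ _)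

/-- The free module on the `v i` embeds in `M`. The `v i` need not be homogeneous; `D` bounds the
degrees of all their components. -/
theorem exists_mul_finrank_trunc_le (hρ : IsGradingProj ρ) (hπ : IsGradingProj π)
    (hsmul : ∀ i j a y, ρ i a = a → π j y = y → π (i + j) (a • y) = a • y)
    (hfin : ∀ n, Module.Finite k (LinearMap.range (ρ n)))
    (hfin' : ∀ n, Module.Finite k (LinearMap.range (π n)))
    {r : ℕ} {v : Fin r → M} (hv : LinearIndependent R v) :
    ∃ D, ∀ n, r * Module.finrank k (trunc ρ n) ≤ Module.finrank k (trunc π (n + D)) := by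
  choose s hs using hπ.exists_mem_trunc
  refine ⟨Finset.univ.sup fun i => s (v i), fun n => ?_⟩
  set D := Finset.univ.sup fun i => s (v i) with hD
  have := hρ.finite_trunc hfin n
  have := hπ.finite_trunc hfin' (n + D)
  let Φ : (Fin r → trunc ρ n) →ₗ[k] trunc π (n + D) :=
    { toFun := fun c => ⟨∑ i, (c i : R) • v i, Submodule.sum_mem _ fun i _ =>
        smul_mem_trunc hρ hπ hsmul (c i).2
          (trunc_mono π (Finset.le_sup (f := fun i => s (v i)) (Finset.mem_univ i)) (hs (v i)))⟩
      map_add' := fun c d => Subtype.ext (by simp [add_smul, Finset.sum_add_distrib])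
      map_smul' := fun c d => Subtype.ext (by simp [Finset.smul_sum]) }
  have hΦ : Function.Injective Φ := by
    refine (injective_iff_map_eq_zero _).2 fun c hc => ?_
    have := Fintype.linearIndependent_iff.1 hv (fun i => (c i : R)) (congrArg Subtype.val hc)
    exact funext fun i => Subtype.ext (this i)
  calc r * Module.finrank k (trunc ρ n) = Module.finrank k (Fin r → trunc ρ n) := by
        rw [Module.finrank_pi_fintype, Finset.sum_const, Finset.card_univ, Fintype.card_fin,
          smul_eq_mul]
    _ ≤ _ := LinearMap.finrank_le_finrank_of_injective hΦ

/-- A graded module with `r ≥ 1` linearly independent elements over a graded domain `R` that is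
generated in degree one has the dimension of `R`, and at least `r` times its multiplicity. -/
theorem exists_hasDimMult [IsNoetherianRing R] [Nontrivial R] [Module.Finite R M]
    (hρ : IsGradingProj ρ) (hπ : IsGradingProj π) (h1 : ρ 0 1 = 1)
    (hmul : ∀ i j a b, ρ i a = a → ρ j b = b → ρ (i + j) (a • b) = a • b)
    (hsmul : ∀ i j a y, ρ i a = a → π j y = y → π (i + j) (a • y) = a • y)
    {x : ℕ → R} (hx : Algebra.adjoin k (Set.range x) = ⊤) (hx1 : ∀ i, ρ 1 (x i) = x i) {s : ℕ}
    (hxs : ∀ i ≥ s, x i = 0) {r : ℕ} (hr : r ≠ 0) {v : Fin r → M} (hv : LinearIndependent R v) :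
    ∃ (d : ℕ) (e e' : ℚ), HasDimMult (fun n => Module.finrank k (trunc π n)) d e ∧
      HasDimMult (fun n => Module.finrank k (trunc ρ n)) d e' ∧ r * e' ≤ e ∧
      ∀ n, Module.Finite k (trunc π n) := by
  obtain ⟨hf, hb⟩ := hilbertSerre_aux hx s R ρ hρ
    (fun i n y => by rw [add_comm, proj_add_smul hρ hmul (hx1 i)])
    (fun i y => proj_smul_of_lt hρ hmul Nat.zero_lt_one (hx1 i) y)
    (fun i hi y => by rw [hxs i hi, zero_smul])
  obtain ⟨hf', hb'⟩ := hilbertSerre_aux hx s M π hπ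
    (fun i n y => by rw [add_comm, proj_add_smul hπ hsmul (hx1 i)])
    (fun i y => proj_smul_of_lt hπ hsmul Nat.zero_lt_one (hx1 i) y)
    (fun i hi y => by rw [hxs i hi, zero_smul])
  have hpos : ∀ n, Module.finrank k (trunc ρ n) ≠ 0 := fun n => by
    have := hρ.finite_trunc hf n
    have h2 : (1 : R) ∈ trunc ρ n := by
      rw [← h1]
      exact hρ.proj_mem_trunc (Nat.zero_le n) 1
    have : Nontrivial (trunc ρ n) := ⟨⟨1, h2⟩, 0, fun h => one_ne_zero (congrArg Subtype.val h)⟩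
    exact Module.finrank_pos.ne'
  obtain ⟨c, hc0, hc⟩ := exists_finrank_trunc_le hρ hπ h1 hmul hsmul hf
  obtain ⟨D, hD⟩ := exists_mul_finrank_trunc_le hρ hπ hsmul hf hf' hv
  obtain ⟨d', e', H'⟩ := (hρ.isEventuallyBinomial_finrank_trunc hf hb).exists_hasDimMult
    (.of_forall hpos)
  obtain ⟨d, e, H⟩ := (hπ.isEventuallyBinomial_finrank_trunc hf' hb').exists_hasDimMult (by
    filter_upwards [Filter.eventually_ge_atTop D] with n hn
    obtain ⟨m, rfl⟩ := Nat.exists_eq_add_of_le' hn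
    have := hD m
    have h3 : r * Module.finrank k (trunc ρ m) ≠ 0 := mul_ne_zero hr (hpos m)
    omega)
  -- The free submodule bounds the dimension from below and the homogeneous generators bound it from
  -- above. For the multiplicity only the lower comparison, with its factor `r`, is used.
  have hle := (H'.const_mul hr).dim_le_of_le (H.comp_add D) hD
  have hge := H.dim_le_of_le (H'.const_mul hc0) hc
  obtain rfl := le_antisymm hle hge
  exact ⟨d', e, e', H, H', (H'.const_mul hr).mult_le_of_le (H.comp_add D) hD,
    hπ.finite_trunc hf'⟩

end Comparison

end IsGradingProj

end

noncomputable section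

/-! ### Algebras generated by anticommuting elements -/

section Finiteness

variable {R A ι : Type*} [CommRing R] [Ring A] [Algebra R A]

/-- With B the algebra generated by `X`, the module W = B + By is stable under left multiplication
by `X` and by `y`, since yx = c - xy with c a scalar and y² is a scalar. As 1 ∈ W, it is the whole
algebra generated by `X` and `y`. -/
theorem fg_adjoin_insert {X : Set A} {y : A}
    (hX : (Subalgebra.toSubmodule (Algebra.adjoin R X)).FG)
    (hy : y * y ∈ (algebraMap R A).range)
    (hyX : ∀ x ∈ X, x * y + y * x ∈ (algebraMap R A).range) :
    (Subalgebra.toSubmodule (Algebra.adjoin R (insert y X))).FG := by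
  set B := Algebra.adjoin R X with hB
  set W : Submodule R A := Subalgebra.toSubmodule B ⊔
    (Subalgebra.toSubmodule B).map (LinearMap.mulRight R y) with hW
  have memW : ∀ w, w ∈ W ↔ ∃ b ∈ B, ∃ c ∈ B, b + c * y = w := by
    intro w
    rw [hW, Submodule.mem_sup]
    constructor
    · rintro ⟨b, hb, _, ⟨c, hc, rfl⟩, rfl⟩
      exact ⟨b, hb, c, hc, rfl⟩
    · rintro ⟨b, hb, c, hc, rfl⟩
      exact ⟨b, hb, c * y, ⟨c, hc, rfl⟩, rfl⟩
  have hBW : ∀ b ∈ B, b ∈ W := fun b hb => (memW b).2 ⟨b, hb, 0, B.zero_mem, by simp⟩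
  have hByW : ∀ b ∈ B, b * y ∈ W := fun b hb => (memW _).2 ⟨0, B.zero_mem, b, hb, by simp⟩
  have hmulW : ∀ b ∈ B, ∀ w ∈ W, b * w ∈ W := by
    intro b hb w hw
    obtain ⟨c, hc, d, hd, rfl⟩ := (memW w).1 hw
    exact (memW _).2 ⟨b * c, B.mul_mem hb hc, b * d, B.mul_mem hb hd, by
      rw [mul_add, mul_assoc]⟩
  have hyB : ∀ b ∈ B, y * b ∈ W := by
    intro b hb
    induction hb using Algebra.adjoin_induction with
    | mem x hx =>
      obtain ⟨r, hr⟩ := hyX x hx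
      have h1 : y * x = algebraMap R A r + (-x) * y := by rw [hr]; noncomm_ring
      rw [h1]
      exact add_mem (hBW _ (B.algebraMap_mem r))
        (hByW _ (B.neg_mem (Algebra.subset_adjoin hx)))
    | algebraMap r =>
      rw [← Algebra.commutes]
      exact hByW _ (B.algebraMap_mem r)
    | add b c _ _ hb hc => rw [mul_add]; exact add_mem hb hc
    | mul b c hbB hcB hb hc =>
      obtain ⟨b1, hb1, b2, hb2, h⟩ := (memW _).1 hb
      rw [← mul_assoc, ← h, add_mul, mul_assoc]
      exact add_mem (hBW _ (B.mul_mem hb1 hcB)) (hmulW _ hb2 _ hc)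
  have hyW : ∀ w ∈ W, y * w ∈ W := by
    intro w hw
    obtain ⟨b, hb, c, hc, rfl⟩ := (memW w).1 hw
    obtain ⟨c1, hc1, c2, hc2, h⟩ := (memW _).1 (hyB c hc)
    obtain ⟨r, hr⟩ := hy
    rw [mul_add, ← mul_assoc, ← h, add_mul, mul_assoc, ← hr]
    exact add_mem (hyB b hb)
      (add_mem (hByW _ hc1) (hBW _ (B.mul_mem hc2 (B.algebraMap_mem r))))
  have hall : ∀ x ∈ Algebra.adjoin R (insert y X), ∀ w ∈ W, x * w ∈ W := by
    intro x hx
    induction hx using Algebra.adjoin_induction with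
    | mem x hx =>
      rcases hx with rfl | hx
      · exact hyW
      · exact hmulW x (Algebra.subset_adjoin hx)
    | algebraMap r => exact hmulW _ (B.algebraMap_mem r)
    | add a b _ _ ha hb => intro w hw; rw [add_mul]; exact add_mem (ha w hw) (hb w hw)
    | mul a b _ _ ha hb => intro w hw; rw [mul_assoc]; exact ha _ (hb w hw)
  have hEq : Subalgebra.toSubmodule (Algebra.adjoin R (insert y X)) = W := by
    refine le_antisymm (fun x hx => ?_) ?_
    · simpa using hall x hx 1 (hBW 1 B.one_mem)
    · intro w hw
      obtain ⟨b, hb, c, hc, rfl⟩ := (memW w).1 hw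
      have hle : B ≤ Algebra.adjoin R (insert y X) := Algebra.adjoin_mono (Set.subset_insert y X)
      exact add_mem (hle hb)
        (Subalgebra.mul_mem _ (hle hc) (Algebra.subset_adjoin (Set.mem_insert y X)))
  rw [hEq]
  exact hX.sup (hX.map _)

/-- An algebra generated by finitely many elements which anticommute up to scalars is finite. -/
theorem Module.Finite.of_anticommute [Finite ι] {e : ι → A}
    (he : Algebra.adjoin R (Set.range e) = ⊤) (hsq : ∀ i, e i * e i ∈ (algebraMap R A).range)
    (hanti : ∀ i j, e i * e j + e j * e i ∈ (algebraMap R A).range) : Module.Finite R A := by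
  classical
  have key : ∀ s : Finset ι,
      (Subalgebra.toSubmodule (Algebra.adjoin R (e '' (s : Set ι)))).FG := by
    intro s
    induction s using Finset.induction_on with
    | empty =>
      rw [Finset.coe_empty, Set.image_empty, Algebra.adjoin_empty, Algebra.toSubmodule_bot,
        Submodule.one_eq_span]
      exact Submodule.fg_span_singleton 1
    | insert i s _ ih =>
      rw [Finset.coe_insert, Set.image_insert_eq]
      refine fg_adjoin_insert ih (hsq i) ?_
      rintro _ ⟨j, -, rfl⟩
      exact hanti j i
  have := Fintype.ofFinite ι
  have h := key Finset.univ
  rw [Finset.coe_univ, Set.image_univ, he, Algebra.top_toSubmodule] at h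
  exact ⟨h⟩

end Finiteness

/-- Anticommuting elements of an algebra whose squares are nonzero scalars. -/
structure IsAnticommSystem {F A ι : Type*} [Field F] [Ring A] [Algebra F A] (e : ι → A)
    (a : ι → F) : Prop where
  ne_zero : ∀ i, a i ≠ 0
  sq : ∀ i, e i * e i = algebraMap F A (a i)
  anti : ∀ {i j}, i ≠ j → e i * e j = -(e j * e i)

/-! ### Monomials in anticommuting elements -/

namespace IsAnticommSystem

variable {F A ι : Type*} [Field F] [Ring A] [Algebra F A] {e : ι → A} {a : ι → F}
  (h : IsAnticommSystem e a)

include h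

theorem comp {κ : Type*} {f : κ → ι} (hf : Function.Injective f) :
    IsAnticommSystem (e ∘ f) (a ∘ f) where
  ne_zero i := h.ne_zero (f i)
  sq i := h.sq (f i)
  anti hij := h.anti (hf.ne hij)

theorem map {B : Type*} [Ring B] [Algebra F B] (φ : A →ₐ[F] B) :
    IsAnticommSystem (fun i => φ (e i)) a where
  ne_zero := h.ne_zero
  sq i := by rw [← map_mul, h.sq, AlgHom.commutes]
  anti hij := by rw [← map_mul, h.anti hij, map_neg, map_mul]

/-- Moving `e j` across a monomial changes the sign once for each letter other than `j`. The number
of these is length minus count, which has the parity of length plus count. -/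
theorem mul_list_prod [DecidableEq ι] (j : ι) (l : List ι) :
    e j * (l.map e).prod = (-1 : F) ^ (l.length + l.count j) • ((l.map e).prod * e j) := by
  induction l with
  | nil => simp
  | cons i l ih =>
    rw [List.map_cons, List.prod_cons, List.length_cons]
    by_cases hij : i = j
    · subst hij
      rw [List.count_cons_self, ih, mul_smul_comm, ← mul_assoc, ih,
        show l.length + 1 + (l.count i + 1) = l.length + l.count i + 2 by ring,
        pow_add _ (l.length + l.count i) 2, smul_mul_assoc]
      simp
    · rw [List.count_cons_of_ne hij, ← mul_assoc, h.anti (Ne.symm hij), neg_mul, mul_assoc, ih,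
        mul_smul_comm, mul_assoc, show l.length + 1 + l.count j = l.length + l.count j + 1 by ring,
        pow_succ, mul_neg_one, neg_smul]

theorem list_prod_perm {l l' : List ι} (hp : l.Perm l') :
    (l.map e).prod = (l'.map e).prod ∨ (l.map e).prod = -(l'.map e).prod := by
  induction hp with
  | nil => simp
  | cons i _ ih =>
    simp only [List.map_cons, List.prod_cons]
    rcases ih with ih | ih
    · left; rw [ih]
    · right; rw [ih, mul_neg]
  | swap i j l =>
    simp only [List.map_cons, List.prod_cons]
    by_cases hij : j = i
    · left; rw [hij]
    · right; rw [← mul_assoc, h.anti hij, neg_mul, mul_assoc]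
  | trans _ _ ih ih' =>
    rcases ih with ih | ih <;> rcases ih' with ih' | ih' <;> simp [ih, ih']

/-- Up to sign the letters can be reordered so that equal ones are adjacent, and each pair
contributes a nonzero scalar. -/
theorem list_prod_of_even_count [DecidableEq ι] (n : ℕ) : ∀ l : List ι, l.length = n →
    (∀ j, Even (l.count j)) → ∃ c : F, c ≠ 0 ∧ (l.map e).prod = algebraMap F A c := by
  induction n using Nat.strong_induction_on with
  | _ n ih =>
    intro l hl hc
    cases l with
    | nil => exact ⟨1, one_ne_zero, by simp⟩
    | cons i l =>
      have hi : i ∈ l := by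
        have := hc i
        rw [List.count_cons_self] at this
        refine List.count_pos_iff.1 (Nat.pos_of_ne_zero fun h0 => ?_)
        rw [h0] at this
        exact absurd this (by decide)
      have hp := List.perm_cons_erase hi
      obtain ⟨c, hc0, hcl⟩ := ih (l.erase i).length (by
        have := hp.length_eq
        simp only [List.length_cons] at this hl
        omega) (l.erase i) rfl (fun j => by
          have h1 := hc j
          rw [List.count_cons, hp.count_eq, List.count_cons] at h1
          split_ifs at h1 with h2
          · rw [add_assoc] at h1
            exact (Nat.even_add.1 h1).2 (by decide)
          · simpa using h1)
      have hm : ∀ x : A, e i * (e i * x) = a i • x := fun x => by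
        rw [← mul_assoc, h.sq, Algebra.smul_def]
      rcases h.list_prod_perm hp with h1 | h1
      · refine ⟨a i * c, mul_ne_zero (h.ne_zero i) hc0, ?_⟩
        rw [List.map_cons, List.prod_cons, h1, List.map_cons, List.prod_cons, hm, hcl,
          Algebra.smul_def, map_mul]
      · refine ⟨-(a i * c), neg_ne_zero.2 (mul_ne_zero (h.ne_zero i) hc0), ?_⟩
        rw [List.map_cons, List.prod_cons, h1, List.map_cons, List.prod_cons, mul_neg, hm, hcl,
          Algebra.smul_def, map_neg, map_mul]

/-- The sign is left open: it does not matter whether the scalar or its negative is a square when -1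
is one. -/
theorem list_prod_mul_self (l : List ι) :
    (l.map e).prod * (l.map e).prod = algebraMap F A (l.map a).prod ∨
      (l.map e).prod * (l.map e).prod = -algebraMap F A (l.map a).prod := by
  classical
  induction l with
  | nil => simp
  | cons i l ih =>
    rw [List.map_cons, List.prod_cons, List.map_cons, List.prod_cons]
    set p := (l.map e).prod with hp
    have h1 : e i * p * (e i * p) = (-1 : F) ^ (l.length + l.count i) • (a i • (p * p)) := by
      have hm : e i * p * (e i * p) = (e i * p) * e i * p := by noncomm_ring
      have hm' : p * e i * e i * p = a i • (p * p) := by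
        rw [mul_assoc p, h.sq, ← Algebra.commutes, mul_assoc, Algebra.smul_def]
      rw [hm, hp, h.mul_list_prod, ← hp, smul_mul_assoc, smul_mul_assoc, hm']
    rw [h1]
    rcases neg_one_pow_eq_or F (l.length + l.count i) with h2 | h2 <;> rw [h2] <;>
      rcases ih with h3 | h3 <;> rw [h3] <;> simp [Algebra.smul_def]

/-! ### Simplicity of the algebra generated by anticommuting elements -/

section Simple

omit h in
theorem span_list_prod (hgen : Algebra.adjoin F (Set.range e) = ⊤) :
    Submodule.span F (Set.range fun l : List ι => (l.map e).prod) = ⊤ := by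
  refine eq_top_iff.2 fun x _ => ?_
  have hx : x ∈ Algebra.adjoin F (Set.range e) := hgen ▸ Algebra.mem_top
  induction hx using Algebra.adjoin_induction with
  | mem x hx =>
    obtain ⟨i, rfl⟩ := hx
    exact Submodule.subset_span ⟨[i], by simp⟩
  | algebraMap c =>
    rw [Algebra.algebraMap_eq_smul_one]
    exact Submodule.smul_mem _ _ (Submodule.subset_span ⟨[], by simp⟩)
  | add x y _ _ hx hy => exact add_mem (hx trivial) (hy trivial)
  | mul x y _ _ hx hy =>
    have := Submodule.mul_mem_mul (hx trivial) (hy trivial)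
    rw [Submodule.span_mul_span] at this
    refine Submodule.span_mono ?_ this
    rintro _ ⟨_, ⟨l, rfl⟩, _, ⟨l', rfl⟩, rfl⟩
    exact ⟨l ++ l', by simp⟩

variable [Fintype ι]

/-- A product of generators commuting with all generators is a scalar, or, if the number of
generators is odd, a scalar multiple of their product. -/
theorem list_prod_of_even [DecidableEq ι] (l : List ι)
    (hl : ∀ j, Even (l.length + l.count j)) :
    (∃ c : F, (l.map e).prod = algebraMap F A c) ∨ (Odd (Fintype.card ι) ∧
      ∃ c : F, (l.map e).prod = c • ((Finset.univ : Finset ι).toList.map e).prod) := by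
  -- Every count has the parity of the length. If it is even, the monomial is a scalar. If it is
  -- odd, every generator occurs an odd number of times, so their number is odd, and prefixing the
  -- product of all generators makes every count even.
  rcases Nat.even_or_odd l.length with hev | hodd
  · left
    obtain ⟨c, -, hc⟩ := h.list_prod_of_even_count _ l rfl fun j =>
      (Nat.even_add.1 (hl j)).1 hev
    exact ⟨c, hc⟩
  · right
    have hcount : ∀ j, Odd (l.count j) := fun j => by
      have := hl j
      rw [Nat.even_add'] at this
      exact this.1 hodd
    refine ⟨?_, ?_⟩
    · have h1 : l.length = ∑ j, l.count j := by
        rw [← List.sum_toFinset_count_eq_length]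
        refine Finset.sum_subset (Finset.subset_univ _) fun j _ hj => ?_
        rw [List.mem_toFinset] at hj
        exact List.count_eq_zero_of_not_mem hj
      rw [h1, Finset.odd_sum_iff_odd_card_odd] at hodd
      rwa [Finset.filter_true_of_mem fun j _ => hcount j] at hodd
    · set u := (Finset.univ : Finset ι).toList with hu
      have hcu : ∀ j, u.count j = 1 := fun j =>
        List.count_eq_one_of_mem (Finset.nodup_toList _) (by simp [hu])
      obtain ⟨c, -, hc⟩ := h.list_prod_of_even_count _ (u ++ l) rfl fun j => by
        rw [List.count_append, hcu]
        exact (hcount j).one_add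
      obtain ⟨w, hw0, hw⟩ := h.list_prod_of_even_count _ (u ++ u) rfl fun j => by
        rw [List.count_append, hcu]
        decide
      rw [List.map_append, List.prod_append] at hc hw
      refine ⟨w⁻¹ * c, ?_⟩
      have h2 : (u.map e).prod * ((u.map e).prod * (l.map e).prod) = w • (l.map e).prod := by
        rw [← mul_assoc, hw, Algebra.smul_def]
      rw [hc, ← Algebra.commutes, ← Algebra.smul_def] at h2
      rw [mul_smul, h2, smul_smul, inv_mul_cancel₀ hw0, one_smul]

omit [Fintype ι] in
-- The map x ↦ e_j x e_j is diagonal on monomials, with eigenvalue ±a_j according to the parity of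
-- length plus count.
theorem mul_linearCombination_filter_mul [DecidableEq ι] (j : ι) (f : List ι →₀ F)
    (q : List ι → Prop) [DecidablePred q] {s : F}
    (hq : ∀ l, q l → (-1 : F) ^ (l.length + l.count j) = s) :
    e j * Finsupp.linearCombination F (fun l : List ι => (l.map e).prod) (f.filter q) * e j =
      s • (a j • Finsupp.linearCombination F (fun l : List ι => (l.map e).prod) (f.filter q)) := by
  rw [Finsupp.linearCombination_apply, Finsupp.sum, Finset.mul_sum, Finset.sum_mul,
    Finset.smul_sum, Finset.smul_sum]
  refine Finset.sum_congr rfl fun l hl => ?_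
  rw [Finsupp.support_filter, Finset.mem_filter] at hl
  rw [mul_smul_comm, smul_mul_assoc, h.mul_list_prod, smul_mul_assoc, mul_assoc, h.sq,
    ← Algebra.commutes, ← Algebra.smul_def, hq l hl.2, smul_comm, smul_comm (a j)]

omit [Fintype ι] in
-- The map x ↦ a_j⁻¹ e_j x e_j preserves a two-sided ideal and is an involution with eigenvalues ±1.
-- As 2 is invertible, the ideal contains both eigencomponents of each of its elements.
theorem linearCombination_filter_mem [DecidableEq ι] (h2 : (2 : F) ≠ 0) (J : TwoSidedIdeal A)
    (j : ι) (f : List ι →₀ F)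
    (hf : Finsupp.linearCombination F (fun l : List ι => (l.map e).prod) f ∈ J) :
    Finsupp.linearCombination F (fun l : List ι => (l.map e).prod)
        (f.filter fun l => Even (l.length + l.count j)) ∈ J ∧
      Finsupp.linearCombination F (fun l : List ι => (l.map e).prod)
        (f.filter fun l => ¬ Even (l.length + l.count j)) ∈ J := by
  have hsmul : ∀ (c : F) {x : A}, x ∈ J → c • x ∈ J := fun c x hx => by
    rw [Algebra.smul_def]
    exact J.mul_mem_left _ _ hx
  have h₁ := h.mul_linearCombination_filter_mul j f
    (fun l => Even (l.length + l.count j)) (s := 1) fun l hl => Even.neg_one_pow hl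
  have h₂ := h.mul_linearCombination_filter_mul j f
    (fun l => ¬ Even (l.length + l.count j)) (s := -1)
    fun l hl => Odd.neg_one_pow (Nat.not_even_iff_odd.1 hl)
  have hsum := congrArg (Finsupp.linearCombination F (fun l : List ι => (l.map e).prod))
    (Finsupp.filter_add_filter_not f fun l => Even (l.length + l.count j))
  rw [map_add] at hsum
  generalize Finsupp.linearCombination F (fun l : List ι => (l.map e).prod)
    (f.filter fun l => Even (l.length + l.count j)) = x at *
  generalize Finsupp.linearCombination F (fun l : List ι => (l.map e).prod)
    (f.filter fun l => ¬ Even (l.length + l.count j)) = y at *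
  rw [← hsum] at hf
  have h3 : e j * (x + y) * e j ∈ J := J.mul_mem_right _ _ (J.mul_mem_left _ _ hf)
  rw [mul_add, add_mul, h₁, h₂, one_smul, neg_one_smul, ← sub_eq_add_neg, ← smul_sub] at h3
  have h4 := hsmul (a j)⁻¹ h3
  rw [smul_smul, inv_mul_cancel₀ (h.ne_zero j), one_smul] at h4
  have h5 := hsmul (2 : F)⁻¹ (J.add_mem hf h4)
  rw [show x + y + (x - y) = (2 : F) • x by module, smul_smul, inv_mul_cancel₀ h2, one_smul] at h5
  refine ⟨h5, ?_⟩
  have h6 := J.sub_mem hf h5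
  rwa [add_sub_cancel_left] at h6

/-- An algebra generated by anticommuting elements with nonzero scalar squares is simple, provided
that, if their number is odd, the product of the squares is not a square. -/
theorem isSimpleRing [Nontrivial A] (h2 : (2 : F) ≠ 0) (hneg : IsSquare (-1 : F))
    (hgen : Algebra.adjoin F (Set.range e) = ⊤)
    (hodd : Odd (Fintype.card ι) → ¬ IsSquare (∏ i, a i)) : IsSimpleRing A := by
  classical
  set E : List ι → A := fun l => (l.map e).prod with hE
  have hEapp : ∀ l l', E (l ++ l') = E l * E l' := fun l l' => by simp [hE]
  -- Induction on the number of monomials in an expression of a nonzero element of `J`. If some `e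
  -- j` separates two of them, one of the two eigencomponents is nonzero, lies in `J` and has a
  -- shorter expression. The monomials may be linearly dependent, so nonvanishing is carried as a
  -- hypothesis.
  have key : ∀ (J : TwoSidedIdeal A) (n : ℕ) (f : List ι →₀ F), f.support.card = n →
      Finsupp.linearCombination F E f ∈ J → Finsupp.linearCombination F E f ≠ 0 →
        (1 : A) ∈ J := by
    intro J n
    have hsmul : ∀ (c : F) {x : A}, x ∈ J → c • x ∈ J := fun c x hx => by
      rw [Algebra.smul_def]
      exact J.mul_mem_left _ _ hx
    have hscalar : ∀ c : F, c ≠ 0 → algebraMap F A c ∈ J → (1 : A) ∈ J := fun c hc hcJ => by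
      have := hsmul c⁻¹ hcJ
      rwa [Algebra.smul_def, ← map_mul, inv_mul_cancel₀ hc, map_one] at this
    induction n using Nat.strong_induction_on with
    | _ n ih =>
      intro f hn hfJ hf0
      by_cases hsplit : ∃ j, ∃ l ∈ f.support, ∃ l' ∈ f.support,
          Even (l.length + l.count j) ∧ ¬ Even (l'.length + l'.count j)
      · obtain ⟨j, l, hl, l', hl', hle, hlo⟩ := hsplit
        obtain ⟨hm₁, hm₂⟩ := h.linearCombination_filter_mem h2 J j f hfJ
        have hsum := congrArg (Finsupp.linearCombination F E)
          (Finsupp.filter_add_filter_not f fun l => Even (l.length + l.count j))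
        have hc₁ : (f.filter fun l => Even (l.length + l.count j)).support.card < n := by
          rw [← hn, Finsupp.support_filter]
          exact Finset.card_lt_card (Finset.filter_ssubset.2 ⟨l', hl', hlo⟩)
        have hc₂ : (f.filter fun l => ¬ Even (l.length + l.count j)).support.card < n := by
          rw [← hn, Finsupp.support_filter]
          exact Finset.card_lt_card (Finset.filter_ssubset.2 ⟨l, hl, not_not.2 hle⟩)
        by_cases hz : Finsupp.linearCombination F E
            (f.filter fun l => Even (l.length + l.count j)) = 0
        · refine ih _ hc₂ _ rfl hm₂ fun hz' => hf0 ?_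
          rw [← hsum, map_add, hz, hz', add_zero]
        · exact ih _ hc₁ _ rfl hm₁ hz
      · push Not at hsplit
        obtain ⟨l₀, hl₀⟩ : f.support.Nonempty := by
          rw [Finset.nonempty_iff_ne_empty]
          intro h0
          rw [Finsupp.support_eq_empty] at h0
          exact hf0 (by rw [h0, map_zero])
        -- Now all monomials have the same signs against every generator. Up to a scalar the
        -- reversed monomial is an inverse of `E l₀`, so multiplying by it keeps the element nonzero
        -- and makes every monomial central.
        obtain ⟨c₀, hc₀, hinv⟩ := h.list_prod_of_even_count _ (l₀.reverse ++ l₀) rfl fun j => by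
          rw [List.count_append, List.count_reverse]
          exact ⟨_, rfl⟩
        set x := Finsupp.linearCombination F E f with hx
        set z := ((Finset.univ : Finset ι).toList.map e).prod with hz
        have hxl : x * E l₀.reverse ∈ J := J.mul_mem_right _ _ hfJ
        have hx0 : x * E l₀.reverse ≠ 0 := fun h0 => hf0 (by
          have h3 := congrArg (· * E l₀) h0
          simp only [zero_mul] at h3
          rw [mul_assoc, ← hEapp] at h3
          change x * ((l₀.reverse ++ l₀).map e).prod = 0 at h3
          rw [hinv, ← Algebra.commutes, ← Algebra.smul_def] at h3
          exact (smul_eq_zero.1 h3).resolve_left hc₀)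
        have hform : ∃ c d : F, (d ≠ 0 → Odd (Fintype.card ι)) ∧
            x * E l₀.reverse = algebraMap F A c + d • z := by
          rw [hx, Finsupp.linearCombination_apply, Finsupp.sum, Finset.sum_mul]
          have hterm : ∀ l ∈ f.support, ∃ c d : F, (d ≠ 0 → Odd (Fintype.card ι)) ∧
              f l • E l * E l₀.reverse = algebraMap F A c + d • z := by
            intro l hl
            have hpar : ∀ j, Even ((l ++ l₀.reverse).length + (l ++ l₀.reverse).count j) := by
              intro j
              rw [List.length_append, List.count_append, List.length_reverse, List.count_reverse,
                add_add_add_comm]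
              rw [Nat.even_add]
              exact ⟨fun h3 => hsplit j l hl l₀ hl₀ h3, fun h3 => hsplit j l₀ hl₀ l hl h3⟩
            rw [smul_mul_assoc, ← hEapp]
            rcases h.list_prod_of_even _ hpar with ⟨c, hc⟩ | ⟨ho, c, hc⟩
            · refine ⟨f l * c, 0, fun h3 => absurd rfl h3, ?_⟩
              change f l • ((l ++ l₀.reverse).map e).prod = _
              rw [hc, zero_smul, add_zero, map_mul, Algebra.smul_def]
            · refine ⟨0, f l * c, fun _ => ho, ?_⟩
              change f l • ((l ++ l₀.reverse).map e).prod = _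
              rw [hc, map_zero, zero_add, mul_smul]
          choose! c d hd hcd using hterm
          refine ⟨∑ l ∈ f.support, c l, ∑ l ∈ f.support, d l, fun h3 => ?_, ?_⟩
          · obtain ⟨l, hl, hl0⟩ := Finset.exists_ne_zero_of_sum_ne_zero h3
            exact hd l hl hl0
          · rw [Finset.sum_congr rfl hcd, Finset.sum_add_distrib, map_sum, Finset.sum_smul]
        obtain ⟨c, d, hd, hcd⟩ := hform
        rw [hcd] at hxl hx0
        by_cases hd0 : d = 0
        · rw [hd0, zero_smul, add_zero] at hxl hx0
          exact hscalar c (fun hc => hx0 (by rw [hc, map_zero])) hxl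
        · have hns := hodd (hd hd0)
          obtain ⟨w, hw, hwz⟩ : ∃ w : F, ¬ IsSquare w ∧ z * z = algebraMap F A w := by
            have hprod : ((Finset.univ : Finset ι).toList.map a).prod = ∏ i, a i :=
              Finset.prod_map_toList _ _
            rcases h.list_prod_mul_self (Finset.univ : Finset ι).toList with h3 | h3
            · exact ⟨_, hns, by rw [hz, h3, hprod]⟩
            · refine ⟨-∏ i, a i, fun h4 => hns ?_, by rw [hz, h3, hprod, map_neg]⟩
              simpa using hneg.mul h4
          -- The norm of c + dz. With d ≠ 0 it vanishes only if w = (c/d)², but w is not a square.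
          have h5 : (algebraMap F A c + d • z) * (algebraMap F A c - d • z) =
              algebraMap F A (c ^ 2 - d ^ 2 * w) := by
            simp only [Algebra.algebraMap_eq_smul_one, add_mul, mul_sub, smul_mul_smul_comm,
              one_mul, mul_one, hwz]
            module
          refine hscalar (c ^ 2 - d ^ 2 * w) (fun h6 => hw ⟨c / d, ?_⟩)
            (h5 ▸ J.mul_mem_right _ _ hxl)
          field_simp
          linear_combination -h6
  refine ⟨⟨fun J => ?_⟩⟩
  by_cases hJ : J = ⊥
  · exact Or.inl hJ
  · right
    obtain ⟨x, hxJ, hx0⟩ : ∃ x ∈ J, x ≠ 0 := by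
      by_contra! hcon
      refine hJ (le_bot_iff.1 fun x hx => ?_)
      rw [TwoSidedIdeal.mem_bot]
      exact hcon x hx
    have hx : x ∈ Submodule.span F (Set.range E) := span_list_prod hgen ▸ Submodule.mem_top
    obtain ⟨f, rfl⟩ := (Finsupp.mem_span_range_iff_exists_finsupp).1 hx
    have h1 := key J _ f rfl hxJ hx0
    exact TwoSidedIdeal.one_mem_iff J |>.1 h1

end Simple

end IsAnticommSystem

end

/-! ### Lower bounds for dimensions of spaces with anticommuting operators -/

noncomputable section

namespace IsAnticommSystem

open Module

section AlgClosed

/-- Since f² = s², the product (f - s)(f + s) is zero, and 2s ≠ 0 makes the eigenspaces disjoint.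
The vectors f x ± s x are explicit eigenvectors, from which the eigenspaces are shown to be nonzero.
-/
theorem exists_eigenspaces {K E : Type*} [Field K] [AddCommGroup E] [Module K E]
    (h2 : (2 : K) ≠ 0) {f : End K E} {s : K} (hs : s ≠ 0) (hf : f * f = algebraMap K _ (s * s)) :
    Disjoint (LinearMap.ker (f - algebraMap K _ s)) (LinearMap.ker (f + algebraMap K _ s)) ∧
      (∀ x, f x - s • x ∈ LinearMap.ker (f + algebraMap K _ s)) ∧
      (∀ x, f x + s • x ∈ LinearMap.ker (f - algebraMap K _ s)) := by
  have hff : ∀ x, f (f x) = (s * s) • x := fun x => by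
    rw [← Module.End.mul_apply, hf, Module.algebraMap_end_apply]
  refine ⟨?_, fun x => ?_, fun x => ?_⟩
  · rw [Submodule.disjoint_def]
    intro x hx hx'
    rw [LinearMap.mem_ker, LinearMap.sub_apply, Module.algebraMap_end_apply, sub_eq_zero] at hx
    rw [LinearMap.mem_ker, LinearMap.add_apply, Module.algebraMap_end_apply, hx, ← two_smul K,
      smul_smul] at hx'
    exact (smul_eq_zero.1 hx').resolve_left (mul_ne_zero h2 hs)
  · rw [LinearMap.mem_ker, LinearMap.add_apply, Module.algebraMap_end_apply, map_sub, map_smul,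
      hff]
    module
  · rw [LinearMap.mem_ker, LinearMap.sub_apply, Module.algebraMap_end_apply, map_add, map_smul,
      hff]
    module

/-- The restriction of an anticommuting system of operators to a stable subspace. -/
theorem restrict {K E ι : Type*} [Field K] [AddCommGroup E] [Module K E] {e : ι → End K E}
    {a : ι → K} (h : IsAnticommSystem e a) {P : Submodule K E} (hP : ∀ i, ∀ x ∈ P, e i x ∈ P) :
    IsAnticommSystem (fun i => (e i).restrict (hP i) : ι → End K P) a where
  ne_zero := h.ne_zero
  sq i := LinearMap.ext fun x => Subtype.ext (LinearMap.congr_fun (h.sq i) (x : E))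
  anti hij := LinearMap.ext fun x => Subtype.ext (LinearMap.congr_fun (h.anti hij) (x : E))

/-- The products of `e 1` with the later generators commute with `e 0`, so they preserve its
eigenspaces, and they anticommute again. This drives the two-step induction below. -/
theorem mul_head {F A : Type*} [Field F] [Ring A] [Algebra F A] {n : ℕ} {e : Fin (n + 2) → A}
    {a : Fin (n + 2) → F} (h : IsAnticommSystem e a) :
    IsAnticommSystem (fun i : Fin n => e 1 * e i.succ.succ)
      (fun i => -(a 1 * a i.succ.succ)) := by
  have h1 : ∀ i : Fin n, e i.succ.succ * e 1 = -(e 1 * e i.succ.succ) := fun i =>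
    h.anti (by rw [← Fin.succ_zero_eq_one, Ne, Fin.succ_inj]; exact Fin.succ_ne_zero i)
  have h2 : ∀ i j : Fin n, e 1 * e i.succ.succ * (e 1 * e j.succ.succ) =
      -(algebraMap F A (a 1) * (e i.succ.succ * e j.succ.succ)) := fun i j => by
    rw [mul_assoc, ← mul_assoc (e i.succ.succ), h1, neg_mul, mul_neg, ← h.sq]
    noncomm_ring
  refine ⟨fun i => neg_ne_zero.2 (mul_ne_zero (h.ne_zero _) (h.ne_zero _)), fun i => ?_,
    fun {i j} hij => ?_⟩
  · rw [h2, h.sq, ← map_mul, map_neg]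
  · rw [h2, h2, h.anti (fun h3 => hij (Fin.succ_inj.1 (Fin.succ_inj.1 h3)))]
    noncomm_ring

/-- `e 1` maps the eigenspace `P` of `e 0` injectively into the opposite one `Q`, so the dimension
of `E` is at least twice that of `P`. On `P` the system of `mul_head`, with two members fewer, acts.
-/
theorem two_pow_le_finrank_of_isAlgClosed {K : Type*} [Field K] [IsAlgClosed K]
    (h2 : (2 : K) ≠ 0) (n : ℕ) :
    ∀ (E : Type*) [AddCommGroup E] [Module K E] [FiniteDimensional K E] [Nontrivial E]
      (e : Fin n → End K E) (a : Fin n → K), IsAnticommSystem e a →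
        2 ^ (n / 2) ≤ finrank K E := by
  induction n using Nat.twoStepInduction with
  | zero => intro E _ _ _ _ _ _ _; exact finrank_pos
  | one => intro E _ _ _ _ _ _ _; exact finrank_pos
  | more n ih _ =>
    intro E _ _ _ _ e a h
    obtain ⟨s, hs⟩ := IsAlgClosed.exists_eq_mul_self (a 0)
    have hs0 : s ≠ 0 := fun h0 => h.ne_zero 0 (by rw [hs, h0, mul_zero])
    obtain ⟨hdisj, hsub, hadd⟩ := exists_eigenspaces h2 hs0 (f := e 0) (by rw [h.sq, hs])
    set P := LinearMap.ker (e 0 - algebraMap K _ s) with hP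
    set Q := LinearMap.ker (e 0 + algebraMap K _ s) with hQ
    have memP : ∀ x, x ∈ P ↔ e 0 x = s • x := fun x => by
      rw [hP, LinearMap.mem_ker, LinearMap.sub_apply, Module.algebraMap_end_apply, sub_eq_zero]
    have memQ : ∀ x, x ∈ Q ↔ e 0 x = -(s • x) := fun x => by
      rw [hQ, LinearMap.mem_ker, LinearMap.add_apply, Module.algebraMap_end_apply,
        add_eq_zero_iff_eq_neg]
    have hanti : ∀ i, i ≠ 0 → ∀ x, e 0 (e i x) = -(e i (e 0 x)) := fun i hi x =>
      LinearMap.congr_fun (h.anti hi.symm) x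
    have h10 : (1 : Fin (n + 2)) ≠ 0 := by simp
    have hinj : ∀ x, e 1 x = 0 → x = 0 := fun x hx => by
      have h3 : e 1 (e 1 x) = a 1 • x := LinearMap.congr_fun (h.sq 1) x
      rw [hx, map_zero] at h3
      exact (smul_eq_zero.1 h3.symm).resolve_left (h.ne_zero 1)
    have hPQ : ∀ x ∈ P, e 1 x ∈ Q := fun x hx => by
      rw [memP] at hx
      rw [memQ, hanti 1 h10, hx, map_smul]
    have hQP : ∀ x ∈ Q, e 1 x ∈ P := fun x hx => by
      rw [memQ] at hx
      rw [memP, hanti 1 h10, hx, map_neg, map_smul, neg_neg]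
    have hPne : Nontrivial P := by
      obtain ⟨x, hx⟩ := exists_ne (0 : E)
      rw [Submodule.nontrivial_iff_ne_bot, Submodule.ne_bot_iff]
      by_cases h3 : e 0 x + s • x = 0
      · refine ⟨e 1 (e 0 x - s • x), hQP _ (hsub x), fun h4 => hx ?_⟩
        have h5 : (2 * s) • x = (e 0 x + s • x) - (e 0 x - s • x) := by module
        rw [h3, hinj _ h4, sub_zero] at h5
        exact (smul_eq_zero.1 h5).resolve_left (mul_ne_zero h2 hs0)
      · exact ⟨_, hadd x, h3⟩
    have hle : finrank K P ≤ finrank K Q :=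
      LinearMap.finrank_le_finrank_of_injective (f := (e 1).restrict hPQ)
        ((injective_iff_map_eq_zero _).2 fun x hx =>
          Subtype.ext (hinj x (congrArg Subtype.val hx)))
    have hsum := Submodule.finrank_add_finrank_le_of_disjoint hdisj
    have hst : ∀ i : Fin n, ∀ x ∈ P, (e 1 * e i.succ.succ) x ∈ P := fun i x hx => by
      rw [memP] at hx ⊢
      rw [Module.End.mul_apply, hanti 1 h10, hanti _ (Fin.succ_ne_zero _), hx, map_neg, map_smul,
        map_smul, neg_neg]
    have := ih P _ _ (h.mul_head.restrict hst)
    rw [show (n + 2) / 2 = n / 2 + 1 by omega, pow_succ]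
    omega

theorem two_pow_le_finrank_of_stable {K E ι : Type*} [Field K] [IsAlgClosed K]
    [AddCommGroup E] [Module K E] [FiniteDimensional K E] [Fintype ι] (h2 : (2 : K) ≠ 0)
    {e : ι → End K E} {a : ι → K} (h : IsAnticommSystem e a) (P : Submodule K E) [Nontrivial P]
    (hP : ∀ i, ∀ x ∈ P, e i x ∈ P) : 2 ^ (Fintype.card ι / 2) ≤ finrank K P :=
  two_pow_le_finrank_of_isAlgClosed h2 _ P _ _
    ((h.restrict hP).comp (Fintype.equivFin ι).symm.injective)

end AlgClosed

variable {F : Type*} [Field F] {E : Type*} [AddCommGroup E] [Module F E] {ι : Type*}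
  {e : ι → End F E} {a : ι → F}

theorem _root_.LinearMap.baseChange_algebraMap_end (K : Type*) [Field K] [Algebra F K] (c : F) :
    (algebraMap F (End F E) c).baseChange K = algebraMap K (End K (K ⊗[F] E)) (algebraMap F K c) := by
  ext x
  change (1 : K) ⊗ₜ[F] (c • x) = algebraMap F K c • ((1 : K) ⊗ₜ[F] x)
  rw [TensorProduct.tmul_smul, algebraMap_smul]

theorem baseChange (h : IsAnticommSystem e a) (K : Type*) [Field K] [Algebra F K] :
    IsAnticommSystem (fun i => (e i).baseChange K) (fun i => algebraMap F K (a i)) where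
  ne_zero i := (map_ne_zero_iff _ (algebraMap F K).injective).2 (h.ne_zero i)
  sq i := by
    rw [← LinearMap.baseChange_mul, h.sq, LinearMap.baseChange_algebraMap_end]
  anti hij := by
    rw [← LinearMap.baseChange_mul, h.anti hij, LinearMap.baseChange_neg,
      LinearMap.baseChange_mul]

/-- The dimension of a space on which `k` anticommuting operators with nonzero scalar squares act
is at least `2 ^ ((k + 1) / 2)`, provided that, if `k` is odd, the product of these squares is not
a square. -/
theorem two_pow_le_finrank [CharZero F] [Fintype ι] [FiniteDimensional F E] [Nontrivial E]
    (h : IsAnticommSystem e a) (hneg : IsSquare (-1 : F))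
    (hodd : Odd (Fintype.card ι) → ¬ IsSquare (∏ i, a i)) :
    2 ^ ((Fintype.card ι + 1) / 2) ≤ finrank F E := by
  classical
  set K := AlgebraicClosure F
  have h2K : (2 : K) ≠ 0 := by
    have := (map_ne_zero_iff (algebraMap F K) (algebraMap F K).injective).2 (two_ne_zero (α := F))
    rwa [map_ofNat] at this
  have hK := h.baseChange K
  have hreindex := hK.comp (Fintype.equivFin ι).symm.injective
  rcases Nat.even_or_odd (Fintype.card ι) with hev | ho
  · have h3 := two_pow_le_finrank_of_isAlgClosed h2K _ (K ⊗[F] E) _ _ hreindex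
    rw [Module.finrank_baseChange] at h3
    obtain ⟨m, hm⟩ := hev
    rwa [show (Fintype.card ι + 1) / 2 = Fintype.card ι / 2 by omega]
  · have hns := hodd ho
    set u := (Finset.univ : Finset ι).toList with hu
    -- For an odd number of generators, their product commutes with each of them, and its square is
    -- a nonsquare scalar.
    set z := (u.map e).prod with hz
    have hcomm : ∀ j, e j * z = z * e j := fun j => by
      have hcu : u.count j = 1 := List.count_eq_one_of_mem (Finset.nodup_toList _) (by simp [hu])
      have hlen : u.length = Fintype.card ι := by rw [hu, Finset.length_toList, Finset.card_univ]
      rw [hz, h.mul_list_prod, hcu, hlen, Even.neg_one_pow ho.add_one, one_smul]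
    obtain ⟨w, hw, hwz⟩ : ∃ w : F, ¬ IsSquare w ∧ z * z = algebraMap F _ w := by
      have hprod : (u.map a).prod = ∏ i, a i := Finset.prod_map_toList _ _
      rcases h.list_prod_mul_self u with h3 | h3
      · exact ⟨_, hns, by rw [hz, h3, hprod]⟩
      · refine ⟨-∏ i, a i, fun h4 => hns ?_, by rw [hz, h3, hprod, map_neg]⟩
        simpa using hneg.mul h4
    obtain ⟨s, hs⟩ := IsAlgClosed.exists_eq_mul_self (algebraMap F K w)
    have hw0 : w ≠ 0 := fun h0 => hw (h0 ▸ IsSquare.zero)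
    have hs0 : s ≠ 0 := fun h0 => hw0 (by
      rw [h0, mul_zero] at hs
      exact (map_eq_zero_iff _ (algebraMap F K).injective).1 hs)
    set zK : End K (K ⊗[F] E) := z.baseChange K with hzK
    have hzK2 : zK * zK = algebraMap K _ (s * s) := by
      rw [hzK, ← LinearMap.baseChange_mul, hwz, ← hs, LinearMap.baseChange_algebraMap_end]
    -- If z became the scalar t over K, the trace of z, an element of F, would be t times the
    -- dimension of E. In characteristic 0 this puts t in F, although its square w has no root
    -- there. Hence both eigenvalues ±s occur, and each eigenspace is a stable subspace to which the
    -- bound over K applies.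
    have hzs : ∀ t : K, t * t = algebraMap F K w → zK ≠ algebraMap K _ t := by
      intro t ht hzt
      have htr : LinearMap.trace K _ zK = algebraMap F K (LinearMap.trace F E z) :=
        LinearMap.trace_baseChange z K
      have hn : (finrank F E : F) ≠ 0 := Nat.cast_ne_zero.2 finrank_pos.ne'
      rw [hzt, Algebra.algebraMap_eq_smul_one, map_smul, LinearMap.trace_one,
        Module.finrank_baseChange, smul_eq_mul, ← map_natCast (algebraMap F K)] at htr
      refine hw ⟨LinearMap.trace F E z / finrank F E, (algebraMap F K).injective ?_⟩
      have hn' : algebraMap F K (finrank F E : F) ≠ 0 :=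
        (map_ne_zero_iff _ (algebraMap F K).injective).2 hn
      rw [map_mul, map_div₀, ← htr, mul_div_cancel_right₀ _ hn', ht]
    obtain ⟨hdisj, hsub, hadd⟩ := exists_eigenspaces h2K hs0 hzK2
    have hstable : ∀ (t : K) (i : ι), ∀ x ∈ LinearMap.ker (zK - algebraMap K _ t),
        (e i).baseChange K x ∈ LinearMap.ker (zK - algebraMap K _ t) := by
      intro t i x hx
      have hc : zK * (e i).baseChange K = (e i).baseChange K * zK := by
        rw [hzK, ← LinearMap.baseChange_mul, ← LinearMap.baseChange_mul, hcomm]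
      rw [LinearMap.mem_ker, LinearMap.sub_apply, Module.algebraMap_end_apply, sub_eq_zero] at hx ⊢
      have := LinearMap.congr_fun hc x
      rw [Module.End.mul_apply, Module.End.mul_apply, hx, map_smul] at this
      exact this
    have hbound : ∀ t : K, Nontrivial (LinearMap.ker (zK - algebraMap K _ t)) →
        2 ^ (Fintype.card ι / 2) ≤ finrank K (LinearMap.ker (zK - algebraMap K _ t)) := by
      intro t _
      exact hK.two_pow_le_finrank_of_stable h2K _ (hstable t)
    have hneg' : zK + algebraMap K _ s = zK - algebraMap K _ (-s) := by
      rw [map_neg, sub_neg_eq_add]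
    rw [hneg'] at hdisj hsub
    have hP : Nontrivial (LinearMap.ker (zK - algebraMap K _ s)) := by
      rw [Submodule.nontrivial_iff_ne_bot]
      intro hbot
      rw [hbot] at hadd
      refine hzs (-s) (by rw [neg_mul_neg, hs]) (LinearMap.ext fun x => ?_)
      have := hadd x
      rw [Submodule.mem_bot] at this
      rw [Module.algebraMap_end_apply, neg_smul]
      exact eq_neg_of_add_eq_zero_left this
    have hQ : Nontrivial (LinearMap.ker (zK - algebraMap K _ (-s))) := by
      rw [Submodule.nontrivial_iff_ne_bot]
      intro hbot
      rw [hbot] at hsub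
      refine hzs s hs.symm (LinearMap.ext fun x => ?_)
      have := hsub x
      rw [Submodule.mem_bot, sub_eq_zero] at this
      rwa [Module.algebraMap_end_apply]
    have h3 := Submodule.finrank_add_finrank_le_of_disjoint hdisj
    have h4 := hbound s hP
    have h5 := hbound (-s) hQ
    rw [Module.finrank_baseChange] at h3
    obtain ⟨m, hm⟩ := ho
    rw [show (Fintype.card ι + 1) / 2 = Fintype.card ι / 2 + 1 by omega, pow_succ]
    omega

end IsAnticommSystem

end

/-! ### Modules of minimal dimension -/

noncomputable section

open Module

theorem IsSimpleRing.nonempty_linearEquiv (A : Type*) [Ring A] [IsSimpleRing A] [IsArtinianRing A]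
    (M E : Type*) [AddCommGroup M] [Module A M] [IsSimpleModule A M] [AddCommGroup E] [Module A E]
    [IsSimpleModule A E] : Nonempty (M ≃ₗ[A] E) := by
  obtain ⟨I, ⟨f⟩⟩ := IsSemisimpleRing.exists_linearEquiv_ideal_of_isSimpleModule A M
  obtain ⟨J, ⟨g⟩⟩ := IsSemisimpleRing.exists_linearEquiv_ideal_of_isSimpleModule A E
  have := IsSimpleModule.congr f.symm
  have := IsSimpleModule.congr g.symm
  obtain ⟨h⟩ := IsSimpleRing.isIsotypic A A J I
  exact ⟨f.trans (h.trans g.symm)⟩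

namespace IsAnticommSystem

variable {F A ι : Type*} [Field F] [CharZero F] [Ring A] [Algebra F A] [Fintype ι] {e : ι → A}
  {a : ι → F}

theorem two_pow_le_finrank_module (h : IsAnticommSystem e a) (hneg : IsSquare (-1 : F))
    (hodd : Odd (Fintype.card ι) → ¬ IsSquare (∏ i, a i)) (M : Type*) [AddCommGroup M] [Module F M]
    [Module A M] [IsScalarTower F A M] [FiniteDimensional F M] [Nontrivial M] :
    2 ^ ((Fintype.card ι + 1) / 2) ≤ finrank F M :=
  (h.map (Algebra.lsmul F F M)).two_pow_le_finrank hneg hodd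

/-- If some module over the algebra generated by an anticommuting system has the least possible
dimension, then so has every simple module. -/
theorem finrank_eq_of_isSimpleModule (h : IsAnticommSystem e a) (hneg : IsSquare (-1 : F))
    (hgen : Algebra.adjoin F (Set.range e) = ⊤)
    (hodd : Odd (Fintype.card ι) → ¬ IsSquare (∏ i, a i)) {M : Type*} [AddCommGroup M] [Module F M]
    [Module A M] [IsScalarTower F A M]
    (hM : finrank F M = 2 ^ ((Fintype.card ι + 1) / 2)) (E : Type*) [AddCommGroup E] [Module F E]
    [Module A E] [IsScalarTower F A E] [IsSimpleModule A E] :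
    finrank F E = 2 ^ ((Fintype.card ι + 1) / 2) := by
  have hpos : 0 < finrank F M := hM ▸ Nat.two_pow_pos _
  have : FiniteDimensional F M := FiniteDimensional.of_finrank_pos hpos
  have : Nontrivial M := Module.nontrivial_of_finrank_pos hpos
  have : Nontrivial A := by
    obtain ⟨x, hx⟩ := exists_ne (0 : M)
    refine ⟨1, 0, fun h01 => hx ?_⟩
    rw [← one_smul A x, h01, zero_smul]
  have := h.isSimpleRing two_ne_zero hneg hgen hodd
  have : Module.Finite F A := Module.Finite.of_anticommute hgen
    (fun i => ⟨a i, (h.sq i).symm⟩) fun i j => by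
      by_cases hij : i = j
      · rw [hij, h.sq, ← map_add]
        exact ⟨_, rfl⟩
      · rw [h.anti hij, neg_add_cancel]
        exact zero_mem _
  have : IsArtinianRing A := IsArtinianRing.of_finite F A
  -- A nonzero submodule obeys the same lower bound, so it already has the dimension of `M`.
  have : IsSimpleModule A M := by
    rw [isSimpleModule_iff]
    refine { eq_bot_or_eq_top := fun P => ?_ }
    by_cases hP : P = ⊥
    · exact Or.inl hP
    · right
      have : Nontrivial P := (Submodule.nontrivial_iff_ne_bot).2 hP
      have : FiniteDimensional F P :=
        FiniteDimensional.finiteDimensional_submodule (P.restrictScalars F)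
      have h1 : finrank F M ≤ finrank F (P.restrictScalars F) :=
        hM ▸ h.two_pow_le_finrank_module hneg hodd P
      have h2 := Submodule.eq_top_of_finrank_eq
        (le_antisymm (Submodule.finrank_le (P.restrictScalars F)) h1)
      rwa [Submodule.restrictScalars_eq_top_iff] at h2
  obtain ⟨f⟩ := IsSimpleRing.nonempty_linearEquiv A M E
  rw [← hM]
  exact (f.restrictScalars F).finrank_eq.symm

end IsAnticommSystem

/-! ### Clifford actions of a diagonalised bilinear form -/

namespace LinearMap.BilinForm

variable {F V : Type*} [Field F] [AddCommGroup V] [Module F V] {B : LinearMap.BilinForm F V}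
  {n : ℕ} {v : Basis (Fin n) F V}

theorem apply_eq_of_isOrthoᵢ (hv : B.IsOrthoᵢ v) (i : Fin n) (w : V) :
    B (v i) w = v.repr w i * B (v i) (v i) := by
  conv_lhs => rw [← v.sum_repr w]
  rw [map_sum, Finset.sum_eq_single i]
  · rw [map_smul, smul_eq_mul]
  · intro j _ hj
    rw [map_smul, LinearMap.isOrthoᵢ_def.1 hv i j hj.symm, smul_zero]
  · simp

theorem apply_eq_zero_of_isOrthoᵢ (hv : B.IsOrthoᵢ v) {i : Fin n} (hi : B (v i) (v i) = 0)
    (w : V) : B (v i) w = 0 := by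
  rw [apply_eq_of_isOrthoᵢ hv, hi, mul_zero]

/-- The rank of a bilinear form is the number of nonisotropic vectors of an orthogonal basis. -/
theorem finrank_range_of_isOrthoᵢ (hv : B.IsOrthoᵢ v)
    [Fintype {i : Fin n // B (v i) (v i) ≠ 0}] :
    finrank F (LinearMap.range B) = Fintype.card {i : Fin n // B (v i) (v i) ≠ 0} := by
  have hli : LinearIndependent F fun i : {i : Fin n // B (v i) (v i) ≠ 0} => B (v i) := by
    rw [Fintype.linearIndependent_iff]
    intro c hc i
    have h1 := LinearMap.congr_fun hc (v i)
    rw [LinearMap.sum_apply, Finset.sum_eq_single i] at h1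
    · exact (mul_eq_zero.1 h1).resolve_right i.2
    · intro j _ hj
      rw [LinearMap.smul_apply, LinearMap.isOrthoᵢ_def.1 hv j i fun h2 => hj (Subtype.ext h2),
        smul_zero]
    · simp
  have hr : LinearMap.range B =
      Submodule.span F (Set.range fun i : {i : Fin n // B (v i) (v i) ≠ 0} => B (v i)) := by
    rw [LinearMap.range_eq_map, ← v.span_eq, Submodule.map_span, ← Set.range_comp]
    refine le_antisymm (Submodule.span_le.2 ?_) (Submodule.span_mono ?_)
    · rintro _ ⟨i, rfl⟩
      by_cases hi : B (v i) (v i) = 0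
      · have h0 : B (v i) = 0 := LinearMap.ext (apply_eq_zero_of_isOrthoᵢ hv hi)
        rw [Function.comp_apply, h0]
        exact zero_mem _
      · exact Submodule.subset_span ⟨⟨i, hi⟩, rfl⟩
    · rintro _ ⟨i, rfl⟩
      exact ⟨i, rfl⟩
  rw [hr, finrank_span_eq_card hli]

/-- Setting v = w in the Clifford relation gives ρ(v)² = B(v, v)/2, whence the factor 2⁻¹. Isotropic
basis vectors are left out because their squares are zero. -/
theorem isAnticommSystem [CharZero F] {A : Type*} [Ring A] [Algebra F A] {ρ : V →ₗ[F] A}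
    (hρ : ∀ v w, ρ v * ρ w + ρ w * ρ v = algebraMap F A (B v w)) (hv : B.IsOrthoᵢ v) :
    IsAnticommSystem (fun i : {i : Fin n // B (v i) (v i) ≠ 0} => ρ (v i))
      (fun i => 2⁻¹ * B (v i) (v i)) where
  ne_zero i := mul_ne_zero (inv_ne_zero two_ne_zero) i.2
  sq i := by
    rw [map_mul (algebraMap F A), ← hρ, ← two_smul F, ← Algebra.smul_def, smul_smul,
      inv_mul_cancel₀ two_ne_zero, one_smul]
  anti {i j} hij := by
    have := hρ (v i) (v j)
    rw [LinearMap.isOrthoᵢ_def.1 hv i j fun h => hij (Subtype.ext h), map_zero] at this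
    exact eq_neg_of_add_eq_zero_left this

variable [CharZero F] [Fintype {i : Fin n // B (v i) (v i) ≠ 0}]
  {M : Type*} [AddCommGroup M] [Module F M]
  [FiniteDimensional F M] {ρ : V →ₗ[F] End F M}

theorem two_pow_le_finrank [Nontrivial M]
    (hρ : ∀ v w, ρ v * ρ w + ρ w * ρ v = algebraMap F _ (B v w)) (hv : B.IsOrthoᵢ v)
    (hneg : IsSquare (-1 : F))
    (hodd : Odd (Fintype.card {i : Fin n // B (v i) (v i) ≠ 0}) →
      ¬ IsSquare (∏ i : {i : Fin n // B (v i) (v i) ≠ 0}, 2⁻¹ * B (v i) (v i))) :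
    2 ^ ((finrank F (LinearMap.range B) + 1) / 2) ≤ finrank F M := by
  rw [finrank_range_of_isOrthoᵢ hv]
  exact (isAnticommSystem hρ hv).two_pow_le_finrank hneg hodd

/-- The radical of the form acts as zero on a module of the least possible dimension. -/
theorem eq_zero_of_finrank_eq
    (hρ : ∀ v w, ρ v * ρ w + ρ w * ρ v = algebraMap F _ (B v w)) (hv : B.IsOrthoᵢ v)
    (hneg : IsSquare (-1 : F))
    (hodd : Odd (Fintype.card {i : Fin n // B (v i) (v i) ≠ 0}) →
      ¬ IsSquare (∏ i : {i : Fin n // B (v i) (v i) ≠ 0}, 2⁻¹ * B (v i) (v i)))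
    (hM : finrank F M = 2 ^ ((finrank F (LinearMap.range B) + 1) / 2)) {u : V}
    (hu : ∀ w, B u w = 0) : ρ u = 0 := by
  have hpos : 0 < finrank F M := hM ▸ Nat.two_pow_pos _
  have : Nontrivial M := Module.nontrivial_of_finrank_pos hpos
  have hcomm : ∀ w x, ρ u (ρ w x) = -ρ w (ρ u x) := fun w x => by
    have h1 := LinearMap.congr_fun (hρ u w) x
    rw [hu, map_zero] at h1
    exact eq_neg_of_add_eq_zero_left h1
  have hsq : ∀ x, ρ u (ρ u x) = 0 := fun x => by
    have h1 := hcomm u x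
    rw [eq_neg_iff_add_eq_zero, ← two_smul F] at h1
    exact (smul_eq_zero.1 h1).resolve_left two_ne_zero
  have hstable : ∀ w, ∀ x ∈ LinearMap.ker (ρ u), ρ w x ∈ LinearMap.ker (ρ u) := fun w x hx => by
    rw [LinearMap.mem_ker] at hx ⊢
    rw [hcomm, hx, map_zero, neg_zero]
  -- A radical vector acts with square zero, so it cannot be injective on a nonzero space.
  have : Nontrivial (LinearMap.ker (ρ u)) := by
    rw [Submodule.nontrivial_iff_ne_bot]
    intro hbot
    rw [LinearMap.ker_eq_bot] at hbot
    obtain ⟨x, hx⟩ := exists_ne (0 : M)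
    exact hx (hbot (hbot (by rw [hsq, map_zero, map_zero])))
  -- The kernel is stable because `ρ u` anticommutes with every `ρ w`. So the lower bound applies to
  -- it, and that bound is the full dimension of `M`.
  have h1 := ((isAnticommSystem hρ hv).restrict (P := LinearMap.ker (ρ u))
    fun i => hstable (v i)).two_pow_le_finrank hneg hodd
  rw [← finrank_range_of_isOrthoᵢ hv, ← hM] at h1
  exact LinearMap.ker_eq_top.1 (Submodule.eq_top_of_finrank_eq
    (le_antisymm (Submodule.finrank_le _) h1))

end LinearMap.BilinForm

end

/-! ### The discriminant of a form of odd rank -/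

noncomputable section

namespace LinearMap.BilinForm

open Module

variable {F V : Type*} [Field F] [AddCommGroup V] [Module F V] {B : LinearMap.BilinForm F V}
  {n : ℕ} {v : Basis (Fin n) F V}

theorem apply_eq_sum_of_isOrthoᵢ (hv : B.IsOrthoᵢ v) (u w : V) :
    B u w = ∑ l, v.repr u l * v.repr w l * B (v l) (v l) := by
  conv_lhs => rw [← v.sum_repr u]
  rw [map_sum, LinearMap.sum_apply]
  refine Finset.sum_congr rfl fun l _ => ?_
  rw [map_smul, LinearMap.smul_apply, apply_eq_of_isOrthoᵢ hv, smul_eq_mul, mul_assoc]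

/-- Suppose that a field embedding `φ : F → F(X)` multiplies by `X` the values of the form on the
vectors of some basis. Then the discriminant of a form of odd rank is not a square. -/
theorem not_isSquare_prod_of_odd [CharZero F] {κ : Type*} [Fintype κ] (y : Basis κ F V)
    (φ : F →+* RatFunc F)
    (hφ : ∀ i j, φ (B (y i) (y j)) = RatFunc.X * RatFunc.C (B (y i) (y j)))
    (hv : B.IsOrthoᵢ v) [Fintype {i : Fin n // B (v i) (v i) ≠ 0}]
    (hodd : Odd (Fintype.card {i : Fin n // B (v i) (v i) ≠ 0})) :
    ¬ IsSquare (∏ i : {i : Fin n // B (v i) (v i) ≠ 0}, 2⁻¹ * B (v i) (v i)) := by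
  classical
  set d : Fin n → F := fun l => B (v l) (v l) with hd
  -- `φ` is controlled only on the Gram matrix of `y`. So pass from `v` to `y`, apply `φ`, and
  -- return to `v` through the constants: the first change of basis is transformed by `φ`, the
  -- second by `RatFunc.C`, and `Q` is their product.
  obtain ⟨Q, hQ⟩ : ∃ Q : Matrix (Fin n) (Fin n) (RatFunc F), ∀ i j,
      φ (B (v i) (v j)) = RatFunc.X * ∑ l, Q i l * RatFunc.C (d l) * Q j l := by
    set P : Matrix κ (Fin n) F := fun j l => v.repr (y j) l with hP
    set R : Matrix (Fin n) κ F := fun i j => y.repr (v i) j with hR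
    set G : Matrix κ κ F := fun i j => B (y i) (y j) with hG
    have hGP : G = P * Matrix.diagonal d * P.transpose := by
      ext i j
      rw [Matrix.mul_apply, hG]
      dsimp only
      rw [apply_eq_sum_of_isOrthoᵢ hv]
      refine Finset.sum_congr rfl fun l _ => ?_
      rw [Matrix.mul_diagonal, Matrix.transpose_apply, hP, hd]
      ring
    have hRG : ∀ i j, B (v i) (v j) = (R * G * R.transpose) i j := by
      intro i j
      conv_lhs => rw [← y.sum_repr (v i), ← y.sum_repr (v j)]
      simp only [map_sum, LinearMap.sum_apply, map_smul, LinearMap.smul_apply, smul_eq_mul]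
      rw [Matrix.mul_apply]
      refine Finset.sum_congr rfl fun i' _ => ?_
      rw [Matrix.mul_apply, Matrix.transpose_apply]
      exact mul_comm _ _
    refine ⟨R.map φ * P.map RatFunc.C, fun i j => ?_⟩
    have hφG : G.map φ = (RatFunc.X : RatFunc F) • G.map RatFunc.C :=
      Matrix.ext fun i j => hφ i j
    have h1 : (R * G * R.transpose).map φ = (RatFunc.X : RatFunc F) •
        (R.map φ * P.map RatFunc.C * Matrix.diagonal (fun l => RatFunc.C (d l)) *
          (R.map φ * P.map RatFunc.C).transpose) := by
      rw [Matrix.map_mul, Matrix.map_mul, hφG, hGP, Matrix.map_mul, Matrix.map_mul,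
        Matrix.diagonal_map (map_zero _), Matrix.transpose_mul, Matrix.transpose_map,
        Matrix.transpose_map, Matrix.mul_smul, Matrix.smul_mul]
      simp only [Matrix.mul_assoc]
    have h2 := congrFun (congrFun h1 i) j
    rw [Matrix.map_apply, ← hRG, Matrix.smul_apply, smul_eq_mul, Matrix.mul_apply] at h2
    simpa only [Matrix.mul_diagonal, Matrix.transpose_apply] using h2
  set k := Fintype.card {i : Fin n // B (v i) (v i) ≠ 0} with hk
  set D : F := ∏ i : {i : Fin n // B (v i) (v i) ≠ 0}, d i with hD
  have hD0 : D ≠ 0 := Finset.prod_ne_zero_iff.2 fun i _ => i.2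
  -- Isotropic basis vectors contribute nothing to the sum over `l`, so the identity restricts to a
  -- square matrix on the other indices, where determinants are nonzero.
  set Q' : Matrix {i : Fin n // B (v i) (v i) ≠ 0} {i : Fin n // B (v i) (v i) ≠ 0} (RatFunc F) :=
    fun i j => Q i j with hQ'
  have hmat : Matrix.diagonal (fun i : {i : Fin n // B (v i) (v i) ≠ 0} => φ (d i)) =
      (RatFunc.X : RatFunc F) • (Q' * Matrix.diagonal
        (fun i : {i : Fin n // B (v i) (v i) ≠ 0} => RatFunc.C (d i)) * Q'.transpose) := by
    ext i j
    have h1 : Matrix.diagonal (fun i : {i : Fin n // B (v i) (v i) ≠ 0} => φ (d i)) i j =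
        φ (B (v i) (v j)) := by
      by_cases hij : i = j
      · rw [hij, Matrix.diagonal_apply_eq]
      · rw [Matrix.diagonal_apply_ne _ hij,
          LinearMap.isOrthoᵢ_def.1 hv i j fun h => hij (Subtype.ext h), map_zero]
    rw [h1, hQ, Matrix.smul_apply, smul_eq_mul, Matrix.mul_apply]
    congr 1
    simp only [Matrix.mul_diagonal, Matrix.transpose_apply]
    change _ = ∑ l : {i : Fin n // B (v i) (v i) ≠ 0}, Q i l * RatFunc.C (d l) * Q j l
    rw [← Finset.sum_subset (Finset.subset_univ
      (Finset.univ.filter fun l : Fin n => B (v l) (v l) ≠ 0))]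
    · exact Finset.sum_subtype _ (by simp) _
    · intro l _ hl
      have hl0 : d l = 0 := by simpa using hl
      rw [hl0, map_zero, mul_zero, zero_mul]
  have hdet := congrArg Matrix.det hmat
  rw [Matrix.det_diagonal, Matrix.det_smul, Matrix.det_mul, Matrix.det_mul, Matrix.det_transpose,
    Matrix.det_diagonal, ← map_prod, ← map_prod, ← hk, ← hD] at hdet
  rintro ⟨b, hb⟩
  rw [Finset.prod_mul_distrib, Finset.prod_const, Finset.card_univ, ← hk, ← hD] at hb
  -- The power of 2 need not be a square; it is fixed by both embeddings of F and cancels in `key`.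
  have hDb : D = 2 ^ k * (b * b) := by
    rw [← hb, ← mul_assoc, ← mul_pow, mul_inv_cancel₀ two_ne_zero, one_pow, one_mul]
  have hb0 : b ≠ 0 := fun h0 => hD0 (by rw [hDb, h0, mul_zero, mul_zero])
  have hdetQ : Q'.det ≠ 0 := fun h0 => by
    rw [h0, zero_mul, zero_mul, mul_zero] at hdet
    exact hD0 ((map_eq_zero φ).1 hdet)
  rw [hDb] at hdet
  simp only [map_mul, map_pow, map_ofNat] at hdet
  have h20 : (2 : RatFunc F) ^ k ≠ 0 := by
    have : (2 : RatFunc F) = RatFunc.C 2 := (map_ofNat _ 2).symm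
    rw [this]
    exact pow_ne_zero _ ((map_ne_zero _).2 two_ne_zero)
  have hφb : φ b ≠ 0 := (map_ne_zero φ).2 hb0
  have hCb : (RatFunc.C b : RatFunc F) ≠ 0 := (map_ne_zero _).2 hb0
  have hX : (RatFunc.X : RatFunc F) ≠ 0 := RatFunc.X_ne_zero
  have key : φ b * φ b = RatFunc.X ^ k * ((Q'.det * RatFunc.C b) * (Q'.det * RatFunc.C b)) := by
    refine mul_left_cancel₀ h20 ?_
    rw [hdet]
    ring
  have hpow : ∀ m : ℕ, ((RatFunc.X : RatFunc F) ^ m).intDegree = m := by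
    intro m
    induction m with
    | zero => rw [pow_zero, RatFunc.intDegree_one, Nat.cast_zero]
    | succ m ih =>
      rw [pow_succ, RatFunc.intDegree_mul (pow_ne_zero _ hX) hX, ih, RatFunc.intDegree_X]
      push_cast
      ring
  -- Degrees give an even number on the left and `k` plus an even number on the right.
  have hdeg := congrArg RatFunc.intDegree key
  have hq : Q'.det * RatFunc.C b ≠ 0 := mul_ne_zero hdetQ hCb
  rw [RatFunc.intDegree_mul hφb hφb, RatFunc.intDegree_mul (pow_ne_zero _ hX) (mul_ne_zero hq hq),
    RatFunc.intDegree_mul hq hq, hpow] at hdeg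
  obtain ⟨m, hm⟩ := hodd
  omega

end LinearMap.BilinForm

end

/-! ### Generators and finiteness of gr U(g) -/

noncomputable section

namespace LieSuperalgebra

universe u v

variable {g : Type u} [AddCommGroup g] [Module ℂ g] (L : LieSuperalgebra g)

theorem ι_odd_mem (y : L.part 1) :
    L.toEnv (TensorAlgebra.ι ℂ (y : g)) ∈ L.envFiltration.F 1 :=
  L.mem_envFil le_rfl (Submodule.subset_span
    ⟨[(1, (y : g))], by simp, by simp [weight], by simp⟩)

/-- An element of `g₁` as an element of degree `1` of `gr U(g)`. -/
def oddSymb : L.part 1 →ₗ[ℂ] L.GrEnv :=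
  (L.envFiltration.symb 1).comp
    (((L.toEnv.toLinearMap.comp (TensorAlgebra.ι ℂ)).comp (L.part 1).subtype).codRestrict _
      L.ι_odd_mem)

theorem toEnv_rel {i j : ZMod 2} {x y : g} (hx : x ∈ L.part i) (hy : y ∈ L.part j) :
    L.toEnv (TensorAlgebra.ι ℂ x) * L.toEnv (TensorAlgebra.ι ℂ y) -
        superSign i j • (L.toEnv (TensorAlgebra.ι ℂ y) * L.toEnv (TensorAlgebra.ι ℂ x)) =
      L.toEnv (TensorAlgebra.ι ℂ (L.bracket x y)) := by
  have h : L.toEnv (TensorAlgebra.ι ℂ x * TensorAlgebra.ι ℂ y -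
      superSign i j • (TensorAlgebra.ι ℂ y * TensorAlgebra.ι ℂ x)) =
      L.toEnv (TensorAlgebra.ι ℂ (L.bracket x y)) :=
    RingQuot.mkAlgHom_rel ℂ (EnvRel.mk hx hy)
  rwa [map_sub, map_smul, map_mul, map_mul] at h

/-- The commutator [x, y] is odd, so it lies in U_1 and vanishes in the component of degree 3. -/
theorem evenSymb_mul_oddSymb (x : L.part 0) (y : L.part 1) :
    L.evenSymb x * L.oddSymb y = L.oddSymb y * L.evenSymb x := by
  simp only [evenSymb, oddSymb, LinearMap.comp_apply]
  rw [L.envFiltration.symb_mul, L.envFiltration.symb_mul]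
  refine L.envFiltration.symb_eq (n := 2 + 1) ?_
  have hr := L.toEnv_rel x.2 y.2
  have hb : L.bracket x y ∈ L.part 1 := by simpa using L.bracket_mem x.2 y.2
  have h3 := L.envFiltration.mono (show 1 ≤ 2 by norm_num) (L.ι_odd_mem ⟨_, hb⟩)
  rw [← hr, show superSign 0 1 = 1 by simp [superSign], one_smul] at h3
  exact h3

/-- In contrast to the other commutators, the bracket of two odd elements has degree exactly 2 and
survives in the graded algebra. This is the source of the Clifford relations. -/
theorem oddSymb_mul_add (x y : L.part 1) :
    L.oddSymb x * L.oddSymb y + L.oddSymb y * L.oddSymb x =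
      L.evenSymb (L.oddBracket x y) := by
  simp only [evenSymb, oddSymb, LinearMap.comp_apply]
  rw [L.envFiltration.symb_mul, L.envFiltration.symb_mul, ← map_add]
  refine congrArg (L.envFiltration.symb 2) (Subtype.ext ?_)
  have hr := L.toEnv_rel x.2 y.2
  rw [show superSign 1 1 = -1 by simp [superSign],
    neg_one_smul ℂ (L.toEnv (TensorAlgebra.ι ℂ (y : g)) * L.toEnv (TensorAlgebra.ι ℂ (x : g))),
    sub_neg_eq_add] at hr
  exact hr

/-- `gr U(g)` is generated by the symbols of the elements of `g₀` and `g₁`. -/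
theorem adjoin_symb :
    Algebra.adjoin ℂ (Set.range L.evenSymb ∪ Set.range L.oddSymb) = ⊤ := by
  set S := Algebra.adjoin ℂ (Set.range L.evenSymb ∪ Set.range L.oddSymb) with hS
  -- In the degree equal to its total weight, the symbol of a product is the product of the symbols.
  have hlist : ∀ l : List (ZMod 2 × g), (∀ p ∈ l, p.2 ∈ L.part p.1) →
      ∀ h : L.toEnv (l.map fun p => TensorAlgebra.ι ℂ p.2).prod ∈
        L.envFiltration.F (l.map fun p => weight p.1).sum,
      L.envFiltration.symb _ ⟨_, h⟩ ∈ S := by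
    intro l
    induction l with
    | nil =>
      intro _ h
      have h1 : L.envFiltration.symb 0 ⟨1, L.envFiltration.one_mem⟩ = 1 := rfl
      have h2 : L.envFiltration.symb 0 ⟨_, h⟩ =
          L.envFiltration.symb 0 ⟨1, L.envFiltration.one_mem⟩ :=
        congrArg _ (Subtype.ext (by simp))
      exact h2.trans h1 ▸ S.one_mem
    | cons p l ih =>
      intro hl h
      have hl' : ∀ p ∈ l, p.2 ∈ L.part p.1 := fun p hp => hl p (List.mem_cons_of_mem _ hp)
      have hmem : L.toEnv (l.map fun p => TensorAlgebra.ι ℂ p.2).prod ∈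
          L.envFiltration.F (l.map fun p => weight p.1).sum :=
        L.mem_envFil le_rfl (Submodule.subset_span ⟨l, hl', rfl, rfl⟩)
      have hp := hl p List.mem_cons_self
      obtain ⟨i, x⟩ := p
      have hx : ∃ hx : L.toEnv (TensorAlgebra.ι ℂ x) ∈ L.envFiltration.F (weight i),
          L.envFiltration.symb _ ⟨_, hx⟩ ∈ S := by
        rcases (by decide : ∀ i : ZMod 2, i = 0 ∨ i = 1) i with rfl | rfl
        · exact ⟨L.ι_even_mem ⟨x, hp⟩, Algebra.subset_adjoin (Or.inl ⟨⟨x, hp⟩, rfl⟩)⟩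
        · exact ⟨L.ι_odd_mem ⟨x, hp⟩, Algebra.subset_adjoin (Or.inr ⟨⟨x, hp⟩, rfl⟩)⟩
      obtain ⟨hx, hxS⟩ := hx
      have h3 := S.mul_mem hxS (ih hl' hmem)
      rw [L.envFiltration.symb_mul] at h3
      convert h3 using 1
      refine congrArg (L.envFiltration.symb _) (Subtype.ext ?_)
      simp
  have hpiece : ∀ n (a : L.envFiltration.F n), L.envFiltration.symb n a ∈ S := by
    rintro n ⟨a, ha⟩
    have ha' : a ∈ ⨆ m ≤ n, (L.tensorGrade m).map L.toEnv.toLinearMap := by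
      rw [← L.envFil_eq]
      exact ha
    -- U_n is spanned by products of weight m ≤ n. Those with m < n have zero symbol in degree n,
    -- and `hlist` covers those with m = n.
    have hle : (⨆ m ≤ n, (L.tensorGrade m).map L.toEnv.toLinearMap) ≤
        ((Subalgebra.toSubmodule S).comap (L.envFiltration.symb n)).map
          (L.envFiltration.F n).subtype := by
      refine iSup₂_le fun m hm => ?_
      rw [tensorGrade, Submodule.map_span_le]
      rintro _ ⟨l, hl, rfl, rfl⟩
      have hmem : L.toEnv (l.map fun p => TensorAlgebra.ι ℂ p.2).prod ∈
          L.envFiltration.F (l.map fun p => weight p.1).sum :=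
        L.mem_envFil le_rfl (Submodule.subset_span ⟨l, hl, rfl, rfl⟩)
      refine ⟨⟨_, L.envFiltration.mono hm hmem⟩, ?_, rfl⟩
      rcases hm.lt_or_eq with hlt | rfl
      · have h0 : L.envFiltration.symb n ⟨_, L.envFiltration.mono hm hmem⟩ =
            L.envFiltration.symb n 0 := by
          refine L.envFiltration.symb_eq ?_
          obtain ⟨k, rfl⟩ := Nat.exists_eq_succ_of_ne_zero (Nat.ne_zero_of_lt hlt)
          rw [ZeroMemClass.coe_zero, sub_zero]
          exact L.envFiltration.mono (Nat.lt_succ_iff.1 hlt) hmem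
        rw [map_zero] at h0
        change L.envFiltration.symb n _ ∈ S
        rw [h0]
        exact S.zero_mem
      · exact hlist l hl _
    obtain ⟨b, hb, hba⟩ := hle ha'
    have : b = ⟨a, ha⟩ := Subtype.ext hba
    exact this ▸ hb
  refine eq_top_iff.2 fun x _ => ?_
  induction x using DirectSum.induction_on with
  | zero => exact S.zero_mem
  | of n a =>
    obtain ⟨a, rfl⟩ := L.envFiltration.cls_surjective n a
    exact hpiece n a
  | add x y hx hy => exact S.add_mem (hx trivial) (hy trivial)

/-- `S(g₀)` acts centrally. -/
theorem evenHom_mul_comm (s : L.SymEven) (a : L.GrEnv) :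
    L.evenHom s * a = a * L.evenHom s := by
  have hgen : ∀ b ∈ Set.range L.evenSymb ∪ Set.range L.oddSymb,
      L.evenHom s * b = b * L.evenHom s := by
    intro b hb
    induction s using SymmetricAlgebra.induction with
    | algebraMap r => rw [AlgHom.commutes, Algebra.commutes]
    | ι x =>
      rw [evenHom_ι]
      rcases hb with ⟨y, rfl⟩ | ⟨y, rfl⟩
      · exact L.evenSymb_comm x y
      · exact L.evenSymb_mul_oddSymb x y
    | mul s t hs ht => rw [map_mul, mul_assoc, ht, ← mul_assoc, hs, mul_assoc]
    | add s t hs ht => rw [map_add, add_mul, mul_add, hs, ht]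
  have ha : a ∈ Algebra.adjoin ℂ (Set.range L.evenSymb ∪ Set.range L.oddSymb) :=
    L.adjoin_symb ▸ Algebra.mem_top
  induction ha using Algebra.adjoin_induction with
  | mem b hb => exact hgen b hb
  | algebraMap r => exact (Algebra.commutes r _).symm
  | add a b _ _ ha hb => rw [add_mul, mul_add, ha, hb]
  | mul a b _ _ ha hb => rw [← mul_assoc, ha, mul_assoc, hb, mul_assoc]

/-- A finite `gr U(g)`-module is finite over `S(g₀)`. -/
theorem finite_symEven [FiniteDimensional ℂ g] (N : Type v) [AddCommGroup N] [Module L.GrEnv N]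
    [Module.Finite L.GrEnv N] [Module L.SymEven N]
    (hmod : ∀ (s : L.SymEven) (x : N), s • x = L.evenHom s • x) : Module.Finite L.SymEven N := by
  let _ : Algebra L.SymEven L.GrEnv := L.evenHom.toRingHom.toAlgebra' L.evenHom_mul_comm
  have halg : ∀ s, algebraMap L.SymEven L.GrEnv s = L.evenHom s := fun s => rfl
  have : IsScalarTower L.SymEven L.GrEnv N := ⟨fun s a x => by
    rw [hmod, Algebra.smul_def, mul_smul, halg]⟩
  set b := Module.finBasis ℂ (L.part 1) with hb
  have hanti : ∀ x y : L.part 1, L.oddSymb x * L.oddSymb y + L.oddSymb y * L.oddSymb x =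
      algebraMap L.SymEven L.GrEnv (SymmetricAlgebra.ι ℂ _ (L.oddBracket x y)) := fun x y => by
    rw [oddSymb_mul_add, halg, evenHom_ι]
  have hfin : Module.Finite L.SymEven L.GrEnv := by
    refine Module.Finite.of_anticommute (e := fun i => L.oddSymb (b i)) ?_ (fun i => ?_)
      fun i j => ⟨_, (hanti (b i) (b j)).symm⟩
    · set T := Algebra.adjoin L.SymEven (Set.range fun i => L.oddSymb (b i)) with hT
      have hev : ∀ x, L.evenSymb x ∈ T := fun x => by
        rw [← evenHom_ι, ← halg]
        exact T.algebraMap_mem _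
      have hsc : ∀ (c : ℂ) {t : L.GrEnv}, t ∈ T → c • t ∈ T := fun c t ht => by
        have h1 : c • t = algebraMap L.SymEven L.GrEnv (algebraMap ℂ _ c) * t := by
          rw [halg, AlgHom.commutes, Algebra.smul_def]
        rw [h1]
        exact T.mul_mem (T.algebraMap_mem _) ht
      have hodd : ∀ y, L.oddSymb y ∈ T := fun y => by
        rw [← b.sum_repr y, map_sum]
        refine T.sum_mem fun i _ => ?_
        rw [map_smul]
        exact hsc _ (Algebra.subset_adjoin ⟨i, rfl⟩)
      refine eq_top_iff.2 fun x _ => ?_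
      have hx : x ∈ Algebra.adjoin ℂ (Set.range L.evenSymb ∪ Set.range L.oddSymb) :=
        L.adjoin_symb ▸ Algebra.mem_top
      induction hx using Algebra.adjoin_induction with
      | mem b hb =>
        rcases hb with ⟨y, rfl⟩ | ⟨y, rfl⟩
        · exact hev y
        · exact hodd y
      | algebraMap r =>
        rw [Algebra.algebraMap_eq_smul_one]
        exact hsc r T.one_mem
      | add a b _ _ ha hb => exact T.add_mem (ha trivial) (hb trivial)
      | mul a b _ _ ha hb => exact T.mul_mem (ha trivial) (hb trivial)
    · refine ⟨(2⁻¹ : ℂ) • SymmetricAlgebra.ι ℂ _ (L.oddBracket (b i) (b i)), ?_⟩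
      have h1 := hanti (b i) (b i)
      rw [← two_smul ℂ] at h1
      rw [halg] at h1 ⊢
      rw [map_smul, ← h1, smul_smul, inv_mul_cancel₀ two_ne_zero, one_smul]
  exact Module.Finite.trans L.GrEnv N

end LieSuperalgebra

end

/-! ### Projections of an internal grading, and the pairing of degrees -/

noncomputable section

namespace IsGradingProj

section Constructions

variable {k M : Type*} [Field k] [AddCommGroup M] [Module k M]

/-- One exact partial sum is enough: applying `π n` with `n ≥ s` to it shows that the later
components vanish. -/
theorem of_exists_sum_eq {π : ℕ → M →ₗ[k] M} (h1 : ∀ n x, π n (π n x) = π n x)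
    (h2 : ∀ {m n}, m ≠ n → ∀ x, π m (π n x) = 0)
    (h3 : ∀ x, ∃ s, ∑ n ∈ Finset.range s, π n x = x) : IsGradingProj π := by
  have hb : ∀ x s, ∑ n ∈ Finset.range s, π n x = x → ∀ n ≥ s, π n x = 0 := by
    intro x s hs n hn
    rw [← hs, map_sum]
    refine Finset.sum_eq_zero fun m hm => h2 ?_ x
    rw [Finset.mem_range] at hm
    omega
  refine ⟨h1, h2, fun x => (h3 x).imp fun s hs => hb x s hs, fun x s hs => ?_⟩
  obtain ⟨t, ht⟩ := h3 x
  have hcut : ∀ u, (∀ n ≥ u, π n x = 0) → ∑ n ∈ Finset.range u, π n x =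
      ∑ n ∈ Finset.range (max s t), π n x ∨ max s t < u := by
    intro u hu
    rcases le_or_gt u (max s t) with h | h
    · left
      refine Finset.sum_subset (Finset.range_mono h) fun n _ hn => hu n ?_
      simpa using hn
    · exact Or.inr h
  rcases hcut s hs with h | h
  · rcases hcut t (hb x t ht) with h' | h'
    · rw [h, ← h', ht]
    · exact absurd h' (by simp)
  · exact absurd h (by simp)

theorem exists_of_isInternal {𝒩 : ℕ → Submodule k M} (h : DirectSum.IsInternal 𝒩) :
    ∃ π : ℕ → M →ₗ[k] M, IsGradingProj π ∧ ∀ n x, π n x = x ↔ x ∈ 𝒩 n := by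
  let e : (⨁ n, 𝒩 n) ≃ₗ[k] M := LinearEquiv.ofBijective (DirectSum.coeLinearMap 𝒩) h
  let π : ℕ → M →ₗ[k] M := fun n =>
    (𝒩 n).subtype ∘ₗ (DirectSum.component k ℕ (fun n => 𝒩 n) n) ∘ₗ e.symm.toLinearMap
  have hmem : ∀ n x, π n x ∈ 𝒩 n := fun n x => Subtype.property _
  have he : ∀ n (x : 𝒩 n), e (DirectSum.lof k ℕ (fun n => 𝒩 n) n x) = x := fun n x =>
    DirectSum.coeLinearMap_lof 𝒩 n x
  have hsymm : ∀ n (x : 𝒩 n), e.symm x = DirectSum.lof k ℕ (fun n => 𝒩 n) n x := fun n x => by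
    rw [LinearEquiv.symm_apply_eq, he]
  have hself : ∀ n x, x ∈ 𝒩 n → π n x = x := fun n x hx => by
    change ((DirectSum.component k ℕ (fun n => 𝒩 n) n (e.symm x) : 𝒩 n) : M) = x
    rw [hsymm n ⟨x, hx⟩, DirectSum.component.lof_self]
  have hne : ∀ {m n} x, m ≠ n → x ∈ 𝒩 n → π m x = 0 := fun {m n} x hmn hx => by
    change ((DirectSum.component k ℕ (fun n => 𝒩 n) m (e.symm x) : 𝒩 m) : M) = 0
    rw [hsymm n ⟨x, hx⟩, DirectSum.component.of, dif_neg hmn.symm, ZeroMemClass.coe_zero]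
  have hsum : ∀ d : ⨁ n, 𝒩 n, ∃ s, ∀ t ≥ s, ∑ n ∈ Finset.range t, π n (e d) = e d := by
    intro d
    induction d using DirectSum.induction_on with
    | zero => exact ⟨0, by simp⟩
    | of n x =>
      refine ⟨n + 1, fun t ht => ?_⟩
      change ∑ m ∈ Finset.range t, π m (e (DirectSum.lof k ℕ (fun n => 𝒩 n) n x)) =
        e (DirectSum.lof k ℕ (fun n => 𝒩 n) n x)
      rw [he, Finset.sum_eq_single n, hself n _ x.2]
      · intro m _ hm
        exact hne _ hm x.2
      · intro hn
        simp at hn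
        omega
    | add x y hx hy =>
      obtain ⟨s, hs⟩ := hx
      obtain ⟨t, ht⟩ := hy
      refine ⟨max s t, fun u hu => ?_⟩
      simp only [map_add, Finset.sum_add_distrib]
      rw [hs u ((le_max_left _ _).trans hu), ht u ((le_max_right _ _).trans hu)]
  refine ⟨π, of_exists_sum_eq (fun n x => hself n _ (hmem n x))
    (fun {m n} hmn x => hne _ hmn (hmem n x)) (fun x => ?_), fun n x => ⟨fun hx => ?_, hself n x⟩⟩
  · obtain ⟨s, hs⟩ := hsum (e.symm x)
    have := hs s le_rfl
    rw [LinearEquiv.apply_symm_apply] at this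
    exact ⟨s, this⟩
  · rw [← hx]
    exact hmem n x

/-- The projections for the grading with components `M(2m - 1) + M(2m)`. -/
def pairUp (π : ℕ → M →ₗ[k] M) : ℕ → M →ₗ[k] M
  | 0 => π 0
  | m + 1 => π (2 * m + 1) + π (2 * m + 2)

section PairUp

variable {π : ℕ → M →ₗ[k] M} (hπ : IsGradingProj π)

theorem sum_pairUp (π : ℕ → M →ₗ[k] M) (x : M) (s : ℕ) :
    ∑ n ∈ Finset.range (s + 1), pairUp π n x = ∑ l ∈ Finset.range (2 * s + 1), π l x := by
  induction s with
  | zero => rfl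
  | succ s ih =>
    rw [Finset.sum_range_succ, ih, show 2 * (s + 1) + 1 = 2 * s + 1 + 1 + 1 by ring,
      Finset.sum_range_succ _ (2 * s + 1 + 1), Finset.sum_range_succ _ (2 * s + 1), add_assoc]
    rfl

include hπ

theorem proj_proj (m n : ℕ) (x : M) : π m (π n x) = if m = n then π n x else 0 := by
  split_ifs with h
  · rw [h, hπ.proj_self]
  · exact hπ.proj_ne h x

/-- Degree `l` lies in paired degree ⌈l/2⌉, which is `(l + 1) / 2`. -/
theorem pairUp_proj (m l : ℕ) (x : M) :
    pairUp π m (π l x) = if (l + 1) / 2 = m then π l x else 0 := by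
  cases m with
  | zero =>
    change π 0 (π l x) = _
    rw [hπ.proj_proj]
    split_ifs with h1 h2 h2
    · rfl
    · omega
    · omega
    · rfl
  | succ m =>
    change π (2 * m + 1) (π l x) + π (2 * m + 2) (π l x) = _
    rw [hπ.proj_proj, hπ.proj_proj]
    split_ifs <;> first | omega | simp

theorem isGradingProj_pairUp : IsGradingProj (pairUp π) := by
  refine of_exists_sum_eq (fun n x => ?_) (fun {m n} hmn x => ?_) (fun x => ?_)
  · cases n with
    | zero => exact hπ.proj_self 0 x
    | succ n =>
      change pairUp π (n + 1) (π (2 * n + 1) x + π (2 * n + 2) x) = π (2 * n + 1) x + π (2 * n + 2) x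
      rw [map_add, hπ.pairUp_proj, hπ.pairUp_proj, if_pos (by omega), if_pos (by omega)]
  · cases n with
    | zero =>
      change pairUp π m (π 0 x) = 0
      rw [hπ.pairUp_proj, if_neg (by omega)]
    | succ n =>
      change pairUp π m (π (2 * n + 1) x + π (2 * n + 2) x) = 0
      rw [map_add, hπ.pairUp_proj, hπ.pairUp_proj, if_neg (by omega), if_neg (by omega), add_zero]
  · obtain ⟨s, hs⟩ := hπ.bounded x
    exact ⟨s + 1, by rw [sum_pairUp]; exact hπ.sum_eq x _ fun n hn => hs n (by omega)⟩

theorem trunc_pairUp (n : ℕ) : trunc (pairUp π) n = trunc π (2 * n) := by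
  ext x
  constructor
  · intro hx
    rw [← (isGradingProj_pairUp hπ).sum_eq_of_mem_trunc hx, sum_pairUp]
    exact Submodule.sum_mem _ fun l hl =>
      hπ.proj_mem_trunc (Nat.lt_succ_iff.1 (Finset.mem_range.1 hl)) x
  · intro hx
    rw [← hπ.sum_eq_of_mem_trunc hx, ← sum_pairUp]
    exact Submodule.sum_mem _ fun l hl =>
      (isGradingProj_pairUp hπ).proj_mem_trunc (Nat.lt_succ_iff.1 (Finset.mem_range.1 hl)) x

/-- Here `f` will be the action of an element of degree `i` of S(g₀)/q. It raises degrees of N by `2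
* i`, hence paired degrees by `i`. -/
theorem pairUp_eq_self_of_mul {i j : ℕ} {f : M →ₗ[k] M}
    (hf : ∀ l x, π l x = x → π (2 * i + l) (f x) = f x) {y : M} (hy : pairUp π j y = y) :
    pairUp π (i + j) (f y) = f y := by
  have key : ∀ l x, (l + 1) / 2 = j → pairUp π (i + j) (f (π l x)) = f (π l x) := by
    intro l x hl
    rw [← hf l _ (hπ.proj_self l x), hπ.pairUp_proj, if_pos (by omega)]
  cases j with
  | zero =>
    change π 0 y = y at hy
    rw [← hy]
    exact key 0 y rfl
  | succ j =>
    change π (2 * j + 1) y + π (2 * j + 2) y = y at hy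
    rw [← hy, map_add, map_add, key _ _ (by omega), key _ _ (by omega)]

end PairUp

theorem hilbertGr_eq {N : Type*} [AddCommGroup N] [Module ℂ N] {𝒩 : ℕ → Submodule ℂ N}
    {π : ℕ → N →ₗ[ℂ] N} (hπ : IsGradingProj π) (hmem : ∀ n x, π n x = x ↔ x ∈ 𝒩 n)
    (hfin : ∀ n, Module.Finite ℂ (trunc (pairUp π) n)) (n : ℕ) :
    hilbertGr 𝒩 n = Module.finrank ℂ (trunc (pairUp π) n) := by
  have hrange : ∀ m, LinearMap.range (π m) = 𝒩 m := fun m => by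
    ext x
    rw [← hmem]
    exact ⟨fun ⟨y, hy⟩ => by rw [← hy, hπ.proj_self], fun hx => ⟨x, hx⟩⟩
  have hfin' : ∀ m, Module.Finite ℂ (LinearMap.range (π m)) := fun m => by
    have hle : LinearMap.range (π m) ≤ trunc (pairUp π) m := by
      rw [hπ.trunc_pairUp]
      rintro _ ⟨x, rfl⟩
      exact hπ.proj_mem_trunc (by omega) x
    have := hfin m
    exact Submodule.finiteDimensional_of_le hle
  rw [hπ.trunc_pairUp, hπ.finrank_trunc hfin', hilbertGr]
  exact Finset.sum_congr rfl fun m _ => by rw [hrange]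

end Constructions

end IsGradingProj

end

/-! ### Homogeneity of q and the grading of S(g₀)/q -/

noncomputable section

namespace LieSuperalgebra

universe u v

variable {g : Type u} [AddCommGroup g] [Module ℂ g] (L : LieSuperalgebra g)

theorem symGrade_mul {i j : ℕ} {a b : L.SymEven} (ha : a ∈ L.symGrade i) (hb : b ∈ L.symGrade j) :
    a * b ∈ L.symGrade (i + j) := by
  rw [symGrade, pow_add]
  exact Submodule.mul_mem_mul ha hb

theorem ι_mem_symGrade (x : L.part 0) : SymmetricAlgebra.ι ℂ _ x ∈ L.symGrade 1 := by
  rw [symGrade, pow_one]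
  exact ⟨x, rfl⟩

theorem one_mem_symGrade : (1 : L.SymEven) ∈ L.symGrade 0 := by
  rw [symGrade, pow_zero]
  exact Submodule.one_le.1 le_rfl

theorem iSup_symGrade : ⨆ m, L.symGrade m = ⊤ := by
  refine eq_top_iff.2 fun s _ => ?_
  induction s using SymmetricAlgebra.induction with
  | algebraMap r =>
    rw [Algebra.algebraMap_eq_smul_one]
    exact Submodule.smul_mem _ _ (Submodule.mem_iSup_of_mem 0 L.one_mem_symGrade)
  | ι x => exact Submodule.mem_iSup_of_mem 1 (L.ι_mem_symGrade x)
  | add s t hs ht => exact add_mem (hs trivial) (ht trivial)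
  | mul s t hs ht =>
    have h := Submodule.mul_mem_mul (hs trivial) (ht trivial)
    have hle : (⨆ m, L.symGrade m) * (⨆ m, L.symGrade m) ≤ ⨆ m, L.symGrade m := by
      simp only [Submodule.iSup_mul, Submodule.mul_iSup, iSup_le_iff]
      intro m n
      rw [Submodule.mul_le]
      exact fun a ha b hb => Submodule.mem_iSup_of_mem _ (L.symGrade_mul ha hb)
    exact hle h

theorem evenHom_mem_range_lof {m : ℕ} {s : L.SymEven} (hs : s ∈ L.symGrade m) :
    ∃ a : L.envFiltration.Piece (2 * m), L.evenHom s = DirectSum.of L.envFiltration.Piece _ a := by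
  induction m generalizing s with
  | zero =>
    rw [symGrade, pow_zero, Submodule.mem_one] at hs
    obtain ⟨c, rfl⟩ := hs
    refine ⟨c • (GradedMonoid.GOne.one : L.envFiltration.Piece 0), ?_⟩
    rw [AlgHom.commutes, Algebra.algebraMap_eq_smul_one]
    exact ((DirectSum.lof ℂ ℕ L.envFiltration.Piece 0).map_smul c _).symm
  | succ m ih =>
    rw [symGrade, pow_succ] at hs
    induction hs using Submodule.mul_induction_on' with
    | mem_mul_mem s hs t ht =>
      obtain ⟨a, ha⟩ := ih hs
      obtain ⟨x, rfl⟩ := ht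
      rw [map_mul, ha, evenHom_ι]
      exact ⟨_, DirectSum.of_mul_of _ _⟩
    | add s _ t _ hs ht =>
      obtain ⟨a, ha⟩ := hs
      obtain ⟨b, hb⟩ := ht
      exact ⟨a + b, by rw [map_add, ha, hb, map_add]⟩

/-- The ideal `q` is homogeneous. -/
def IsHomogeneousIdeal (q : Ideal L.SymEven) : Prop :=
  ∀ (T : Finset ℕ) (f : ℕ → L.SymEven), (∀ m ∈ T, f m ∈ L.symGrade m) →
    ∑ m ∈ T, f m ∈ q → ∀ m ∈ T, f m ∈ q

section Module

variable {N : Type v} [AddCommGroup N] [Module ℂ N] [Module L.GrEnv N] {𝒩 : ℕ → Submodule ℂ N}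
  (h_graded : ∀ (i j : ℕ) (a : L.envFiltration.Piece i) (x : N), x ∈ 𝒩 j →
      DirectSum.of L.envFiltration.Piece i a • x ∈ 𝒩 (i + j))
include h_graded

theorem evenHom_smul_mem {m j : ℕ} {s : L.SymEven} (hs : s ∈ L.symGrade m) {x : N}
    (hx : x ∈ 𝒩 j) : L.evenHom s • x ∈ 𝒩 (2 * m + j) := by
  obtain ⟨a, ha⟩ := L.evenHom_mem_range_lof hs
  rw [ha]
  exact h_graded _ _ a x hx

omit h_graded [Module ℂ N] in
theorem mem_evenAnnihilator {s : L.SymEven} :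
    s ∈ L.evenAnnihilator N ↔ ∀ x : N, L.evenHom s • x = 0 := by
  rw [evenAnnihilator, Ideal.mem_comap, Module.mem_annihilator]

/-- On a homogeneous `x` of degree `j` the terms `f l` give vectors of distinct degrees `2 * l + j`,
so their sum vanishes only if each of them does. -/
theorem isHomogeneousIdeal_evenAnnihilator (h_internal : DirectSum.IsInternal 𝒩) :
    L.IsHomogeneousIdeal (L.evenAnnihilator N) := by
  intro T f hf hsum m hm
  rw [mem_evenAnnihilator] at hsum ⊢
  intro x
  have hx : x ∈ ⨆ j, 𝒩 j := h_internal.submodule_iSup_eq_top ▸ Submodule.mem_top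
  induction hx using Submodule.iSup_induction' with
  | mem j x hx =>
    obtain ⟨π, hπ, hmem⟩ := IsGradingProj.exists_of_isInternal h_internal
    have h1 : ∀ l ∈ T, π (2 * l + j) (L.evenHom (f l) • x) = L.evenHom (f l) • x := fun l hl =>
      (hmem _ _).2 (L.evenHom_smul_mem h_graded (hf l hl) hx)
    have h2 := congrArg (π (2 * m + j)) (hsum x)
    rw [map_sum, Finset.sum_smul, map_sum, map_zero, Finset.sum_eq_single_of_mem m hm] at h2
    · rwa [h1 m hm] at h2
    · intro l hl hlm
      rw [← h1 l hl]
      exact hπ.proj_ne (by omega) _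
  | zero => rw [smul_zero]
  | add x y _ _ hx hy => rw [smul_add, hx, hy, add_zero]

end Module

section Quotient

variable {L} {q : Ideal L.SymEven} (hq : L.IsHomogeneousIdeal q)

/-- The component of degree `m` of `S(g₀)/q`. -/
def quotGrade (q : Ideal L.SymEven) (m : ℕ) : Submodule ℂ (L.SymEven ⧸ q) :=
  (L.symGrade m).map (Ideal.Quotient.mkₐ ℂ q).toLinearMap

theorem mk_mem_quotGrade {m : ℕ} {s : L.SymEven} (hs : s ∈ L.symGrade m) :
    Ideal.Quotient.mk q s ∈ quotGrade q m := ⟨s, hs, rfl⟩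

theorem iSup_quotGrade (q : Ideal L.SymEven) : ⨆ m, quotGrade q m = ⊤ := by
  simp only [quotGrade]
  rw [← Submodule.map_iSup, iSup_symGrade, Submodule.map_top, LinearMap.range_eq_top]
  exact Ideal.Quotient.mk_surjective

include hq

theorem IsHomogeneousIdeal.isInternal : DirectSum.IsInternal (quotGrade q) := by
  rw [DirectSum.isInternal_submodule_iff_iSupIndep_and_iSup_eq_top]
  refine ⟨?_, iSup_quotGrade q⟩
  rw [iSupIndep_iff_finsetSum_eq_zero_imp_eq_zero]
  intro T v hv hsum m hm
  choose! f hf hfv using hv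
  have hfv' : ∀ m ∈ T, Ideal.Quotient.mk q (f m) = v m := hfv
  rw [← hfv' m hm, Ideal.Quotient.eq_zero_iff_mem]
  refine hq T f (fun m hm => hf m hm) ?_ m hm
  rw [← Ideal.Quotient.eq_zero_iff_mem, map_sum, Finset.sum_congr rfl hfv', hsum]

omit hq in
theorem exists_sum_symGrade (s : L.SymEven) :
    ∃ (T : Finset ℕ) (f : ℕ → L.SymEven), (∀ m, f m ∈ L.symGrade m) ∧ s = ∑ m ∈ T, f m := by
  have hs : s ∈ ⨆ m, L.symGrade m := L.iSup_symGrade ▸ Submodule.mem_top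
  obtain ⟨f, hf, rfl⟩ := (Submodule.mem_iSup_iff_exists_finsupp _ _).1 hs
  exact ⟨f.support, f, hf, rfl⟩

/-- The homomorphism `S(g₀) → (S(g₀)/q)[X]` multiplying elements of degree `m` by `X ^ m`. -/
def gradeHom (q : Ideal L.SymEven) : L.SymEven →ₐ[ℂ] Polynomial (L.SymEven ⧸ q) :=
  SymmetricAlgebra.lift
    { toFun := fun x => Polynomial.C (Ideal.Quotient.mk q (SymmetricAlgebra.ι ℂ _ x)) * Polynomial.X
      map_add' := fun x y => by rw [map_add, map_add, map_add, add_mul]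
      map_smul' := fun c x => by
        rw [map_smul, RingHom.id_apply, ← smul_mul_assoc, Polynomial.smul_C]
        rfl }

omit hq in
theorem gradeHom_ι (x : L.part 0) : gradeHom q (SymmetricAlgebra.ι ℂ _ x) =
    Polynomial.C (Ideal.Quotient.mk q (SymmetricAlgebra.ι ℂ _ x)) * Polynomial.X := by
  rw [gradeHom, SymmetricAlgebra.lift_ι_apply]
  rfl

omit hq in
theorem gradeHom_eq {m : ℕ} {s : L.SymEven} (hs : s ∈ L.symGrade m) :
    gradeHom q s = Polynomial.C (Ideal.Quotient.mk q s) * Polynomial.X ^ m := by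
  induction m generalizing s with
  | zero =>
    rw [symGrade, pow_zero, Submodule.mem_one] at hs
    obtain ⟨c, rfl⟩ := hs
    rw [AlgHom.commutes, pow_zero, mul_one]
    rfl
  | succ m ih =>
    rw [symGrade, pow_succ] at hs
    induction hs using Submodule.mul_induction_on' with
    | mem_mul_mem s hs t ht =>
      obtain ⟨x, rfl⟩ := ht
      rw [map_mul, ih hs, gradeHom_ι, map_mul, map_mul, pow_succ]
      ring
    | add s _ t _ hs ht => rw [map_add, hs, ht, map_add, map_add, add_mul]

omit hq in
theorem eval_gradeHom (s : L.SymEven) :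
    Polynomial.eval 1 (gradeHom q s) = Ideal.Quotient.mk q s := by
  obtain ⟨T, f, hf, rfl⟩ := exists_sum_symGrade s
  rw [map_sum, map_sum, Polynomial.eval_finsetSum]
  refine Finset.sum_congr rfl fun m _ => ?_
  rw [gradeHom_eq (hf m)]
  simp

theorem IsHomogeneousIdeal.gradeHom_eq_zero {s : L.SymEven} (hs : s ∈ q) : gradeHom q s = 0 := by
  obtain ⟨T, f, hf, rfl⟩ := exists_sum_symGrade s
  rw [map_sum]
  refine Finset.sum_eq_zero fun m hm => ?_
  rw [gradeHom_eq (hf m), Ideal.Quotient.eq_zero_iff_mem.2 (hq T f (fun m _ => hf m) hs m hm),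
    map_zero, zero_mul]

/-- The field `F_q` embeds in `F_q(X)` so that the elements of `g₀` are multiplied by `X`. -/
theorem IsHomogeneousIdeal.exists_embedding [q.IsPrime] :
    ∃ φ : L.FracField q →+* RatFunc (L.FracField q), ∀ x : L.part 0,
      φ (L.evenToFrac q x) = RatFunc.X * RatFunc.C (L.evenToFrac q x) := by
  -- Homogeneity of q makes `gradeHom` descend to S(g₀)/q. Evaluation at X = 1 is a left inverse, so
  -- the map is injective and extends to the field of fractions.
  let φ₀ : (L.SymEven ⧸ q) →+* Polynomial (L.SymEven ⧸ q) :=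
    Ideal.Quotient.lift q (gradeHom q).toRingHom fun s hs => hq.gradeHom_eq_zero hs
  have hφ₀ : Function.Injective φ₀ := by
    refine Function.LeftInverse.injective (g := Polynomial.eval 1) fun z => ?_
    obtain ⟨s, rfl⟩ := Ideal.Quotient.mk_surjective z
    exact eval_gradeHom s
  let θ : (L.SymEven ⧸ q) →+* RatFunc (L.FracField q) :=
    (algebraMap (Polynomial (L.FracField q)) (RatFunc (L.FracField q))).comp
      ((Polynomial.mapRingHom (algebraMap (L.SymEven ⧸ q) (L.FracField q))).comp φ₀)
  have hθ_apply : ∀ z, θ z = algebraMap (Polynomial (L.FracField q)) (RatFunc (L.FracField q))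
      (Polynomial.map (algebraMap (L.SymEven ⧸ q) (L.FracField q)) (φ₀ z)) := fun z => rfl
  have hθ : Function.Injective θ := fun y z hyz => by
    rw [hθ_apply, hθ_apply] at hyz
    exact hφ₀ (Polynomial.map_injective _ (IsFractionRing.injective _ _)
      (RatFunc.algebraMap_injective _ hyz))
  refine ⟨IsFractionRing.lift hθ, fun x => ?_⟩
  have h1 : L.evenToFrac q x = algebraMap (L.SymEven ⧸ q) (L.FracField q)
      (Ideal.Quotient.mk q (SymmetricAlgebra.ι ℂ _ x)) := rfl
  have h2 : φ₀ (Ideal.Quotient.mk q (SymmetricAlgebra.ι ℂ _ x)) =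
      Polynomial.C (Ideal.Quotient.mk q (SymmetricAlgebra.ι ℂ _ x)) * Polynomial.X :=
    gradeHom_ι x
  rw [h1, IsFractionRing.lift_algebraMap]
  rw [hθ_apply, h2, Polynomial.map_mul, Polynomial.map_C, Polynomial.map_X, map_mul,
    RatFunc.algebraMap_C, RatFunc.algebraMap_X, mul_comm]

end Quotient

end LieSuperalgebra

end

/-! ### Hilbert functions over S(g₀)/q -/

noncomputable section

namespace LieSuperalgebra

universe u v

variable {g : Type u} [AddCommGroup g] [Module ℂ g] (L : LieSuperalgebra g) (q : Ideal L.SymEven)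

/-- Generators of degree one of `S(g₀)/q`. -/
def quotGen [FiniteDimensional ℂ g] (i : ℕ) : L.SymEven ⧸ q :=
  if h : i < Module.finrank ℂ (L.part 0) then
    Ideal.Quotient.mk q (SymmetricAlgebra.ι ℂ _ (Module.finBasis ℂ (L.part 0) ⟨i, h⟩)) else 0

theorem quotGen_mem [FiniteDimensional ℂ g] (i : ℕ) : L.quotGen q i ∈ quotGrade q 1 := by
  rw [quotGen]
  split_ifs
  · exact mk_mem_quotGrade (L.ι_mem_symGrade _)
  · exact zero_mem _

theorem quotGen_eq_zero [FiniteDimensional ℂ g] {i : ℕ} (h : i ≥ Module.finrank ℂ (L.part 0)) :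
    L.quotGen q i = 0 := by
  rw [quotGen, dif_neg (not_lt.2 h)]

theorem adjoin_quotGen [FiniteDimensional ℂ g] :
    Algebra.adjoin ℂ (Set.range (L.quotGen q)) = ⊤ := by
  refine eq_top_iff.2 fun z _ => ?_
  obtain ⟨s, rfl⟩ := Ideal.Quotient.mk_surjective z
  induction s using SymmetricAlgebra.induction with
  | algebraMap r => exact Subalgebra.algebraMap_mem _ r
  | ι x =>
    rw [← (Module.finBasis ℂ (L.part 0)).sum_repr x, map_sum, map_sum]
    refine Subalgebra.sum_mem _ fun i _ => ?_
    have hi : L.quotGen q i =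
        Ideal.Quotient.mk q (SymmetricAlgebra.ι ℂ _ (Module.finBasis ℂ (L.part 0) i)) := by
      rw [quotGen, dif_pos i.2]
    rw [map_smul]
    change Ideal.Quotient.mkₐ ℂ q (_ • _) ∈ _
    rw [map_smul]
    refine Subalgebra.smul_mem _ ?_ _
    rw [Ideal.Quotient.mkₐ_eq_mk, ← hi]
    exact Algebra.subset_adjoin (Set.mem_range_self _)
  | mul s t hs ht => rw [map_mul]; exact Subalgebra.mul_mem _ (hs trivial) (ht trivial)
  | add s t hs ht => rw [map_add]; exact Subalgebra.add_mem _ (hs trivial) (ht trivial)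

instance [FiniteDimensional ℂ g] : IsNoetherianRing (L.SymEven ⧸ q) := by
  have : Algebra.FiniteType ℂ (L.SymEven ⧸ q) := by
    refine ⟨Subalgebra.fg_def.2 ⟨_, ?_, L.adjoin_quotGen q⟩⟩
    refine (((Set.finite_lt_nat (Module.finrank ℂ (L.part 0))).image
      (L.quotGen q)).insert 0).subset ?_
    rintro _ ⟨i, rfl⟩
    by_cases h : i < Module.finrank ℂ (L.part 0)
    · exact Or.inr ⟨i, h, rfl⟩
    · exact Or.inl (L.quotGen_eq_zero q (not_lt.1 h))
  exact Algebra.FiniteType.isNoetherianRing ℂ _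

variable {L q}

/-- The comparison of the dimension and the multiplicity of a graded module with `r ≥ 1` linearly
independent elements and those of `S(g₀)/q`. -/
theorem IsHomogeneousIdeal.exists_hasDimMult [FiniteDimensional ℂ g] [q.IsPrime]
    (hq : L.IsHomogeneousIdeal q) {N : Type v} [AddCommGroup N] [Module ℂ N] [Module L.GrEnv N]
    {𝒩 : ℕ → Submodule ℂ N} (h_internal : DirectSum.IsInternal 𝒩)
    (h_graded : ∀ (i j : ℕ) (a : L.envFiltration.Piece i) (x : N), x ∈ 𝒩 j →
      DirectSum.of L.envFiltration.Piece i a • x ∈ 𝒩 (i + j))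
    [Module (L.SymEven ⧸ q) N] [IsScalarTower ℂ (L.SymEven ⧸ q) N]
    [Module.Finite (L.SymEven ⧸ q) N]
    (hmod : ∀ (s : L.SymEven) (x : N), Ideal.Quotient.mk q s • x = L.evenHom s • x)
    {r : ℕ} (hr : r ≠ 0) {v : Fin r → N} (hv : LinearIndependent (L.SymEven ⧸ q) v) :
    ∃ (d : ℕ) (e e' : ℚ), HasDimMult (hilbertGr 𝒩) d e ∧ HasDimMult (L.hilbertSym q) d e' ∧
      r * e' ≤ e := by
  obtain ⟨π, hπ, hπmem⟩ := IsGradingProj.exists_of_isInternal h_internal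
  obtain ⟨ρ, hρ, hρmem⟩ := IsGradingProj.exists_of_isInternal hq.isInternal
  have h1 : ρ 0 1 = 1 := (hρmem 0 1).2 (mk_mem_quotGrade L.one_mem_symGrade)
  have hmul : ∀ i j a b, ρ i a = a → ρ j b = b → ρ (i + j) (a • b) = a • b := by
    intro i j a b ha hb
    rw [hρmem] at ha hb ⊢
    obtain ⟨s, hs, rfl⟩ := ha
    obtain ⟨t, ht, rfl⟩ := hb
    exact ⟨s * t, L.symGrade_mul hs ht, map_mul (Ideal.Quotient.mk q) s t⟩
  have hsmul : ∀ i j a y, ρ i a = a → IsGradingProj.pairUp π j y = y →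
      IsGradingProj.pairUp π (i + j) (a • y) = a • y := by
    intro i j a y ha hy
    refine hπ.pairUp_eq_self_of_mul (f := Algebra.lsmul ℂ ℂ N a) (fun l x hx => ?_) hy
    rw [hρmem] at ha
    rw [hπmem] at hx ⊢
    obtain ⟨s, hs, rfl⟩ := ha
    have h2 : Algebra.lsmul ℂ ℂ N ((Ideal.Quotient.mkₐ ℂ q).toLinearMap s) x =
        L.evenHom s • x := hmod s x
    rw [h2]
    exact L.evenHom_smul_mem h_graded hs hx
  obtain ⟨d, e, e', H, H', hle, hfin⟩ := IsGradingProj.exists_hasDimMult hρ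
    hπ.isGradingProj_pairUp h1 hmul hsmul (L.adjoin_quotGen q)
    (fun i => (hρmem 1 _).2 (L.quotGen_mem q i)) (fun i hi => L.quotGen_eq_zero q hi) hr hv
  refine ⟨d, e, e', ?_, ?_, hle⟩
  · convert H using 1
    exact funext fun n => IsGradingProj.hilbertGr_eq hπ hπmem hfin n
  · convert H' using 1
    funext n
    have htr : (⨆ m ≤ n, L.symGrade m).map (Ideal.Quotient.mkₐ ℂ q).toLinearMap =
        IsGradingProj.trunc ρ n := by
      simp only [Submodule.map_iSup]
      refine le_antisymm (iSup₂_le fun m hm z hz => ?_) fun z hz => ?_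
      · rw [← (hρmem m z).2 hz]
        exact hρ.proj_mem_trunc hm z
      · rw [← hρ.sum_eq_of_mem_trunc hz]
        refine Submodule.sum_mem _ fun m hm => ?_
        refine Submodule.mem_iSup_of_mem m (Submodule.mem_iSup_of_mem
          (Nat.lt_succ_iff.1 (Finset.mem_range.1 hm)) ?_)
        exact (hρmem m _).1 (hρ.proj_self m z)
    rw [hilbertSym, htr]

variable (L q)

theorem oddBracket_comm (x y : L.part 1) : L.oddBracket x y = L.oddBracket y x := by
  refine Subtype.ext ?_
  have h := L.skew x.2 y.2
  rw [show superSign 1 1 = -1 by simp [superSign], neg_one_smul, neg_neg] at h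
  exact h

end LieSuperalgebra

end

/-! ### Clifford actions under base change and the quotient by the radical -/

noncomputable section

open Module

namespace LinearMap.BilinForm

section BaseChange

variable {k F W : Type*} [Field k] [Field F] [Algebra k F] [AddCommGroup W] [Module k W]
  {B : LinearMap.BilinForm F (F ⊗[k] W)}

theorem isSymm_of_tmul (h : ∀ x y : W, B (1 ⊗ₜ x) (1 ⊗ₜ y) = B (1 ⊗ₜ y) (1 ⊗ₜ x)) : B.IsSymm := by
  refine ⟨fun v w => ?_⟩
  have : B = B.flip := by
    ext x y
    simpa using h x y
  exact LinearMap.congr_fun₂ this v w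

theorem liftBaseChange_mul_add {M : Type*} [AddCommGroup M] [Module F M] [Module k M]
    [IsScalarTower k F M] {ρ₀ : W →ₗ[k] End F M}
    (h : ∀ x y, ρ₀ x * ρ₀ y + ρ₀ y * ρ₀ x = algebraMap F (End F M) (B (1 ⊗ₜ x) (1 ⊗ₜ y)))
    (v w : F ⊗[k] W) :
    ρ₀.liftBaseChange F v * ρ₀.liftBaseChange F w + ρ₀.liftBaseChange F w * ρ₀.liftBaseChange F v =
      algebraMap F (End F M) (B v w) := by
  induction v using TensorProduct.induction_on with
  | zero => simp
  | add v v' hv hv' =>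
    rw [map_add, add_mul, mul_add, map_add B, LinearMap.add_apply, map_add (algebraMap F (End F M)),
      ← hv, ← hv']
    abel
  | tmul a x =>
    induction w using TensorProduct.induction_on with
    | zero => simp
    | add w w' hw hw' =>
      rw [map_add, add_mul, mul_add, map_add (B _), map_add (algebraMap F (End F M)), ← hw, ← hw']
      abel
    | tmul b y =>
      have ha : (a ⊗ₜ[k] x) = a • (1 ⊗ₜ[k] x) := by simp [TensorProduct.smul_tmul']
      have hb : (b ⊗ₜ[k] y) = b • (1 ⊗ₜ[k] y) := by simp [TensorProduct.smul_tmul']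
      have hAB : B (a ⊗ₜ x) (b ⊗ₜ y) = (a * b) * B (1 ⊗ₜ x) (1 ⊗ₜ y) := by
        rw [ha, hb, map_smul B a, LinearMap.smul_apply, map_smul (B _), smul_eq_mul, smul_eq_mul,
          mul_assoc]
      rw [hAB, map_mul, ← h, LinearMap.liftBaseChange_tmul, LinearMap.liftBaseChange_tmul,
        smul_mul_smul_comm, smul_mul_smul_comm, mul_comm b a, ← smul_add, ← Algebra.smul_def]

/-- The Clifford relation holds on N over Z with values in Z. On F ⊗ N it holds for the vectors 1 ⊗
x, and it extends to F ⊗ W by bilinearity. -/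
theorem exists_baseChange_mul_add {Z N : Type*} [CommRing Z] [Algebra k Z] [Algebra Z F]
    [IsScalarTower k Z F] [AddCommGroup N] [Module k N] [Module Z N] [IsScalarTower k Z N]
    (μ : W →ₗ[k] Module.End Z N) (β : W → W → Z)
    (hμ : ∀ x y, μ x * μ y + μ y * μ x = algebraMap Z _ (β x y))
    (hβ : ∀ x y, B (1 ⊗ₜ x) (1 ⊗ₜ y) = algebraMap Z F (β x y)) :
    ∃ ρ : F ⊗[k] W →ₗ[F] Module.End F (F ⊗[Z] N),
      ∀ v w, ρ v * ρ w + ρ w * ρ v = algebraMap F _ (B v w) := by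
  let T : Module.End Z N →ₗ[k] Module.End F (F ⊗[Z] N) :=
    { toFun f := f.baseChange F
      map_add' f f' := LinearMap.baseChange_add f f'
      map_smul' c f := by
        ext n
        exact TensorProduct.tmul_smul c (1 : F) (f n) }
  refine ⟨(T.comp μ).liftBaseChange F,
    liftBaseChange_mul_add (ρ₀ := T.comp μ) fun x y => ?_⟩
  have hT : ∀ x, (T.comp μ) x = (μ x).baseChange F := fun _ => rfl
  rw [hT, hT]
  clear_value T
  rw [hβ]
  ext n
  have h1 := LinearMap.congr_fun (hμ x y) n
  have h2 : (1 : F) ⊗ₜ[Z] (μ x (μ y n)) + 1 ⊗ₜ[Z] (μ y (μ x n)) = 1 ⊗ₜ[Z] (β x y • n) := by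
    rw [← TensorProduct.tmul_add]
    exact congrArg _ h1
  simpa [Algebra.algebraMap_eq_smul_one, TensorProduct.smul_tmul'] using h2

theorem not_isSquare_prod_of_odd_baseChange [CharZero F] [FiniteDimensional k W]
    (φ : F →+* RatFunc F) (hφ : ∀ x y : W, φ (B (1 ⊗ₜ x) (1 ⊗ₜ y)) =
      RatFunc.X * RatFunc.C (B (1 ⊗ₜ x) (1 ⊗ₜ y)))
    {n : ℕ} {v : Basis (Fin n) F (F ⊗[k] W)} (hv : B.IsOrthoᵢ v)
    [Fintype {i : Fin n // B (v i) (v i) ≠ 0}]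
    (hodd : Odd (Fintype.card {i : Fin n // B (v i) (v i) ≠ 0})) :
    ¬ IsSquare (∏ i : {i : Fin n // B (v i) (v i) ≠ 0}, 2⁻¹ * B (v i) (v i)) := by
  refine not_isSquare_prod_of_odd ((finBasis k W).baseChange F) φ (fun i j => ?_) hv hodd
  rw [Basis.baseChange_apply, Basis.baseChange_apply]
  exact hφ _ _

end BaseChange

variable {F V : Type*} [Field F] [CharZero F] [AddCommGroup V] [Module F V]
  {B : LinearMap.BilinForm F V} {n : ℕ} {v : Basis (Fin n) F V}

/-- An isotropic vector of an orthogonal basis lies in the radical, which `σ` kills. So the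
anticommuting system of the other basis vectors generates `A`. -/
theorem finrank_eq_of_isSimpleModule [Fintype {i : Fin n // B (v i) (v i) ≠ 0}]
    {A : Type*} [Ring A] [Algebra F A] {σ : V →ₗ[F] A}
    (hσ : ∀ v w, σ v * σ w + σ w * σ v = algebraMap F A (B v w))
    (hrad : ∀ u, (∀ w, B u w = 0) → σ u = 0)
    (hgen : Algebra.adjoin F (Set.range σ) = ⊤) (hv : B.IsOrthoᵢ v) (hneg : IsSquare (-1 : F))
    (hodd : Odd (Fintype.card {i : Fin n // B (v i) (v i) ≠ 0}) →
      ¬ IsSquare (∏ i : {i : Fin n // B (v i) (v i) ≠ 0}, 2⁻¹ * B (v i) (v i)))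
    {M : Type*} [AddCommGroup M] [Module F M] [Module A M] [IsScalarTower F A M]
    (hM : finrank F M = 2 ^ ((finrank F (LinearMap.range B) + 1) / 2))
    (E : Type*) [AddCommGroup E] [Module F E] [Module A E] [IsScalarTower F A E]
    [IsSimpleModule A E] :
    finrank F E = 2 ^ ((finrank F (LinearMap.range B) + 1) / 2) := by
  rw [finrank_range_of_isOrthoᵢ hv] at hM ⊢
  refine (isAnticommSystem hσ hv).finrank_eq_of_isSimpleModule hneg ?_ hodd hM E
  rw [eq_top_iff, ← hgen, Algebra.adjoin_le_iff]
  rintro _ ⟨x, rfl⟩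
  rw [← v.sum_repr x, map_sum]
  refine Subalgebra.sum_mem _ fun i _ => ?_
  rw [map_smul]
  refine Subalgebra.smul_mem _ ?_ _
  by_cases hi : B (v i) (v i) = 0
  · rw [hrad _ (apply_eq_zero_of_isOrthoᵢ hv hi)]
    exact zero_mem _
  · exact Algebra.subset_adjoin ⟨⟨i, hi⟩, rfl⟩

section Clifford

variable {Q : QuadraticForm F V} {R : CliffordAlgebra Q → CliffordAlgebra Q → Prop}

/-- The factor 2⁻¹ in `Q` makes its polar form equal to `B`. -/
theorem ι_mul_ι_add (hB : B.IsSymm) (hQ : ∀ u, Q u = 2⁻¹ * B u u) (u w : V) :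
    CliffordAlgebra.ι Q u * CliffordAlgebra.ι Q w + CliffordAlgebra.ι Q w * CliffordAlgebra.ι Q u =
      algebraMap F _ (B u w) := by
  rw [CliffordAlgebra.ι_mul_ι_add_swap, QuadraticMap.polar, hQ, hQ, hQ, map_add, map_add,
    LinearMap.add_apply, LinearMap.add_apply, hB.eq u w]
  congr 1
  field_simp
  ring

/-- Suppose that a module over the Clifford algebra of `B` has the least possible dimension. Then
so have the simple modules over the quotient by the radical. -/
theorem finrank_eq_of_isSimpleModule_ringQuot [Fintype {i : Fin n // B (v i) (v i) ≠ 0}]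
    (hB : B.IsSymm) (hQ : ∀ u, Q u = 2⁻¹ * B u u)
    (hR : ∀ a b, R a b → ∃ u, (∀ w, B u w = 0) ∧ a = CliffordAlgebra.ι Q u ∧ b = 0)
    (hR' : ∀ u, (∀ w, B u w = 0) → R (CliffordAlgebra.ι Q u) 0)
    (hv : B.IsOrthoᵢ v) (hneg : IsSquare (-1 : F))
    (hodd : Odd (Fintype.card {i : Fin n // B (v i) (v i) ≠ 0}) →
      ¬ IsSquare (∏ i : {i : Fin n // B (v i) (v i) ≠ 0}, 2⁻¹ * B (v i) (v i)))
    {M : Type*} [AddCommGroup M] [Module F M] [FiniteDimensional F M] {ρ : V →ₗ[F] End F M}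
    (hρ : ∀ v w, ρ v * ρ w + ρ w * ρ v = algebraMap F _ (B v w))
    (hM : finrank F M = 2 ^ ((finrank F (LinearMap.range B) + 1) / 2))
    (E : Type*) [AddCommGroup E] [Module F E] [Module (RingQuot R) E]
    [IsScalarTower F (RingQuot R) E] [IsSimpleModule (RingQuot R) E] :
    finrank F E = 2 ^ ((finrank F (LinearMap.range B) + 1) / 2) := by
  have hsq : ∀ u, ρ u * ρ u = algebraMap F _ (Q u) := fun u => by
    rw [hQ, map_mul, ← hρ, ← two_smul F, ← Algebra.smul_def, smul_smul,
      inv_mul_cancel₀ two_ne_zero, one_smul]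
  -- The action on `M` descends to the quotient because, in the least possible dimension, the
  -- radical acts as zero.
  let Φ : RingQuot R →ₐ[F] End F M := RingQuot.liftAlgHom F
    ⟨CliffordAlgebra.lift Q ⟨ρ, hsq⟩, by
      intro a b hab
      obtain ⟨u, hu, rfl, rfl⟩ := hR a b hab
      rw [map_zero, CliffordAlgebra.lift_ι_apply]
      exact eq_zero_of_finrank_eq hρ hv hneg hodd hM hu⟩
  let σ : V →ₗ[F] RingQuot R := (RingQuot.mkAlgHom F R).toLinearMap.comp (CliffordAlgebra.ι Q)
  let _ : Module (RingQuot R) M := Module.compHom M Φ.toRingHom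
  have : IsScalarTower F (RingQuot R) M := ⟨fun c a x => by
    change Φ (c • a) x = c • Φ a x
    rw [map_smul, LinearMap.smul_apply]⟩
  refine finrank_eq_of_isSimpleModule (σ := σ) (fun u w => ?_) (fun u hu => ?_) ?_ hv hneg hodd
    hM E
  · have := congrArg (RingQuot.mkAlgHom F R) (ι_mul_ι_add (Q := Q) hB hQ u w)
    rwa [map_add, map_mul, map_mul, AlgHom.commutes] at this
  · have := RingQuot.mkAlgHom_rel F (hR' u hu)
    rwa [map_zero] at this
  · have h1 : Set.range σ = RingQuot.mkAlgHom F R '' Set.range (CliffordAlgebra.ι Q) := by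
      rw [← Set.range_comp]
      rfl
    rw [h1, ← AlgHom.map_adjoin, CliffordAlgebra.adjoin_range_ι, Algebra.map_top,
      AlgHom.range_eq_top]
    exact RingQuot.mkAlgHom_surjective F R

end Clifford

end LinearMap.BilinForm

/-! ### The generic rank of a module over a domain -/

section Localization

open nonZeroDivisors

variable {Z F N : Type*} [CommRing Z] [IsDomain Z] [Field F] [Algebra Z F] [IsFractionRing Z F]
  [AddCommGroup N] [Module Z N]

omit [IsDomain Z] in
-- A basis over the field of fractions, after clearing denominators, comes from elements of `N`.
theorem exists_linearIndependent_finrank_baseChange [Module.Finite Z N] :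
    ∃ v : Fin (finrank F (F ⊗[Z] N)) → N, LinearIndependent Z v := by
  let b := finBasis F (F ⊗[Z] N)
  have hb : LinearIndependent Z b := b.linearIndependent.restrict_scalars (by
    intro x y hxy
    simpa [Algebra.smul_def] using hxy)
  have := IsLocalizedModule.linearIndependent_lift Z⁰ (TensorProduct.mk Z F N 1) hb
  obtain ⟨w, hw⟩ := this
  exact ⟨_, hw⟩

theorem finrank_baseChange_ne_zero [Module.Finite Z N] [Nontrivial N]
    (h : ∀ z : Z, z ≠ 0 → ∀ x : N, z • x = 0 → x = 0) : finrank F (F ⊗[Z] N) ≠ 0 := by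
  obtain ⟨x, hx⟩ := exists_ne (0 : N)
  have : Nontrivial (F ⊗[Z] N) := by
    refine ⟨1 ⊗ₜ x, 0, fun h0 => ?_⟩
    obtain ⟨s, hs⟩ := (IsLocalizedModule.eq_zero_iff Z⁰ (TensorProduct.mk Z F N 1)).1 h0
    exact hx (h s (nonZeroDivisors.ne_zero s.2) x hs)
  exact (finrank_pos (R := F) (M := F ⊗[Z] N)).ne'

end Localization

end

/-! ### The bounds for gr U(g)-modules and the theorem -/

noncomputable section

open Module

namespace LieSuperalgebra

universe u v

variable {g : Type u} [AddCommGroup g] [Module ℂ g] (L : LieSuperalgebra g) (q : Ideal L.SymEven)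

theorem form_isSymm [q.IsPrime] : (L.form q).IsSymm :=
  LinearMap.BilinForm.isSymm_of_tmul fun x y => by
    rw [form_tmul, form_tmul, oddBracket_comm]

theorem isSquare_neg_one_fracField [q.IsPrime] : IsSquare (-1 : L.FracField q) :=
  ⟨algebraMap ℂ _ Complex.I, by rw [← map_mul, Complex.I_mul_I, map_neg, map_one]⟩

instance [q.IsPrime] : CharZero (L.FracField q) :=
  charZero_of_injective_algebraMap (algebraMap ℂ (L.FracField q)).injective

theorem exists_orthogonal_basis_form [FiniteDimensional ℂ g] [q.IsPrime] :
    ∃ (n : ℕ) (v : Basis (Fin n) (L.FracField q) (L.FracField q ⊗[ℂ] L.part 1)),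
      (L.form q).IsOrthoᵢ v := by
  have : Invertible (2 : L.FracField q) := invertibleOfNonzero two_ne_zero
  exact ⟨_, LinearMap.BilinForm.exists_orthogonal_basis ⟨(L.form_isSymm q).eq⟩⟩

variable {L q}

theorem IsHomogeneousIdeal.not_isSquare_prod_of_odd [FiniteDimensional ℂ g] [q.IsPrime]
    (hq : L.IsHomogeneousIdeal q) {n : ℕ}
    {v : Basis (Fin n) (L.FracField q) (L.FracField q ⊗[ℂ] L.part 1)}
    (hv : (L.form q).IsOrthoᵢ v) [Fintype {i : Fin n // L.form q (v i) (v i) ≠ 0}]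
    (hodd : Odd (Fintype.card {i : Fin n // L.form q (v i) (v i) ≠ 0})) :
    ¬ IsSquare (∏ i : {i : Fin n // L.form q (v i) (v i) ≠ 0}, 2⁻¹ * L.form q (v i) (v i)) := by
  obtain ⟨φ, hφ⟩ := hq.exists_embedding
  refine LinearMap.BilinForm.not_isSquare_prod_of_odd_baseChange φ (fun x y => ?_) hv hodd
  rw [form_tmul, one_mul, one_mul]
  exact hφ _

section OddAction

variable {N : Type v} [AddCommGroup N] [Module ℂ N] [Module L.GrEnv N] [IsScalarTower ℂ L.GrEnv N]
  [Module (L.SymEven ⧸ q) N] [IsScalarTower ℂ (L.SymEven ⧸ q) N]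

/-- The action of `g₁` on a `gr U(g)`-module, as `S(g₀)/q`-linear endomorphisms. -/
def oddAction (hmod : ∀ (s : L.SymEven) (x : N), Ideal.Quotient.mk q s • x = L.evenHom s • x) :
    L.part 1 →ₗ[ℂ] Module.End (L.SymEven ⧸ q) N where
  toFun y :=
    { toFun x := L.oddSymb y • x
      map_add' := smul_add _
      map_smul' z x := by
        obtain ⟨s, rfl⟩ := Ideal.Quotient.mk_surjective z
        rw [RingHom.id_apply, hmod, hmod, ← mul_smul, ← mul_smul, L.evenHom_mul_comm] }
  map_add' y y' := LinearMap.ext fun x => by simp [add_smul]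
  map_smul' c y := LinearMap.ext fun x => by simp

theorem oddAction_mul_add
    (hmod : ∀ (s : L.SymEven) (x : N), Ideal.Quotient.mk q s • x = L.evenHom s • x)
    (y y' : L.part 1) :
    oddAction hmod y * oddAction hmod y' + oddAction hmod y' * oddAction hmod y =
      algebraMap (L.SymEven ⧸ q) _
        (Ideal.Quotient.mk q (SymmetricAlgebra.ι ℂ _ (L.oddBracket y y'))) := by
  ext x
  change L.oddSymb y • L.oddSymb y' • x + L.oddSymb y' • L.oddSymb y • x =
    Ideal.Quotient.mk q _ • x
  rw [hmod, evenHom_ι, ← L.oddSymb_mul_add, add_smul, mul_smul, mul_smul]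

theorem exists_clifford_action [q.IsPrime]
    (hmod : ∀ (s : L.SymEven) (x : N), Ideal.Quotient.mk q s • x = L.evenHom s • x) :
    ∃ ρ : L.FracField q ⊗[ℂ] L.part 1 →ₗ[L.FracField q]
        Module.End (L.FracField q) (L.FracField q ⊗[L.SymEven ⧸ q] N),
      ∀ v w, ρ v * ρ w + ρ w * ρ v = algebraMap (L.FracField q) _ (L.form q v w) := by
  refine LinearMap.BilinForm.exists_baseChange_mul_add (oddAction hmod) _
    (oddAction_mul_add hmod) fun x y => ?_
  rw [form_tmul, one_mul, one_mul]
  rfl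

theorem isSplit_of_finrank_eq [FiniteDimensional ℂ g] [q.IsPrime] (hq : L.IsHomogeneousIdeal q)
    {M : Type*} [AddCommGroup M] [Module (L.FracField q) M] [FiniteDimensional (L.FracField q) M]
    {ρ : L.FracField q ⊗[ℂ] L.part 1 →ₗ[L.FracField q] Module.End (L.FracField q) M}
    (hρ : ∀ v w, ρ v * ρ w + ρ w * ρ v = algebraMap (L.FracField q) _ (L.form q v w))
    (hM : finrank (L.FracField q) M = 2 ^ L.ell q) : L.IsSplit q := by
  classical
  intro E _ _ _ _ _
  obtain ⟨n, v, hv⟩ := L.exists_orthogonal_basis_form q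
  refine LinearMap.BilinForm.finrank_eq_of_isSimpleModule_ringQuot (Q := L.quadForm q)
    (R := L.RadRel q) (L.form_isSymm q) (fun u => rfl) ?_ (fun u hu => RadRel.mk u hu) hv
    (L.isSquare_neg_one_fracField q) (hq.not_isSquare_prod_of_odd hv) hρ hM E
  rintro _ _ ⟨u, hu⟩
  exact ⟨u, hu, rfl, rfl⟩

theorem two_pow_ell_le_finrank [FiniteDimensional ℂ g] [q.IsPrime] (hq : L.IsHomogeneousIdeal q)
    {M : Type*} [AddCommGroup M] [Module (L.FracField q) M] [FiniteDimensional (L.FracField q) M]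
    [Nontrivial M]
    {ρ : L.FracField q ⊗[ℂ] L.part 1 →ₗ[L.FracField q] Module.End (L.FracField q) M}
    (hρ : ∀ v w, ρ v * ρ w + ρ w * ρ v = algebraMap (L.FracField q) _ (L.form q v w)) :
    2 ^ L.ell q ≤ finrank (L.FracField q) M := by
  classical
  obtain ⟨n, v, hv⟩ := L.exists_orthogonal_basis_form q
  exact LinearMap.BilinForm.two_pow_le_finrank hρ hv (L.isSquare_neg_one_fracField q)
    (hq.not_isSquare_prod_of_odd hv)

/-- With r the generic rank, 2^ℓ(q) e' ≤ r e' ≤ e. Equality of the outer terms and e' > 0 force r =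
2^ℓ(q), the least dimension of a Clifford module, and then C_q is split. -/
theorem IsHomogeneousIdeal.exists_hasDimMult_ell [FiniteDimensional ℂ g] [q.IsPrime]
    (hq : L.IsHomogeneousIdeal q)
    {𝒩 : ℕ → Submodule ℂ N} (h_internal : DirectSum.IsInternal 𝒩)
    (h_graded : ∀ (i j : ℕ) (a : L.envFiltration.Piece i) (x : N), x ∈ 𝒩 j →
      DirectSum.of L.envFiltration.Piece i a • x ∈ 𝒩 (i + j))
    [Module.Finite (L.SymEven ⧸ q) N] [Nontrivial N]
    (hmod : ∀ (s : L.SymEven) (x : N), Ideal.Quotient.mk q s • x = L.evenHom s • x)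
    (htf : L.IsTorsionFreeMod q N) :
    ∃ (d : ℕ) (e e' : ℚ), HasDimMult (hilbertGr 𝒩) d e ∧ HasDimMult (L.hilbertSym q) d e' ∧
      2 ^ L.ell q * e' ≤ e ∧ (e = 2 ^ L.ell q * e' → L.IsSplit q) := by
  have hr : finrank (L.FracField q) (L.FracField q ⊗[L.SymEven ⧸ q] N) ≠ 0 := by
    refine finrank_baseChange_ne_zero fun z hz x hx => ?_
    obtain ⟨s, rfl⟩ := Ideal.Quotient.mk_surjective z
    rw [hmod] at hx
    exact htf s (fun hs => hz (Ideal.Quotient.eq_zero_iff_mem.2 hs)) x hx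
  obtain ⟨w, hw⟩ := exists_linearIndependent_finrank_baseChange (Z := L.SymEven ⧸ q)
    (F := L.FracField q) (N := N)
  obtain ⟨d, e, e', H, H', hle⟩ := hq.exists_hasDimMult h_internal h_graded hmod hr hw
  obtain ⟨ρ, hρ⟩ := exists_clifford_action (N := N) hmod
  have : Nontrivial (L.FracField q ⊗[L.SymEven ⧸ q] N) :=
    nontrivial_of_finrank_pos (R := L.FracField q) (Nat.pos_of_ne_zero hr)
  have hell := two_pow_ell_le_finrank hq hρ
  have hpos := H'.pos
  have hell' : (2 ^ L.ell q : ℚ) ≤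
      finrank (L.FracField q) (L.FracField q ⊗[L.SymEven ⧸ q] N) := by exact_mod_cast hell
  refine ⟨d, e, e', H, H', (mul_le_mul_of_nonneg_right hell' hpos.le).trans hle, fun he => ?_⟩
  refine isSplit_of_finrank_eq hq hρ (le_antisymm ?_ hell)
  rw [he] at hle
  exact_mod_cast le_of_mul_le_mul_right hle hpos

end OddAction

end LieSuperalgebra

end

theorem lemma5p1 {g : Type*} [AddCommGroup g] [Module ℂ g] [FiniteDimensional ℂ g]
    (L : LieSuperalgebra g)
    {N : Type*} [AddCommGroup N] [Module ℂ N] [Module L.GrEnv N] [IsScalarTower ℂ L.GrEnv N]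
    [Module.Finite L.GrEnv N]
    (𝒩 : ℕ → Submodule ℂ N) (h_internal : DirectSum.IsInternal 𝒩)
    (h_graded : ∀ (i j : ℕ) (a : L.envFiltration.Piece i) (x : N), x ∈ 𝒩 j →
      DirectSum.of L.envFiltration.Piece i a • x ∈ 𝒩 (i + j))
    (q : Ideal L.SymEven) [q.IsPrime] (hq : q = L.evenAnnihilator N)
    (h_torsionFree : L.IsTorsionFreeMod q N) :
    ∃ (dN dZ : ℕ) (eN eZ : ℚ),
      HasDimMult (hilbertGr 𝒩) dN eN ∧
      HasDimMult (L.hilbertSym q) dZ eZ ∧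
      dN = dZ ∧
      2 ^ L.ell q * eZ ≤ eN ∧
      (eN = 2 ^ L.ell q * eZ → L.IsSplit q) := by
  have hom : L.IsHomogeneousIdeal q := by
    rw [hq]
    exact L.isHomogeneousIdeal_evenAnnihilator h_graded h_internal
  let _ : Module L.SymEven N := Module.compHom N L.evenHom.toRingHom
  have htors : Module.IsTorsionBySet L.SymEven N q := fun x s => by
    have hs : (s : L.SymEven) ∈ L.evenAnnihilator N := hq ▸ s.2
    exact Module.mem_annihilator.1 hs x
  let _ : Module (L.SymEven ⧸ q) N := htors.module
  have hmod : ∀ (s : L.SymEven) (x : N), Ideal.Quotient.mk q s • x = L.evenHom s • x :=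
    fun s x => rfl
  have : IsScalarTower ℂ (L.SymEven ⧸ q) N := ⟨fun c z x => by
    obtain ⟨s, rfl⟩ := Ideal.Quotient.mk_surjective z
    change L.evenHom (c • s) • x = c • L.evenHom s • x
    rw [map_smul, smul_assoc]⟩
  have : IsScalarTower L.SymEven (L.SymEven ⧸ q) N := htors.isScalarTower
  have : Module.Finite L.SymEven N := L.finite_symEven N fun _ _ => rfl
  have : Module.Finite (L.SymEven ⧸ q) N := Module.Finite.of_restrictScalars_finite L.SymEven _ N
  -- A prime ideal is proper, whereas the annihilator of the zero module is not.
  have : Nontrivial N := by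
    by_contra h
    rw [not_nontrivial_iff_subsingleton] at h
    refine Ideal.IsPrime.ne_top (I := q) ‹_› ((Ideal.eq_top_iff_one q).2 ?_)
    rw [hq]
    exact Module.mem_annihilator.2 fun x => Subsingleton.elim _ _
  obtain ⟨d, e, e', H, H', hle, hsplit⟩ :=
    hom.exists_hasDimMult_ell h_internal h_graded hmod h_torsionFree
  exact ⟨d, d, e, e', H, H', rfl, hle, hsplit⟩
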